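/- Lemma 2 (Long-term network dynamics). Consider $N\ge 1$ agents, where agent $k$ has a twice-differentiable cost $J_k:\mathbb{R}^M\to\mathbb{R}$ with $0<\nu_d I_M\le\nabla^2J_k(w)\le\delta_d I_M$ for all $w$; all the $J_k$ share the minimizer $w^o$, and $\|\nabla^2J_k(w^o+\Delta w)-\nabla^2J_k(w^o)\|\le\kappa_c\|\Delta w\|$ whenever $\|\Delta w\|\le\varepsilon$, for some $\kappa_c\ge0$ and $\varepsilon>0$. Let $A_1=[a_{1,\ell k}]$ and $A_2=[a_{2,\ell k}]$ be left-stochastic $N\times N$ matrices whose product $P=A_1A_2$ is primitive. From random initial vectors $w_{k,-1}$ with finite fourth moments the agents run, for $i\ge0$, the coordinate-descent diffusion strategy $$\phi_{k,i-1}=\sum_{\ell}a_{1,\ell k}w_{\ell,i-1},\qquad \psi_{k,i}=\phi_{k,i-1}-\mu_k\Gamma_{k,i}\widehat{\nabla J}_{k,i}(\phi_{k,i-1}),\qquad w_{k,i}=\sum_{\ell}a_{2,\ell k}\psi_{\ell,i},$$ with $\Gamma_{k,i}=\mathrm{diag}\{r_{k,i}(1),\dots,r_{k,i}(M)\}$,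 $r_{k,i}(m)\in\{0,1\}$ and $\mathrm{Prob}(r_{k,i}(m)=0)=r_k\in[0,1)$. The step-sizes are $\mu_k=\tau_k\mu_{\max}$ with fixed ratios $\tau_k>0$, $\max_k\tau_k=1$. Let $\mathcal F_{i-1}$ be generated by all $w_{k,j}$ and $\Gamma_{k,j}$ with $j\le i-1$, and let $s_{k,i}(w)=\widehat{\nabla J}_{k,i}(w)-\nabla J_k(w)$ be the gradient noise. Assume that, for every $i$, the indicators $r_{k,i}(m)$ are independent of each other; that, for all agents $k$ and all $\mathcal F_{i-1}$-measurable vectors $w$ with finite fourth moment, the collection of all indicators of iteration $i$ is independent of $\mathcal F_{i-1}$ and $\widehat{\nabla J}_{k,i}(w)$; and that, for all such $w$, the noise $s_{k,i}(w)$ has a finite fourth moment and almost surely $$\mathbb E[s_{k,i}(w)|\mathcal F_{i-1}]=0,\qquad \mathbb E[s_{k,i}(w)s_{\ell,i}(w)^{\sf T}|\mathcal F_{i-1}]=0\ (k\ne\ell),\qquad \mathbb E[\|s_{k,i}(w)\|^4|\mathcal F_{i-1}]\le\beta_k^4\|w\|^4+\sigma_{s,k}^4 .$$ Let $\widetilde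 w_i=\mathrm{col}\{w^o-w_{k,i}\}_k$, $s_i=\mathrm{col}\{s_{k,i}(\phi_{k,i-1})\}_k$, $\mathcal A_j=A_j\otimes I_M$, $\mathcal M=\mathrm{diag}\{\mu_k\}\otimes I_M$, $\Gamma_i=\mathrm{diag}\{\Gamma_{k,i}\}$ and $\mathcal H=\mathrm{diag}\{H_1,\dots,H_N\}$ with $H_k=\nabla^2J_k(w^o)$. Consider the long-term model $$\widetilde w_i'=\mathcal A_2^{\sf T}(I-\mathcal M\Gamma_i\mathcal H)\mathcal A_1^{\sf T}\,\widetilde w_{i-1}'+\mathcal A_2^{\sf T}\mathcal M\Gamma_is_i,\qquad i\ge i_0,$$ run from an arbitrary iteration $i_0$ with an arbitrary $\mathcal F_{i_0-1}$-measurable starting value $\widetilde w'_{i_0-1}$ of finite fourth moment (for instance $\widetilde w_{i_0-1}$). Then the model approximates the error dynamics: for all sufficiently small $\mu_{\max}$ and all $k$, $$\limsup_{i\to\infty}\mathbb E\|\widetilde w_{k,i}'\|^2=O(\mu_{\max}),\qquad \limsup_{i\to\infty}\mathbb E\|\widetilde w_{k,i}'\|^4=O(\mu_{\max}^2),$$ $$\limsup_{i\to\infty}\mathbb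 E\|\widetilde w_i'\|^2=\limsup_{i\to\infty}\mathbb E\|\widetilde w_i\|^2+O(\mu_{\max}^{3/2}),\qquad \limsup_{i\to\infty}\mathbb E\|\widetilde w_i-\widetilde w_i'\|^2=O(\mu_{\max}^2).$$ The constants in the $O(\cdot)$ and the bound on $\mu_{\max}$ depend only on $N$, $M$, $A_1$, $A_2$, the $J_k$, $w^o$, $\nu_d$, $\delta_d$, $\kappa_c$, $\varepsilon$, $r_k$, $\beta_k$, $\sigma_{s,k}$ and $\tau_k$. -/

import Mathlib

open MeasureTheory ProbabilityTheory Filter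
open scoped Matrix Kronecker ENNReal

noncomputable section

/-- Parameter vectors in `ℝ^M`, with the Euclidean norm. -/
abbrev Vec (M : ℕ) := EuclideanSpace ℝ (Fin M)

/-- Block vectors in `ℝ^{NM}` (`N` blocks of size `M`), with the Euclidean norm. -/
abbrev BVec (N M : ℕ) := EuclideanSpace ℝ (Fin N × Fin M)

/-- Square matrices acting on block vectors. -/
abbrev BMat (N M : ℕ) := Matrix (Fin N × Fin M) (Fin N × Fin M) ℝ

/-- `col{x_1, …, x_N}`. -/
def blockCol {N M : ℕ} (x : Fin N → Vec M) : BVec N M :=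
  WithLp.toLp 2 fun p => x p.1 p.2

/-- The `k`-th block of a block vector. -/
def block {N M : ℕ} (k : Fin N) (x : BVec N M) : Vec M :=
  WithLp.toLp 2 fun m => x (k, m)

/-- `diag{X_1, …, X_N}`. -/
def blockDiag {N M : ℕ} (X : Fin N → Matrix (Fin M) (Fin M) ℝ) : BMat N M :=
  Matrix.of fun p q => if p.1 = q.1 then X p.1 p.2 q.2 else 0

/-- The Hessian matrix `∇²J(w)`. -/
def hessian {M : ℕ} (J : Vec M → ℝ) (w : Vec M) : Matrix (Fin M) (Fin M) ℝ :=
  Matrix.of fun a b =>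
    fderiv ℝ (fderiv ℝ J) w (EuclideanSpace.single a 1) (EuclideanSpace.single b 1)

/-- `J` is twice differentiable with `ν I ≤ ∇²J(w) ≤ δ I` for all `w`. -/
structure HessianBounds {M : ℕ} (J : Vec M → ℝ) (ν δ : ℝ) : Prop where
  differentiable : Differentiable ℝ J
  twice_differentiable : Differentiable ℝ (fderiv ℝ J)
  lower : ∀ w, (hessian J w - ν • (1 : Matrix (Fin M) (Fin M) ℝ)).PosSemidef
  upper : ∀ w, (δ • (1 : Matrix (Fin M) (Fin M) ℝ) - hessian J w).PosSemidef

/-- The Hessian of `J` is Lipschitz at `wo` on the ball of radius `ε`, in the two-induced norm. -/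
def HessianLocallyLipschitz {M : ℕ} (J : Vec M → ℝ) (wo : Vec M) (κ ε : ℝ) : Prop :=
  ∀ d : Vec M, ‖d‖ ≤ ε →
    ‖Matrix.toEuclideanCLM (n := Fin M) (𝕜 := ℝ) (hessian J (wo + d) - hessian J wo)‖ ≤ κ * ‖d‖

/-- The random quantities that drive the algorithm. The iterations are `i = 0, 1, 2, …`. -/
structure Inputs (N M : ℕ) (Ω : Type*) where
  /-- the initial estimates `w_{k,-1}` -/
  init : Fin N → Ω → Vec M
  /-- the approximate gradient of agent `k` at iteration `i`, as a random function of `w` -/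
  gradHat : Fin N → ℕ → Vec M → Ω → Vec M
  /-- the indicator variable `r_{k,i}(m)` -/
  ind : Fin N → ℕ → Fin M → Ω → ℝ

section Algorithm

variable {N M : ℕ} {Ω : Type*}

/-- The combination `∑_ℓ a_{ℓk} x_ℓ` at agent `k`. -/
def combine (A : Matrix (Fin N) (Fin N) ℝ) (x : Fin N → Vec M) (k : Fin N) : Vec M :=
  ∑ l, A l k • x l

/-- `Γ_{k,i} = diag{r_{k,i}(1), …, r_{k,i}(M)}`. -/
def Inputs.Gam (S : Inputs N M Ω) (k : Fin N) (i : ℕ) (ω : Ω) : Matrix (Fin M) (Fin M) ℝ :=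
  Matrix.diagonal fun m => S.ind k i m ω

/-- The estimates held by the agents just before iteration `i`, that is `w_{k,i-1}`, for the
coordinate-descent diffusion strategy with step-sizes `μ`. -/
def est (A₁ A₂ : Matrix (Fin N) (Fin N) ℝ) (μ : Fin N → ℝ) (S : Inputs N M Ω) :
    ℕ → Fin N → Ω → Vec M
  | 0 => S.init
  | i + 1 => fun k ω =>
      let φ : Fin N → Vec M := combine A₁ fun l => est A₁ A₂ μ S i l ω
      let ψ : Fin N → Vec M := fun l =>
        φ l - μ l • Matrix.toEuclideanLin (S.Gam l i ω) (S.gradHat l i (φ l) ω)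
      combine A₂ ψ k

/-- The intermediate estimate `φ_{k,i-1}` formed at the start of iteration `i`. -/
def phi (A₁ A₂ : Matrix (Fin N) (Fin N) ℝ) (μ : Fin N → ℝ) (S : Inputs N M Ω)
    (i : ℕ) (k : Fin N) (ω : Ω) : Vec M :=
  combine A₁ (fun l => est A₁ A₂ μ S i l ω) k

/-- The past just before iteration `i`, that is `F_{i-1}`: it is generated by the estimates
`w_{k,-1}, …, w_{k,i-1}` and the indicators `Γ_{k,0}, …, Γ_{k,i-1}` of all agents. -/
@[reducible] def past (A₁ A₂ : Matrix (Fin N) (Fin N) ℝ) (μ : Fin N → ℝ) (S : Inputs N M Ω) (i : ℕ) :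
    MeasurableSpace Ω :=
  (⨆ j : ℕ, ⨆ _ : j ≤ i, ⨆ k : Fin N,
      MeasurableSpace.comap (est A₁ A₂ μ S j k) inferInstance) ⊔
  (⨆ j : ℕ, ⨆ _ : j < i, ⨆ k : Fin N, ⨆ m : Fin M,
      MeasurableSpace.comap (S.ind k j m) inferInstance)

/-- The σ-algebra generated by all the indicator variables of iteration `i`. -/
@[reducible] def indSigma (S : Inputs N M Ω) (i : ℕ) : MeasurableSpace Ω :=
  ⨆ k : Fin N, ⨆ m : Fin M, MeasurableSpace.comap (S.ind k i m) inferInstance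

/-- The gradient noise `s_{k,i}(w)`. -/
def gradNoise (J : Fin N → Vec M → ℝ) (S : Inputs N M Ω) (k : Fin N) (i : ℕ) (w : Vec M) (ω : Ω) :
    Vec M :=
  S.gradHat k i w ω - gradient (J k) w

/-- `x` is an iterate determined by the past of iteration `i`, with a finite fourth moment. -/
def IsIterate [MeasurableSpace Ω] (P : Measure Ω)
    (A₁ A₂ : Matrix (Fin N) (Fin N) ℝ) (μ : Fin N → ℝ) (S : Inputs N M Ω) (i : ℕ)
    {E : Type*} [NormedAddCommGroup E] [MeasurableSpace E] (x : Ω → E) : Prop :=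
  Measurable[past A₁ A₂ μ S i] x ∧ MemLp x 4 P

/-- Measurability of the inputs, and finite fourth moments of the initial estimates. -/
structure Inputs.Regular [MeasurableSpace Ω] (S : Inputs N M Ω) (P : Measure Ω) : Prop where
  measurable_init : ∀ k, Measurable (S.init k)
  memLp_init : ∀ k, MemLp (S.init k) 4 P
  measurable_gradHat : ∀ k i, Measurable (Function.uncurry (S.gradHat k i))
  measurable_ind : ∀ k i m, Measurable (S.ind k i m)

/-- The indicator variables: they are zero or one, `r_{k,i}(m)` vanishes with probability `r k`,
those of one iteration are independent of each other, and together they are independent of the past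
and of the approximate gradient of any agent at any iterate. -/
structure IndicatorConditions [MeasurableSpace Ω] (P : Measure Ω)
    (A₁ A₂ : Matrix (Fin N) (Fin N) ℝ) (μ : Fin N → ℝ) (r : Fin N → ℝ) (S : Inputs N M Ω) :
    Prop where
  zero_or_one : ∀ k i m ω, S.ind k i m ω = 0 ∨ S.ind k i m ω = 1
  prob_zero : ∀ k i m, P {ω | S.ind k i m ω = 0} = ENNReal.ofReal (r k)
  indep : ∀ i, Pairwise fun a b : Fin N × Fin M => S.ind a.1 i a.2 ⟂ᵢ[P] S.ind b.1 i b.2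
  indep_past : ∀ (i : ℕ) (x : Ω → Vec M), IsIterate P A₁ A₂ μ S i x → ∀ k,
    Indep (indSigma S i)
      (past A₁ A₂ μ S i ⊔ MeasurableSpace.comap (fun ω => S.gradHat k i (x ω) ω) inferInstance) P

/-- The gradient noise at any iterate is conditionally zero-mean, uncorrelated across agents, and
has a conditional fourth moment bounded by `β_k⁴ ‖w‖⁴ + σ_k⁴`. The first field says that the
moments in question exist. -/
structure NoiseConditions [MeasurableSpace Ω] (P : Measure Ω)
    (A₁ A₂ : Matrix (Fin N) (Fin N) ℝ) (μ : Fin N → ℝ) (J : Fin N → Vec M → ℝ)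
    (β σ : Fin N → ℝ) (S : Inputs N M Ω) : Prop where
  memLp : ∀ (i : ℕ) (x : Ω → Vec M), IsIterate P A₁ A₂ μ S i x → ∀ k,
    MemLp (fun ω => gradNoise J S k i (x ω) ω) 4 P
  mean_zero : ∀ (i : ℕ) (x : Ω → Vec M), IsIterate P A₁ A₂ μ S i x → ∀ k,
    P[fun ω => gradNoise J S k i (x ω) ω | past A₁ A₂ μ S i] =ᵐ[P] 0
  uncorrelated : ∀ (i : ℕ) (x : Ω → Vec M), IsIterate P A₁ A₂ μ S i x → ∀ k l, k ≠ l → ∀ m n,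
    P[fun ω => gradNoise J S k i (x ω) ω m * gradNoise J S l i (x ω) ω n | past A₁ A₂ μ S i]
      =ᵐ[P] 0
  fourth_moment : ∀ (i : ℕ) (x : Ω → Vec M), IsIterate P A₁ A₂ μ S i x → ∀ k,
    P[fun ω => ‖gradNoise J S k i (x ω) ω‖ ^ 4 | past A₁ A₂ μ S i]
      ≤ᵐ[P] fun ω => β k ^ 4 * ‖x ω‖ ^ 4 + σ k ^ 4

/-- The network error vector just before iteration `i`: `col{wo - w_{k,i-1}}`. -/
def netError (A₁ A₂ : Matrix (Fin N) (Fin N) ℝ) (μ : Fin N → ℝ) (wo : Vec M) (S : Inputs N M Ω)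
    (i : ℕ) (ω : Ω) : BVec N M :=
  blockCol fun k => wo - est A₁ A₂ μ S i k ω

/-- The network noise vector `s_i = col{s_{k,i}(φ_{k,i-1})}`. -/
def netNoise (A₁ A₂ : Matrix (Fin N) (Fin N) ℝ) (μ : Fin N → ℝ) (J : Fin N → Vec M → ℝ)
    (S : Inputs N M Ω) (i : ℕ) (ω : Ω) : BVec N M :=
  blockCol fun k => gradNoise J S k i (phi A₁ A₂ μ S i k ω) ω

/-- `A ⊗ I_M`. -/
def calA (M : ℕ) (A : Matrix (Fin N) (Fin N) ℝ) : BMat N M :=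
  A ⊗ₖ (1 : Matrix (Fin M) (Fin M) ℝ)

/-- `diag{μ_1, …, μ_N} ⊗ I_M`. -/
def calM (M : ℕ) (μ : Fin N → ℝ) : BMat N M :=
  Matrix.diagonal μ ⊗ₖ (1 : Matrix (Fin M) (Fin M) ℝ)

/-- `diag{Γ_{1,i}, …, Γ_{N,i}}`. -/
def Inputs.calGam (S : Inputs N M Ω) (i : ℕ) (ω : Ω) : BMat N M :=
  blockDiag fun k => S.Gam k i ω

/-- `diag{H_1, …, H_N}` with the fixed Hessians `H_k = ∇²J_k(wo)`. -/
def calH (J : Fin N → Vec M → ℝ) (wo : Vec M) : BMat N M :=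
  blockDiag fun k => hessian (J k) wo

/-- The coefficient matrix `B'_i` of the long-term model. -/
def calB' (A₁ A₂ : Matrix (Fin N) (Fin N) ℝ) (μ : Fin N → ℝ) (J : Fin N → Vec M → ℝ)
    (wo : Vec M) (S : Inputs N M Ω) (i : ℕ) (ω : Ω) : BMat N M :=
  (calA M A₂)ᵀ * (1 - calM M μ * S.calGam i ω * calH J wo) * (calA M A₁)ᵀ

/-- `w'` is a trajectory of the long-term model run from iteration `i₀` on: its starting value is
determined by the past and has a finite fourth moment, and it is driven by the same indicators and
the same gradient noise as the diffusion strategy. As for `netError`, `w' i` is the value just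
before iteration `i`. -/
structure IsLongTermModel [MeasurableSpace Ω] (P : Measure Ω)
    (A₁ A₂ : Matrix (Fin N) (Fin N) ℝ) (μ : Fin N → ℝ) (J : Fin N → Vec M → ℝ) (wo : Vec M)
    (S : Inputs N M Ω) (i₀ : ℕ) (w' : ℕ → Ω → BVec N M) : Prop where
  start : IsIterate P A₁ A₂ μ S i₀ (w' i₀)
  step : ∀ i, i₀ ≤ i → ∀ ω,
    w' (i + 1) ω =
      Matrix.toEuclideanLin (calB' A₁ A₂ μ J wo S i ω) (w' i ω) +
      Matrix.toEuclideanLin ((calA M A₂)ᵀ * calM M μ * S.calGam i ω)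
        (netNoise A₁ A₂ μ J S i ω)

/-- The asymptotic moment `limsup_i E ‖X_i‖^p`, with values in `[0, ∞]`. -/
def limsupMoment [MeasurableSpace Ω] (P : Measure Ω) {E : Type*} [NormedAddCommGroup E]
    (p : ℕ) (X : ℕ → Ω → E) : ℝ≥0∞ :=
  limsup (fun i => ∫⁻ ω, ‖X i ω‖ₑ ^ p ∂P) atTop

end Algorithm

end

/-!
Write `x = wo - w` for the errors of the agents. The network error, the long-term model and their
difference are all of the form `x⁺ = A₂ᵀ (A₁ᵀ x - μ τ Γ h)` (`Splitting.step`), with `h = G(φ) - s`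
for the error (`G` the gradient field in terms of the error), `h = H φ - s` for the model (`H` its
linearization, `s` the same noise), and `h = H φ + e` for the difference, where the noise cancels
and `e = G(φ) - H φ` is quadratic in the network error. Both `G` and `H` are Lipschitz and strongly
monotone with respect to the origin (`RestoringField`), and nothing else about them is used.

Since `P = A₁ A₂` is primitive, the state splits (`exists_splitting`) into its centroid `u` with
respect to the stationary weights of `P`, which the combination steps preserve, and a disagreement
`q`, which they contract by a fixed factor. The selection matrices are independent of the past and
of the approximate gradients, so on average they act as scalars (`integral_inner_gam`), and the
noise averages out; the drift therefore pulls the centroid back at the rate `μ`. Expanding the norms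
and absorbing all error terms for small `μ` yields one-step inequalities for `V_n = ‖u‖ⁿ + qⁿ`
(`exists_fourth_moment_drift`, `exists_second_moment_drift`):

* `E V₄⁺ ≤ (1 - a μ) E V₄ + b μ³ E ‖s‖⁴` for the error and for the model,
* `E V₂⁺ ≤ (1 - a μ) E V₂ + b μ E ‖e‖²` for the difference.

The fourth moment of the noise is at most a constant plus a multiple of `E V₄` of the network error,
so `E V₄ = O(μ²)` in the long run, first for the error and then for the model. Hence
`E ‖e‖² = O(μ²)`, and the difference has second moment `O(μ²)`. Second moments of order `μ` follow
from fourth moments of order `μ²`, and the comparison of the mean-square errors up to `O(μ^{3/2})`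
follows from the triangle inequality with the weights `1 + √μ` and `1 + 1/√μ`.
-/

noncomputable section

/-! ### Combination steps and the stationary weights -/

section Combination

variable {N M : ℕ}

lemma combine_mul (A B : Matrix (Fin N) (Fin N) ℝ) (x : Fin N → Vec M) :
    combine (A * B) x = combine B (combine A x) := by
  funext k
  simp only [combine, Matrix.mul_apply, Finset.sum_smul, Finset.smul_sum, smul_smul]
  rw [Finset.sum_comm]
  simp only [mul_comm]

lemma combine_one (x : Fin N → Vec M) : combine 1 x = x := by
  funext k
  simp [combine, Matrix.one_apply, ite_smul]

lemma combine_add (A : Matrix (Fin N) (Fin N) ℝ) (x y : Fin N → Vec M) :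
    combine A (x + y) = combine A x + combine A y := by
  funext k
  simp [combine, Finset.sum_add_distrib]

lemma combine_sub (A : Matrix (Fin N) (Fin N) ℝ) (x y : Fin N → Vec M) :
    combine A (x - y) = combine A x - combine A y := by
  funext k
  simp [combine, smul_sub, Finset.sum_sub_distrib]

lemma combine_const {A : Matrix (Fin N) (Fin N) ℝ} (hA : A ∈ Matrix.colStochastic ℝ (Fin N))
    (v : Vec M) : combine A (fun _ => v) = fun _ => v := by
  funext k
  rw [combine, ← Finset.sum_smul, Matrix.sum_col_of_mem_colStochastic hA, one_smul]

/-- Averaging with weights `a` that are nonnegative and sum to one does not increase norms. -/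
lemma norm_sum_smul_le {a : Fin N → ℝ} (ha : ∀ k, 0 ≤ a k) (ha1 : ∑ k, a k = 1)
    {x : Fin N → Vec M} {b : ℝ} (hx : ∀ k, ‖x k‖ ≤ b) : ‖∑ k, a k • x k‖ ≤ b := by
  calc ‖∑ k, a k • x k‖ ≤ ∑ k, ‖a k • x k‖ := norm_sum_le _ _
    _ ≤ ∑ k, a k * b := by
        refine Finset.sum_le_sum fun k _ => ?_
        rw [norm_smul, Real.norm_of_nonneg (ha k)]
        exact mul_le_mul_of_nonneg_left (hx k) (ha k)
    _ = b := by rw [← Finset.sum_mul, ha1, one_mul]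

lemma norm_combine_apply_le {A : Matrix (Fin N) (Fin N) ℝ}
    (hA : A ∈ Matrix.colStochastic ℝ (Fin N)) {x : Fin N → Vec M} {b : ℝ}
    (hx : ∀ k, ‖x k‖ ≤ b) (k : Fin N) : ‖combine A x k‖ ≤ b :=
  norm_sum_smul_le (fun _ => Matrix.nonneg_of_mem_colStochastic hA)
    (Matrix.sum_col_of_mem_colStochastic hA k) hx

lemma norm_combine_le {A : Matrix (Fin N) (Fin N) ℝ}
    (hA : A ∈ Matrix.colStochastic ℝ (Fin N)) (x : Fin N → Vec M) : ‖combine A x‖ ≤ ‖x‖ :=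
  (pi_norm_le_iff_of_nonneg (norm_nonneg _)).2
    fun k => norm_combine_apply_le hA (fun l => norm_le_pi_norm x l) k

/-- The weighted average `∑_k a_k x_k` of the blocks. -/
def centroid (a : Fin N → ℝ) (x : Fin N → Vec M) : Vec M := ∑ k, a k • x k

lemma centroid_add (a : Fin N → ℝ) (x y : Fin N → Vec M) :
    centroid a (x + y) = centroid a x + centroid a y := by
  simp [centroid, Finset.sum_add_distrib]

lemma centroid_sub (a : Fin N → ℝ) (x y : Fin N → Vec M) :
    centroid a (x - y) = centroid a x - centroid a y := by
  simp [centroid, smul_sub, Finset.sum_sub_distrib]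

lemma continuous_centroid (a : Fin N → ℝ) :
    Continuous (centroid a : (Fin N → Vec M) → Vec M) := by
  unfold centroid; fun_prop

lemma continuous_combine (A : Matrix (Fin N) (Fin N) ℝ) :
    Continuous (combine A : (Fin N → Vec M) → Fin N → Vec M) := by
  unfold combine; fun_prop

lemma centroid_combine (a : Fin N → ℝ) (A : Matrix (Fin N) (Fin N) ℝ) (x : Fin N → Vec M) :
    centroid a (combine A x) = centroid (A *ᵥ a) x := by
  simp only [centroid, combine, Matrix.mulVec, dotProduct, Finset.sum_smul, Finset.smul_sum,
    smul_smul]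
  rw [Finset.sum_comm]
  simp only [mul_comm]

lemma norm_centroid_le {a : Fin N → ℝ} (ha : ∀ k, 0 ≤ a k) (ha1 : ∑ k, a k = 1)
    (x : Fin N → Vec M) : ‖centroid a x‖ ≤ ‖x‖ :=
  norm_sum_smul_le ha ha1 fun k => norm_le_pi_norm x k

/-- A column-stochastic matrix has a stationary probability vector: if `P v = v` with `v ≠ 0`, then
`P |v| ≥ |v|` entrywise, and equality holds because the column sums are one. -/
lemma exists_stationary [NeZero N] {P : Matrix (Fin N) (Fin N) ℝ}
    (hP : P ∈ Matrix.colStochastic ℝ (Fin N)) :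
    ∃ a : Fin N → ℝ, (∀ k, 0 ≤ a k) ∧ ∑ k, a k = 1 ∧ P *ᵥ a = a := by
  have hdet : (P - 1).det = 0 := by
    refine Matrix.exists_vecMul_eq_zero_iff.1 ⟨1, one_ne_zero, ?_⟩
    rw [Matrix.vecMul_sub, Matrix.one_vecMul_of_mem_colStochastic hP, Matrix.vecMul_one, sub_self]
  obtain ⟨v, hv0, hv⟩ := Matrix.exists_mulVec_eq_zero_iff.2 hdet
  have hPv : P *ᵥ v = v := by
    rwa [Matrix.sub_mulVec, Matrix.one_mulVec, sub_eq_zero] at hv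
  set w : Fin N → ℝ := fun k => |v k| with hw
  have hle : ∀ k ∈ Finset.univ, w k ≤ (P *ᵥ w) k := fun k _ => by
    calc w k = |(P *ᵥ v) k| := by rw [hPv]
      _ ≤ ∑ l, |P k l * v l| := by
        rw [Matrix.mulVec, dotProduct]
        exact Finset.abs_sum_le_sum_abs _ _
      _ = (P *ᵥ w) k := by
        refine Finset.sum_congr rfl fun l _ => ?_
        rw [abs_mul, abs_of_nonneg (Matrix.nonneg_of_mem_colStochastic hP)]
  have heq := (Finset.sum_eq_sum_iff_of_le hle).1 (Matrix.sum_mulVec_of_mem_colStochastic hP).symm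
  have hs : 0 < ∑ k, w k := by
    obtain ⟨k, hk⟩ := Function.ne_iff.1 hv0
    exact Finset.sum_pos' (fun k _ => abs_nonneg _) ⟨k, Finset.mem_univ k, abs_pos.2 hk⟩
  refine ⟨(∑ k, w k)⁻¹ • w, fun k => ?_, ?_, ?_⟩
  · exact mul_nonneg (inv_nonneg.2 hs.le) (abs_nonneg _)
  · simp only [Pi.smul_apply, smul_eq_mul, ← Finset.mul_sum]
    exact inv_mul_cancel₀ hs.ne'
  · rw [Matrix.mulVec_smul]
    congr 1
    funext k
    exact (heq k (Finset.mem_univ k)).symm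

end Combination

/-! ### A seminorm that the combination step contracts -/

section Disagreement

variable {N M : ℕ}

/-- The largest distance between a block and the centroid. -/
def deviation (a : Fin N → ℝ) (x : Fin N → Vec M) : ℝ := ‖fun k => x k - centroid a x‖

lemma deviation_add_le (a : Fin N → ℝ) (x y : Fin N → Vec M) :
    deviation a (x + y) ≤ deviation a x + deviation a y := by
  unfold deviation
  refine le_trans (le_of_eq ?_) (norm_add_le _ _)
  congr 1
  funext k
  simp only [centroid_add, Pi.add_apply]
  abel

lemma deviation_le {a : Fin N → ℝ} (ha : ∀ k, 0 ≤ a k) (ha1 : ∑ k, a k = 1)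
    (x : Fin N → Vec M) : deviation a x ≤ 2 * ‖x‖ := by
  refine (pi_norm_le_iff_of_nonneg (by positivity)).2 fun k => ?_
  linarith [norm_sub_le (x k) (centroid a x), norm_le_pi_norm x k, norm_centroid_le ha ha1 x]

lemma continuous_deviation (a : Fin N → ℝ) :
    Continuous (deviation a : (Fin N → Vec M) → ℝ) := by
  have := continuous_centroid (M := M) a
  unfold deviation; fun_prop

/-- Doeblin's contraction: if all entries of `Q` are at least `η`, then `Q` is the sum of
`η (a 1ᵀ)`, which maps everything to the centroid, and a nonnegative matrix with column sums
`1 - η`. -/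
lemma deviation_combine_le {a : Fin N → ℝ} (ha : ∀ k, 0 ≤ a k) (ha1 : ∑ k, a k = 1)
    {Q : Matrix (Fin N) (Fin N) ℝ} (hQ : Q ∈ Matrix.colStochastic ℝ (Fin N)) (hQa : Q *ᵥ a = a)
    {η : ℝ} (hη : 0 ≤ η) (hQη : ∀ i j, η ≤ Q i j) (x : Fin N → Vec M) :
    deviation a (combine Q x) ≤ (1 - η) * deviation a x := by
  have ha_le : ∀ l, a l ≤ 1 := fun l =>
    ha1 ▸ Finset.single_le_sum (fun k _ => ha k) (Finset.mem_univ l)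
  have hcoef : ∀ k l, 0 ≤ Q l k - η * a l := fun k l => by
    nlinarith [hQη l k, mul_le_mul_of_nonneg_left (ha_le l) hη]
  have hsum : ∀ k, ∑ l, (Q l k - η * a l) = 1 - η := fun k => by
    rw [Finset.sum_sub_distrib, ← Finset.mul_sum, ha1, Matrix.sum_col_of_mem_colStochastic hQ,
      mul_one]
  have hη1 : 0 ≤ 1 - η ∨ N = 0 := by
    rcases Nat.eq_zero_or_pos N with h | h
    · exact Or.inr h
    · exact Or.inl (hsum ⟨0, h⟩ ▸ Finset.sum_nonneg fun l _ => hcoef _ l)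
  rcases hη1 with hη1 | rfl
  swap
  · simp at ha1
  refine (pi_norm_le_iff_of_nonneg (mul_nonneg hη1 (norm_nonneg _))).2 fun k => ?_
  have key : combine Q x k - centroid a (combine Q x)
      = ∑ l, (Q l k - η * a l) • (x l - centroid a x) := by
    have h0 : ∑ l, a l • (x l - centroid a x) = 0 := by
      simp only [smul_sub, Finset.sum_sub_distrib, ← Finset.sum_smul, ha1, one_smul]
      exact sub_self _
    have h1 : ∑ l, Q l k • (x l - centroid a x) = combine Q x k - centroid a x := by
      simp only [smul_sub, Finset.sum_sub_distrib, ← Finset.sum_smul,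
        Matrix.sum_col_of_mem_colStochastic hQ, one_smul, combine]
    rw [centroid_combine, hQa, ← h1]
    simp only [sub_smul, Finset.sum_sub_distrib, mul_smul, ← Finset.smul_sum]
    rw [h0, smul_zero, sub_zero]
  rw [key, ← hsum k, Finset.sum_mul]
  refine (norm_sum_le _ _).trans (Finset.sum_le_sum fun l _ => ?_)
  rw [norm_smul, Real.norm_of_nonneg (hcoef k l)]
  exact mul_le_mul_of_nonneg_left
    (norm_le_pi_norm (fun k => x k - centroid a x) l) (hcoef k l)

/-- A splitting of the network state adapted to the combination matrix `P`: the centroid with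
respect to stationary weights, which the step `combine P` leaves unchanged, and a subadditive
measure of disagreement, which the step contracts by a factor `rate < 1`. -/
structure Splitting (M : ℕ) (P : Matrix (Fin N) (Fin N) ℝ) where
  /-- the stationary weights -/
  weight : Fin N → ℝ
  weight_nonneg : ∀ k, 0 ≤ weight k
  weight_sum : ∑ k, weight k = 1
  stationary : P *ᵥ weight = weight
  /-- the measure of disagreement -/
  dis : (Fin N → Vec M) → ℝ
  /-- the contraction factor of the disagreement -/
  rate : ℝ
  /-- the constant in the bound of the disagreement by the norm of the state -/
  bound : ℝ
  rate_nonneg : 0 ≤ rate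
  rate_lt_one : rate < 1
  bound_nonneg : 0 ≤ bound
  continuous_dis : Continuous dis
  dis_add_le : ∀ x y, dis (x + y) ≤ dis x + dis y
  dis_le : ∀ x, dis x ≤ bound * ‖x‖
  norm_sub_le_dis : ∀ x k, ‖x k - centroid weight x‖ ≤ dis x
  dis_combine_le : ∀ x, dis (combine P x) ≤ rate * dis x

/-- If `P ^ n` contracts the deviation `d`, then the weighted sum `∑_{j<n} (K + j) d (P ^ j x)`
with `K` large is contracted by `P` itself, by summation by parts. -/
theorem exists_splitting (M : ℕ) [NeZero N] {P : Matrix (Fin N) (Fin N) ℝ}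
    (hP : P ∈ Matrix.colStochastic ℝ (Fin N)) (hprim : P.IsPrimitive) :
    Nonempty (Splitting M P) := by
  obtain ⟨a, ha, ha1, hPa⟩ := exists_stationary hP
  obtain ⟨n, hn, hpos⟩ := hprim.exists_pos_pow
  have hPj : ∀ j, P ^ j ∈ Matrix.colStochastic ℝ (Fin N) := fun j => pow_mem hP j
  have hPja : ∀ j, P ^ j *ᵥ a = a := fun j => by
    induction j with
    | zero => simp
    | succ j ih => rw [pow_succ, ← Matrix.mulVec_mulVec, hPa, ih]
  obtain ⟨p, -, hp⟩ := Finset.exists_min_image (Finset.univ : Finset (Fin N × Fin N))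
    (fun p => (P ^ n) p.1 p.2) ⟨(0, 0), Finset.mem_univ _⟩
  set η := (P ^ n) p.1 p.2 with hηdef
  have hη : 0 < η := hpos _ _
  have hη1 : η ≤ 1 := Matrix.le_one_of_mem_colStochastic (hPj n)
  set K : ℝ := (n + 1) / η with hK
  have hKη : K * η = n + 1 := div_mul_cancel₀ _ hη.ne'
  have hK1 : 1 ≤ K := by
    rw [hK, le_div_iff₀ hη]; linarith [(Nat.cast_nonneg n : (0 : ℝ) ≤ n)]
  have hn1 : (1 : ℝ) ≤ n := by exact_mod_cast hn
  set d : ℕ → (Fin N → Vec M) → ℝ := fun j x => deviation a (combine (P ^ j) x) with hd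
  have hd0 : ∀ j x, 0 ≤ d j x := fun j x => norm_nonneg _
  have hdn : ∀ x, d n x ≤ (1 - η) * d 0 x := fun x => by
    simp only [hd, pow_zero, combine_one]
    exact deviation_combine_le ha ha1 (hPj n) (hPja n) hη.le
      (fun i j => hp (i, j) (Finset.mem_univ _)) x
  have hstep : ∀ j x, d j (combine P x) = d (j + 1) x := fun j x => by
    simp only [hd]
    rw [pow_succ', combine_mul]
  have hparts : ∀ (x : Fin N → Vec M) (m : ℕ), ∑ j ∈ Finset.range m, (K + j) * d (j + 1) x
      = ∑ j ∈ Finset.range m, (K + j) * d j x - ∑ j ∈ Finset.range m, d j x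
        - (K - 1) * d 0 x + (K + m - 1) * d m x := fun x m => by
    induction m with
    | zero => simp
    | succ m ih =>
      simp only [Finset.sum_range_succ, ih]
      push_cast
      ring
  refine ⟨⟨a, ha, ha1, hPa, fun x => ∑ j ∈ Finset.range n, (K + j) * d j x,
    1 - 1 / (K + n), 2 * (n * (K + n)), ?_, ?_, by positivity, ?_, ?_, ?_, ?_, ?_⟩⟩
  · have : 1 / (K + n) ≤ 1 := by rw [div_le_one (by linarith)]; linarith
    linarith
  · have : 0 < 1 / (K + n) := by positivity
    linarith
  · refine continuous_finsetSum _ fun j _ => continuous_const.mul ?_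
    exact (continuous_deviation a).comp (continuous_combine _)
  · intro x y
    rw [← Finset.sum_add_distrib]
    refine Finset.sum_le_sum fun j _ => ?_
    rw [← mul_add]
    refine mul_le_mul_of_nonneg_left ?_ (by positivity)
    simp only [hd, combine_add]
    exact deviation_add_le _ _ _
  · intro x
    have : ∀ j ∈ Finset.range n, (K + j) * d j x ≤ (K + n) * (2 * ‖x‖) := fun j hj => by
      have hjn : (j : ℝ) ≤ n := by exact_mod_cast (Finset.mem_range.1 hj).le
      refine mul_le_mul (by linarith) ?_ (hd0 j x) (by positivity)
      refine (deviation_le ha ha1 _).trans ?_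
      linarith [norm_combine_le (hPj j) x]
    refine (Finset.sum_le_sum this).trans (le_of_eq ?_)
    rw [Finset.sum_const, Finset.card_range, nsmul_eq_mul]
    ring
  · intro x k
    have h0 : (K + (0 : ℕ)) * d 0 x ≤ ∑ j ∈ Finset.range n, (K + j) * d j x :=
      Finset.single_le_sum (f := fun j : ℕ => (K + j) * d j x)
        (fun j _ => mul_nonneg (by positivity) (hd0 j x)) (Finset.mem_range.2 hn)
    have h1 : ‖x k - centroid a x‖ ≤ d 0 x := by
      simp only [hd, pow_zero, combine_one]
      exact norm_le_pi_norm (fun k => x k - centroid a x) k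
    push_cast at h0
    nlinarith [hd0 0 x]
  · intro x
    simp only [hstep]
    have h1 : ∑ j ∈ Finset.range n, (K + j) * d j x ≤ (K + n) * ∑ j ∈ Finset.range n, d j x := by
      rw [Finset.mul_sum]
      refine Finset.sum_le_sum fun j hj => mul_le_mul_of_nonneg_right ?_ (hd0 j x)
      have hjn : (j : ℝ) ≤ n := by exact_mod_cast (Finset.mem_range.1 hj).le
      linarith
    have h2 : 1 / (K + n) * ∑ j ∈ Finset.range n, (K + j) * d j x
        ≤ ∑ j ∈ Finset.range n, d j x := by
      rw [div_mul_eq_mul_div, one_mul, div_le_iff₀ (by positivity)]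
      linarith
    have h3 : (K + n - 1) * d n x ≤ (K - 1) * d 0 x := by
      have h4 : (K + n - 1) * d n x ≤ (K + n - 1) * ((1 - η) * d 0 x) :=
        mul_le_mul_of_nonneg_left (hdn x) (by linarith)
      have h5 : (K + n - 1) * (1 - η) ≤ K - 1 := by nlinarith
      nlinarith [mul_le_mul_of_nonneg_right h5 (hd0 0 x)]
    rw [hparts x n]
    linarith

end Disagreement

/-! ### Costs with bounded Hessians -/

section Cost

variable {M : ℕ}

/-- A field on `ℝ^M` that vanishes at the origin, is `D`-Lipschitz there, and is `ν`-strongly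
monotone with respect to the origin. -/
structure RestoringField (G : Vec M → Vec M) (ν D : ℝ) : Prop where
  map_zero : G 0 = 0
  lipschitz : ∀ x y, ‖G x - G y‖ ≤ D * ‖x - y‖
  monotone : ∀ x, ν * ‖x‖ ^ 2 ≤ inner ℝ x (G x)

lemma RestoringField.continuous {G : Vec M → Vec M} {ν D : ℝ} (hG : RestoringField G ν D) :
    Continuous G := by
  refine (LipschitzWith.of_dist_le_mul (K := D.toNNReal) fun x y => ?_).continuous
  rw [dist_eq_norm, dist_eq_norm]
  exact (hG.lipschitz x y).trans
    (mul_le_mul_of_nonneg_right (Real.le_coe_toNNReal D) (norm_nonneg _))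

lemma RestoringField.norm_le {G : Vec M → Vec M} {ν D : ℝ} (hG : RestoringField G ν D)
    (x : Vec M) : ‖G x‖ ≤ D * ‖x‖ := by
  simpa [hG.map_zero] using hG.lipschitz x 0

/-- The second derivative of `J` as a bilinear form is the form of the Hessian matrix. -/
lemma inner_toEuclideanLin_hessian (J : Vec M → ℝ) (w x y : Vec M) :
    inner ℝ y (Matrix.toEuclideanLin (hessian J w) x) = fderiv ℝ (fderiv ℝ J) w y x := by
  set B := fderiv ℝ (fderiv ℝ J) w
  have hx : ∀ z : Vec M, z = ∑ a, z a • EuclideanSpace.single a (1 : ℝ) := fun z => by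
    ext b
    simp [Finset.sum_apply, Pi.single_apply]
  have h1 : B y x = ∑ a, ∑ b, y a * (x b * B (EuclideanSpace.single a 1)
      (EuclideanSpace.single b 1)) := by
    conv_lhs => rw [hx y, hx x]
    simp only [map_sum, map_smul, sum_apply, smul_apply,
      smul_eq_mul, Finset.mul_sum]
    rw [Finset.sum_comm]
    exact Finset.sum_congr rfl fun a _ => Finset.sum_congr rfl fun b _ => by ring
  rw [h1, PiLp.inner_apply]
  refine Finset.sum_congr rfl fun a _ => ?_
  simp only [Matrix.toLpLin_apply, Matrix.mulVec, dotProduct, hessian, Matrix.of_apply,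
    RCLike.inner_apply, conj_trivial, Finset.sum_mul]
  exact Finset.sum_congr rfl fun b _ => by ring

lemma posSemidef_inner {A : Matrix (Fin M) (Fin M) ℝ} (hA : A.PosSemidef) (x : Vec M) :
    0 ≤ inner ℝ x (Matrix.toEuclideanLin A x) := by
  have h := hA.dotProduct_mulVec_nonneg (x : Fin M → ℝ)
  rw [PiLp.inner_apply]
  simpa [Matrix.toLpLin_apply, dotProduct, mul_comm] using h

variable {J : Vec M → ℝ} {ν δ : ℝ}

lemma HessianBounds.lower_form (hJ : HessianBounds J ν δ) (w x : Vec M) :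
    ν * ‖x‖ ^ 2 ≤ fderiv ℝ (fderiv ℝ J) w x x := by
  have h := posSemidef_inner (hJ.lower w) x
  simp only [map_sub, map_smul, Matrix.toLpLin_one, LinearMap.sub_apply, LinearMap.smul_apply,
    LinearMap.id_apply, inner_sub_right, inner_smul_right, inner_toEuclideanLin_hessian,
    real_inner_self_eq_norm_sq] at h
  linarith

lemma HessianBounds.upper_form (hJ : HessianBounds J ν δ) (w x : Vec M) :
    fderiv ℝ (fderiv ℝ J) w x x ≤ δ * ‖x‖ ^ 2 := by
  have h := posSemidef_inner (hJ.upper w) x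
  simp only [map_sub, map_smul, Matrix.toLpLin_one, LinearMap.sub_apply, LinearMap.smul_apply,
    LinearMap.id_apply, inner_sub_right, inner_smul_right, inner_toEuclideanLin_hessian,
    real_inner_self_eq_norm_sq] at h
  linarith

lemma HessianBounds.symm_form (hJ : HessianBounds J ν δ) (w x y : Vec M) :
    fderiv ℝ (fderiv ℝ J) w x y = fderiv ℝ (fderiv ℝ J) w y x :=
  second_derivative_symmetric (f := J) (f' := fderiv ℝ J)
    (fun z => (hJ.differentiable z).hasFDerivAt) (hJ.twice_differentiable w).hasFDerivAt x y

/-- By polarization, a nonnegative quadratic form that is at most `δ ‖x‖²` has norm at most `δ`.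
The absolute value only matters for `M = 0`, where the sign of `δ` is not determined. -/
lemma HessianBounds.norm_form_le (hJ : HessianBounds J ν δ) (hν : 0 ≤ ν) (w : Vec M) :
    ‖fderiv ℝ (fderiv ℝ J) w‖ ≤ |δ| := by
  refine ContinuousLinearMap.opNorm_le_of_unit_norm (abs_nonneg _) fun x hx => ?_
  refine ContinuousLinearMap.opNorm_le_of_unit_norm (abs_nonneg _) fun y hy => ?_
  have hnonneg : ∀ z, 0 ≤ fderiv ℝ (fderiv ℝ J) w z z := fun z =>
    (mul_nonneg hν (sq_nonneg _)).trans (hJ.lower_form w z)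
  have hle : ∀ z, ‖z‖ ≤ 2 → fderiv ℝ (fderiv ℝ J) w z z ≤ 4 * |δ| := fun z hz => by
    have h2 : ‖z‖ ^ 2 ≤ 4 := by nlinarith [norm_nonneg z]
    calc _ ≤ δ * ‖z‖ ^ 2 := hJ.upper_form w z
      _ ≤ |δ| * ‖z‖ ^ 2 := mul_le_mul_of_nonneg_right (le_abs_self δ) (sq_nonneg _)
      _ ≤ 4 * |δ| := by nlinarith [abs_nonneg δ]
  have hs := hJ.symm_form w x y
  have h1 : fderiv ℝ (fderiv ℝ J) w (x + y) (x + y) - fderiv ℝ (fderiv ℝ J) w (x - y) (x - y)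
      = 4 * fderiv ℝ (fderiv ℝ J) w x y := by
    simp only [map_add, map_sub, add_apply, sub_apply]
    linarith
  have h2 := hle (x + y) ((norm_add_le _ _).trans (by linarith))
  have h3 := hle (x - y) ((norm_sub_le _ _).trans (by linarith))
  rw [Real.norm_eq_abs, abs_le]
  constructor <;> linarith [hnonneg (x + y), hnonneg (x - y)]

lemma HessianBounds.restoringField_hessian (hJ : HessianBounds J ν δ) (hν : 0 ≤ ν) (w : Vec M) :
    RestoringField (fun x => Matrix.toEuclideanLin (hessian J w) x) ν |δ| where
  map_zero := map_zero _
  lipschitz x y := by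
    rw [← map_sub]
    set v := Matrix.toEuclideanLin (hessian J w) (x - y) with hv
    have h : ‖v‖ ^ 2 ≤ |δ| * ‖x - y‖ * ‖v‖ := by
      calc ‖v‖ ^ 2 = fderiv ℝ (fderiv ℝ J) w v (x - y) := by
            rw [← inner_toEuclideanLin_hessian, ← hv, real_inner_self_eq_norm_sq]
        _ ≤ ‖fderiv ℝ (fderiv ℝ J) w v (x - y)‖ := le_abs_self _
        _ ≤ ‖fderiv ℝ (fderiv ℝ J) w‖ * ‖v‖ * ‖x - y‖ := ContinuousLinearMap.le_opNorm₂ _ _ _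
        _ ≤ |δ| * ‖v‖ * ‖x - y‖ := by gcongr; exact hJ.norm_form_le hν w
        _ = |δ| * ‖x - y‖ * ‖v‖ := by ring
    rcases (norm_nonneg v).eq_or_lt with h0 | h0
    · rw [← h0]; positivity
    · exact le_of_mul_le_mul_right (by rwa [← sq]) h0
  monotone x := by
    rw [inner_toEuclideanLin_hessian]
    exact hJ.lower_form w x

lemma inner_gradient (J : Vec M → ℝ) (w x : Vec M) :
    inner ℝ x (gradient J w) = fderiv ℝ J w x := by
  rw [real_inner_comm, gradient, InnerProductSpace.toDual_symm_apply]

lemma norm_gradient_sub (J : Vec M → ℝ) (w w' : Vec M) :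
    ‖gradient J w - gradient J w'‖ = ‖fderiv ℝ J w - fderiv ℝ J w'‖ := by
  rw [gradient, gradient, ← map_sub, LinearIsometryEquiv.norm_map]

lemma HessianBounds.norm_gradient_sub_le (hJ : HessianBounds J ν δ) (hν : 0 ≤ ν) (w w' : Vec M) :
    ‖gradient J w - gradient J w'‖ ≤ |δ| * ‖w - w'‖ := by
  rw [norm_gradient_sub]
  exact convex_univ.norm_image_sub_le_of_norm_fderiv_le
    (fun z _ => hJ.twice_differentiable z) (fun z _ => hJ.norm_form_le hν z)
    (Set.mem_univ _) (Set.mem_univ _)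

lemma HessianBounds.continuous_gradient (hJ : HessianBounds J ν δ) : Continuous (gradient J) := by
  have := hJ.twice_differentiable.continuous
  unfold gradient
  fun_prop

variable {wo : Vec M}

lemma gradient_eq_zero_of_isMinOn (hwo : IsMinOn J Set.univ wo) : gradient J wo = 0 := by
  rw [gradient, (hwo.isLocalMin Filter.univ_mem).fderiv_eq_zero, map_zero]

/-- In terms of the error `x = wo - w`, the field `x ↦ -∇J(wo - x)` is restoring. -/
lemma HessianBounds.restoringField_gradient (hJ : HessianBounds J ν δ) (hν : 0 ≤ ν)
    (hwo : IsMinOn J Set.univ wo) :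
    RestoringField (fun x => -gradient J (wo - x)) ν |δ| where
  map_zero := by rw [sub_zero, gradient_eq_zero_of_isMinOn hwo, neg_zero]
  lipschitz x y := by
    rw [neg_sub_neg]
    refine (hJ.norm_gradient_sub_le hν _ _).trans (le_of_eq ?_)
    congr 2
    abel
  monotone x := by
    obtain ⟨z, -, hz⟩ := domain_mvt (f := fun w => fderiv ℝ J w x) (s := Set.univ)
      (x := wo - x) (y := wo) (f' := fun w => (fderiv ℝ (fderiv ℝ J) w).flip x)
      (fun w _ => ((hJ.twice_differentiable w).hasFDerivAt.clm_apply
        (hasFDerivAt_const x w)).hasFDerivWithinAt.congr_fderiv (by ext; simp))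
      convex_univ (Set.mem_univ _) (Set.mem_univ _)
    have h0 : fderiv ℝ J wo x = 0 := by
      rw [← inner_gradient, gradient_eq_zero_of_isMinOn hwo, inner_zero_right]
    have h1 := hJ.lower_form z x
    simp only [sub_sub_cancel, ContinuousLinearMap.flip_apply, h0] at hz
    rw [inner_neg_right, inner_gradient]
    linarith

/-- The linearization error of the gradient at the minimizer is quadratic: near the minimizer
because the Hessian is Lipschitz there, and away from it because both fields grow linearly. -/
lemma HessianBounds.linearization_error_le (hJ : HessianBounds J ν δ) (hν : 0 ≤ ν)
    (hwo : IsMinOn J Set.univ wo) {κ ε : ℝ} (hκ : 0 ≤ κ) (hε : 0 < ε)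
    (hLip : HessianLocallyLipschitz J wo κ ε) (x : Vec M) :
    ‖-gradient J (wo - x) - Matrix.toEuclideanLin (hessian J wo) x‖
      ≤ (κ + 2 * |δ| / ε) * ‖x‖ ^ 2 := by
  rcases le_total ‖x‖ ε with hx | hx
  · have hform : ∀ d : Vec M, ‖d‖ ≤ ‖x‖ →
        ‖fderiv ℝ (fderiv ℝ J) (wo + d) - fderiv ℝ (fderiv ℝ J) wo‖ ≤ κ * ‖x‖ := fun d hd => by
      have h := (hLip d (hd.trans hx)).trans (mul_le_mul_of_nonneg_left hd hκ)
      refine ContinuousLinearMap.opNorm_le_bound₂ _ (by positivity) fun y z => ?_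
      have h1 : (fderiv ℝ (fderiv ℝ J) (wo + d) - fderiv ℝ (fderiv ℝ J) wo) y z
          = inner ℝ y (Matrix.toEuclideanCLM (n := Fin M) (𝕜 := ℝ)
              (hessian J (wo + d) - hessian J wo) z) := by
        have h2 : Matrix.toEuclideanCLM (n := Fin M) (𝕜 := ℝ)
            (hessian J (wo + d) - hessian J wo) z
            = Matrix.toEuclideanLin (hessian J (wo + d)) z
              - Matrix.toEuclideanLin (hessian J wo) z := by
          rw [← LinearMap.sub_apply, ← map_sub]; rfl
        rw [h2, inner_sub_right, inner_toEuclideanLin_hessian, inner_toEuclideanLin_hessian]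
        rfl
      rw [h1]
      refine (norm_inner_le_norm _ _).trans ?_
      refine (mul_le_mul_of_nonneg_left (ContinuousLinearMap.le_of_opNorm_le _ h z)
        (norm_nonneg y)).trans (le_of_eq (by ring))
    have hmv := (convex_closedBall wo ‖x‖).norm_image_sub_le_of_norm_fderiv_le'
      (f := fderiv ℝ J) (φ := fderiv ℝ (fderiv ℝ J) wo) (C := κ * ‖x‖) (x := wo) (y := wo - x)
      (fun z _ => hJ.twice_differentiable z)
      (fun z hz => by
        have := hform (z - wo) (by rwa [← dist_eq_norm])
        rwa [add_sub_cancel] at this)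
      (Metric.mem_closedBall_self (norm_nonneg x)) (by simp [Metric.mem_closedBall])
    set v := -gradient J (wo - x) - Matrix.toEuclideanLin (hessian J wo) x with hv
    have h0 : fderiv ℝ J wo = 0 := (hwo.isLocalMin Filter.univ_mem).fderiv_eq_zero
    rw [h0, sub_zero, sub_sub_cancel_left, norm_neg, map_neg, sub_neg_eq_add] at hmv
    have h : ‖v‖ ^ 2 ≤ κ * ‖x‖ ^ 2 * ‖v‖ := by
      calc ‖v‖ ^ 2 = -(fderiv ℝ J (wo - x) + fderiv ℝ (fderiv ℝ J) wo x) v := by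
            rw [← real_inner_self_eq_norm_sq]
            nth_rw 2 [hv]
            rw [inner_sub_right, inner_neg_right, inner_gradient, inner_toEuclideanLin_hessian,
              hJ.symm_form, add_apply]
            ring
        _ ≤ ‖(fderiv ℝ J (wo - x) + fderiv ℝ (fderiv ℝ J) wo x) v‖ := neg_le_abs _
        _ ≤ κ * ‖x‖ * ‖x‖ * ‖v‖ := ContinuousLinearMap.le_of_opNorm_le _ hmv _
        _ = κ * ‖x‖ ^ 2 * ‖v‖ := by ring
    have h2 : ‖v‖ ≤ κ * ‖x‖ ^ 2 := by
      rcases (norm_nonneg v).eq_or_lt with h0 | h0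
      · rw [← h0]; positivity
      · exact le_of_mul_le_mul_right (by rwa [← sq]) h0
    refine h2.trans ?_
    have : 0 ≤ 2 * |δ| / ε := by positivity
    nlinarith [sq_nonneg ‖x‖]
  · have h1 := (hJ.restoringField_gradient hν hwo).lipschitz x 0
    have h2 := (hJ.restoringField_hessian hν wo).lipschitz x 0
    simp only [sub_zero, gradient_eq_zero_of_isMinOn hwo, neg_zero, map_zero] at h1 h2
    have h3 : 2 * |δ| * ‖x‖ ≤ 2 * |δ| / ε * ‖x‖ ^ 2 := by
      rw [div_mul_eq_mul_div, le_div_iff₀ hε]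
      have := mul_le_mul_of_nonneg_left hx (by positivity : 0 ≤ 2 * |δ| * ‖x‖)
      linarith
    have h4 := norm_sub_le (-gradient J (wo - x)) (Matrix.toEuclideanLin (hessian J wo) x)
    have h5 : 0 ≤ κ * ‖x‖ ^ 2 := by positivity
    rw [add_mul]
    linarith

end Cost

/-! ### One-step drift inequalities -/

section Drift

lemma add_pow_four_le (s t : ℝ) : (s + t) ^ 4 ≤ 8 * (s ^ 4 + t ^ 4) := by
  have h1 : (s + t) ^ 2 ≤ 2 * (s ^ 2 + t ^ 2) := by nlinarith [sq_nonneg (s - t)]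
  have h2 : (s ^ 2 + t ^ 2) ^ 2 ≤ 2 * (s ^ 4 + t ^ 4) := by nlinarith [sq_nonneg (s ^ 2 - t ^ 2)]
  calc (s + t) ^ 4 = ((s + t) ^ 2) ^ 2 := by ring
    _ ≤ (2 * (s ^ 2 + t ^ 2)) ^ 2 := by gcongr
    _ ≤ 8 * (s ^ 4 + t ^ 4) := by linarith

/-- Young's inequality for the cross term between the centroid `u` and the disagreement `q`. -/
lemma cross_term_le {a : ℝ} (ha : 0 < a) (D u q : ℝ) :
    4 * D * (u ^ 3 * q) ≤ a * u ^ 4 + 32 * D ^ 4 / a ^ 3 * q ^ 4 := by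
  have e1 : 0 ≤ (a * u ^ 2 - 4 * D * (u * q)) ^ 2 / (2 * a) := by positivity
  have e2 : 0 ≤ a / 2 * (u ^ 2 - 8 * D ^ 2 / a ^ 2 * q ^ 2) ^ 2 := by positivity
  have e : (a * u ^ 2 - 4 * D * (u * q)) ^ 2 / (2 * a)
      + a / 2 * (u ^ 2 - 8 * D ^ 2 / a ^ 2 * q ^ 2) ^ 2
      = a * u ^ 4 + 32 * D ^ 4 / a ^ 3 * q ^ 4 - 4 * D * (u ^ 3 * q) := by
    field_simp; ring
  linarith

lemma sq_mul_sq_le (D u q T : ℝ) : u ^ 2 * (D * (u + q) + T) ^ 2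
    ≤ 6 * D ^ 2 * u ^ 4 + 2 * D ^ 2 * q ^ 4 + 2 * (u ^ 2 * T ^ 2) := by
  have e1 : 0 ≤ u ^ 2 * (D * (u + q) - T) ^ 2 := by positivity
  have e2 : 0 ≤ u ^ 2 * (D ^ 2 * (u - q) ^ 2) := by positivity
  have e3 : 0 ≤ D ^ 2 * (u ^ 2 - q ^ 2) ^ 2 := by positivity
  linarith

lemma pow_four_le (D u q T : ℝ) :
    (D * (u + q) + T) ^ 4 ≤ 64 * D ^ 4 * (u ^ 4 + q ^ 4) + 8 * T ^ 4 := by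
  have e1 := add_pow_four_le (D * (u + q)) T
  have e2 := mul_le_mul_of_nonneg_left (add_pow_four_le u q) (by positivity : 0 ≤ D ^ 4)
  rw [mul_pow] at e1
  linarith

/-- The absorption of all error terms of the fourth-order drift by the contraction of the
centroid (`a μ`) and of the disagreement (`1 - lam`), for small `μ`. -/
lemma exists_quartic_absorption {a D lam L : ℝ} (ha : 0 < a) (hlam : lam < 1)
    (hL : 0 ≤ L) : ∃ b, 0 ≤ b ∧ ∃ μ₁ > 0, ∀ μ, 0 < μ → μ < μ₁ → ∀ u q T H : ℝ, 0 ≤ u → 0 ≤ q →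
      0 ≤ T → H = D * (u + q) + T →
      u ^ 4 - 4 * μ * (u ^ 2 * (a * u ^ 2 - D * (u * q))) + 8 * μ ^ 2 * (u ^ 2 * H ^ 2)
        + L * μ ^ 4 * H ^ 4 + lam * q ^ 4 ≤ (1 - a * μ) * (u ^ 4 + q ^ 4) + b * μ ^ 3 * T ^ 4 := by
  set C : ℝ := 32 * D ^ 4 / a ^ 3 with hC
  have hC0 : 0 ≤ C := by positivity
  set c : ℝ := 64 * D ^ 4 * L with hc
  have hc0 : 0 ≤ c := by positivity
  refine ⟨64 / a + 8 * L, by positivity,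
    min 1 (min (a / (48 * D ^ 2 + c + 1)) ((1 - lam) / (a + C + 16 * D ^ 2 + c + 1))), ?_, ?_⟩
  · have : 0 < 1 - lam := by linarith
    exact lt_min one_pos (lt_min (by positivity) (by positivity))
  intro μ hμ hμ1 u q T H hu hq hT hH
  obtain ⟨hμa, hμb⟩ := lt_min_iff.1 hμ1
  obtain ⟨hμb, hμc⟩ := lt_min_iff.1 hμb
  rw [lt_div_iff₀ (by positivity)] at hμb hμc
  have hμ2 : μ ^ 2 ≤ μ := by nlinarith
  have hμ4 : μ ^ 4 ≤ μ ^ 2 := by nlinarith [sq_nonneg μ]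
  have hμ43 : μ ^ 4 ≤ μ ^ 3 := by nlinarith [pow_pos hμ 3]
  have h1 := cross_term_le ha D u q
  rw [← hC] at h1
  have h2 := sq_mul_sq_le D u q T
  have h4 := pow_four_le D u q T
  rw [← hH] at h2 h4
  have h3 : 16 * μ ^ 2 * (u ^ 2 * T ^ 2) ≤ a * μ * u ^ 4 + 64 / a * μ ^ 3 * T ^ 4 := by
    have : 0 ≤ a * μ * (u ^ 2 - 8 * μ / a * T ^ 2) ^ 2 := by positivity
    have e : a * μ * (u ^ 2 - 8 * μ / a * T ^ 2) ^ 2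
        = a * μ * u ^ 4 + 64 / a * μ ^ 3 * T ^ 4 - 16 * μ ^ 2 * (u ^ 2 * T ^ 2) := by
      field_simp; ring
    linarith
  have hu4 : 0 ≤ u ^ 4 := by positivity
  have hq4 : 0 ≤ q ^ 4 := by positivity
  have hT4 : 0 ≤ T ^ 4 := by positivity
  have k1 := mul_le_mul_of_nonneg_left h1 hμ.le
  have k2 : 8 * μ ^ 2 * (u ^ 2 * H ^ 2)
      ≤ 48 * D ^ 2 * μ ^ 2 * u ^ 4 + 16 * D ^ 2 * μ ^ 2 * q ^ 4
        + 16 * μ ^ 2 * (u ^ 2 * T ^ 2) := by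
    linarith [mul_le_mul_of_nonneg_left h2 (by positivity : 0 ≤ 8 * μ ^ 2)]
  have k4 : L * μ ^ 4 * H ^ 4 ≤ c * μ ^ 2 * (u ^ 4 + q ^ 4) + 8 * L * μ ^ 3 * T ^ 4 := by
    have e1 := mul_le_mul_of_nonneg_left h4 (by positivity : 0 ≤ L * μ ^ 4)
    have e2 := mul_le_mul_of_nonneg_right hμ4 (by positivity : 0 ≤ c * (u ^ 4 + q ^ 4))
    have e3 := mul_le_mul_of_nonneg_right hμ43 (by positivity : 0 ≤ 8 * L * T ^ 4)
    rw [hc] at e2 ⊢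
    linarith
  have m1 : (48 * D ^ 2 + c) * μ ^ 2 * u ^ 4 ≤ a * μ * u ^ 4 := by
    refine mul_le_mul_of_nonneg_right ?_ hu4
    nlinarith
  have m2 : (C * μ + 16 * D ^ 2 * μ ^ 2 + c * μ ^ 2 + lam) * q ^ 4 ≤ (1 - a * μ) * q ^ 4 := by
    refine mul_le_mul_of_nonneg_right ?_ hq4
    linarith [mul_le_mul_of_nonneg_left hμ2 (by positivity : 0 ≤ 16 * D ^ 2 + c)]
  linarith

/-- The second-order counterpart of `exists_quartic_absorption`, with a disturbance `T` that need
not have zero mean. -/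
lemma exists_quadratic_absorption {a D lam L : ℝ} (ha : 0 < a) (hlam : lam < 1)
    (hL : 0 ≤ L) : ∃ b, 0 ≤ b ∧ ∃ μ₁ > 0, ∀ μ, 0 < μ → μ < μ₁ → ∀ u q T H : ℝ, 0 ≤ u → 0 ≤ q →
      0 ≤ T → H = D * (u + q) + T →
      u ^ 2 - 2 * μ * (a * u ^ 2 - D * (u * q) - u * T) + L * μ ^ 2 * H ^ 2 + lam * q ^ 2
        ≤ (1 - a / 2 * μ) * (u ^ 2 + q ^ 2) + b * μ * T ^ 2 := by
  set C : ℝ := 2 * D ^ 2 / a with hC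
  have hC0 : 0 ≤ C := by positivity
  set c : ℝ := 4 * D ^ 2 * L with hc
  have hc0 : 0 ≤ c := by positivity
  refine ⟨2 / a + 2 * L, by positivity,
    min 1 (min (a / (2 * (c + 1))) ((1 - lam) / (a + C + c + 1))), ?_, ?_⟩
  · have : 0 < 1 - lam := by linarith
    exact lt_min one_pos (lt_min (by positivity) (by positivity))
  intro μ hμ hμ1 u q T H hu hq hT hH
  obtain ⟨hμa, hμb⟩ := lt_min_iff.1 hμ1
  obtain ⟨hμb, hμc⟩ := lt_min_iff.1 hμb
  rw [lt_div_iff₀ (by positivity)] at hμb hμc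
  have hμ2 : μ ^ 2 ≤ μ := by nlinarith
  have h1 : 2 * D * (u * q) ≤ a / 2 * u ^ 2 + C * q ^ 2 := by
    have : 0 ≤ a / 2 * (u - 2 * D / a * q) ^ 2 := by positivity
    have e : a / 2 * (u - 2 * D / a * q) ^ 2
        = a / 2 * u ^ 2 + C * q ^ 2 - 2 * D * (u * q) := by
      rw [hC]; field_simp; ring
    linarith
  have h2 : 2 * (u * T) ≤ a / 2 * u ^ 2 + 2 / a * T ^ 2 := by
    have : 0 ≤ a / 2 * (u - 2 / a * T) ^ 2 := by positivity
    have e : a / 2 * (u - 2 / a * T) ^ 2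
        = a / 2 * u ^ 2 + 2 / a * T ^ 2 - 2 * (u * T) := by
      field_simp; ring
    linarith
  have h3 : H ^ 2 ≤ 4 * D ^ 2 * (u ^ 2 + q ^ 2) + 2 * T ^ 2 := by
    rw [hH]
    nlinarith [sq_nonneg (D * (u + q) - T), mul_nonneg (sq_nonneg D) (sq_nonneg (u - q))]
  have hu2 : 0 ≤ u ^ 2 := by positivity
  have hq2 : 0 ≤ q ^ 2 := by positivity
  have hT2 : 0 ≤ T ^ 2 := by positivity
  have k1 := mul_le_mul_of_nonneg_left h1 hμ.le
  have k2 := mul_le_mul_of_nonneg_left h2 hμ.le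
  have k3 : L * μ ^ 2 * H ^ 2 ≤ c * μ ^ 2 * (u ^ 2 + q ^ 2) + 2 * L * μ * T ^ 2 := by
    have e1 := mul_le_mul_of_nonneg_left h3 (by positivity : 0 ≤ L * μ ^ 2)
    have e3 := mul_le_mul_of_nonneg_right hμ2 (by positivity : 0 ≤ 2 * L * T ^ 2)
    rw [hc]
    linarith
  have m1 : c * μ ^ 2 * u ^ 2 ≤ a / 2 * μ * u ^ 2 := by
    refine mul_le_mul_of_nonneg_right ?_ hu2
    nlinarith
  have m2 : (C * μ + c * μ ^ 2 + lam) * q ^ 2 ≤ (1 - a / 2 * μ) * q ^ 2 := by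
    refine mul_le_mul_of_nonneg_right ?_ hq2
    linarith [mul_le_mul_of_nonneg_left hμ2 hc0, mul_pos ha hμ]
  linarith

/-- Convexity of `t ↦ t ^ n`, for a contraction by `lam` followed by a perturbation by `t`. -/
lemma contraction_add_pow_le {lam s t : ℝ} (h0 : 0 ≤ lam) (h1 : lam < 1) (hs : 0 ≤ s) (ht : 0 ≤ t)
    (n : ℕ) : (lam * s + t) ^ n ≤ lam * s ^ n + (1 - lam) * (t / (1 - lam)) ^ n := by
  have h2 : 0 < 1 - lam := by linarith
  have h := (convexOn_pow n).2 (Set.mem_Ici.2 hs)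
    (Set.mem_Ici.2 (div_nonneg ht h2.le)) h0 h2.le (by ring)
  simpa [smul_eq_mul, mul_div_cancel₀ t h2.ne'] using h

lemma norm_sub_smul_sq_le {E : Type*} [NormedAddCommGroup E] [InnerProductSpace ℝ E] {u v : E}
    {μ H : ℝ} (hv : ‖v‖ ≤ H) :
    ‖u - μ • v‖ ^ 2 ≤ ‖u‖ ^ 2 - 2 * μ * inner ℝ u v + μ ^ 2 * H ^ 2 := by
  rw [norm_sub_sq_real, norm_smul, inner_smul_right, mul_pow, Real.norm_eq_abs, sq_abs]
  have : ‖v‖ ^ 2 ≤ H ^ 2 := by gcongr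
  nlinarith [mul_le_mul_of_nonneg_left this (sq_nonneg μ)]

lemma norm_sub_smul_pow_four_le {E : Type*} [NormedAddCommGroup E] [InnerProductSpace ℝ E]
    {u v : E} {μ H : ℝ} (hv : ‖v‖ ≤ H) :
    ‖u - μ • v‖ ^ 4 ≤ ‖u‖ ^ 4 - 4 * μ * (‖u‖ ^ 2 * inner ℝ u v)
      + 8 * μ ^ 2 * (‖u‖ ^ 2 * H ^ 2) + 3 * μ ^ 4 * H ^ 4 := by
  have hin : (inner ℝ u v) ^ 2 ≤ ‖u‖ ^ 2 * ‖v‖ ^ 2 := by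
    have h := abs_le.1 (abs_real_inner_le_norm u v)
    nlinarith
  have e : ‖u - μ • v‖ ^ 4 = (‖u‖ ^ 2 - 2 * μ * inner ℝ u v + μ ^ 2 * ‖v‖ ^ 2) ^ 2 := by
    have : ‖u - μ • v‖ ^ 2 = ‖u‖ ^ 2 - 2 * μ * inner ℝ u v + μ ^ 2 * ‖v‖ ^ 2 := by
      rw [norm_sub_sq_real, norm_smul, inner_smul_right, mul_pow, Real.norm_eq_abs, sq_abs]
      ring
    rw [← this]; ring
  have hv2 : ‖v‖ ^ 2 ≤ H ^ 2 := by gcongr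
  have hv4 : ‖v‖ ^ 4 ≤ H ^ 4 := by gcongr
  have k1 := mul_le_mul_of_nonneg_left hv2 (by positivity : 0 ≤ 8 * μ ^ 2 * ‖u‖ ^ 2)
  have k2 := mul_le_mul_of_nonneg_left hv4 (by positivity : 0 ≤ 3 * μ ^ 4)
  have k3 := mul_le_mul_of_nonneg_left hin (by positivity : 0 ≤ 6 * μ ^ 2)
  -- `-4 μ³ ⟪u, v⟫ ‖v‖² ≤ 2 μ² ⟪u, v⟫² + 2 μ⁴ ‖v‖⁴`
  have k4 : 0 ≤ 2 * (μ * inner ℝ u v + μ ^ 2 * ‖v‖ ^ 2) ^ 2 := by positivity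
  rw [e]
  nlinarith

end Drift

/-! ### Moment recursions for one step of the network -/

section MomentStep

variable {N M : ℕ}

namespace Splitting

variable {P : Matrix (Fin N) (Fin N) ℝ} (Sp : Splitting M P)

/-- The centroid of a network state with respect to the stationary weights. -/
def cen (x : Fin N → Vec M) : Vec M := centroid Sp.weight x

/-- The Lyapunov function of order `n`: centroid and disagreement, both to the power `n`. -/
def lyap (n : ℕ) (x : Fin N → Vec M) : ℝ := ‖Sp.cen x‖ ^ n + Sp.dis x ^ n

lemma continuous_cen : Continuous Sp.cen := continuous_centroid _

lemma dis_nonneg [NeZero N] (x : Fin N → Vec M) : 0 ≤ Sp.dis x :=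
  (norm_nonneg _).trans (Sp.norm_sub_le_dis x 0)

lemma norm_cen_le (x : Fin N → Vec M) : ‖Sp.cen x‖ ≤ ‖x‖ :=
  norm_centroid_le Sp.weight_nonneg Sp.weight_sum x

lemma norm_apply_le (x : Fin N → Vec M) (k : Fin N) : ‖x k‖ ≤ ‖Sp.cen x‖ + Sp.dis x := by
  have h := Sp.norm_sub_le_dis x k
  have h2 := norm_add_le (centroid Sp.weight x) (x k - centroid Sp.weight x)
  rw [add_sub_cancel] at h2
  unfold cen
  linarith

lemma lyap_nonneg [NeZero N] (n : ℕ) (x : Fin N → Vec M) : 0 ≤ Sp.lyap n x :=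
  add_nonneg (by positivity) (pow_nonneg (Sp.dis_nonneg x) n)

lemma continuous_lyap (n : ℕ) : Continuous (Sp.lyap n) :=
  (Sp.continuous_cen.norm.pow n).add (Sp.continuous_dis.pow n)

lemma lyap_le [NeZero N] (n : ℕ) (x : Fin N → Vec M) :
    Sp.lyap n x ≤ (1 + Sp.bound ^ n) * ‖x‖ ^ n := by
  have h1 : ‖Sp.cen x‖ ^ n ≤ ‖x‖ ^ n := pow_le_pow_left₀ (norm_nonneg _) (Sp.norm_cen_le x) n
  have h2 : Sp.dis x ^ n ≤ (Sp.bound * ‖x‖) ^ n :=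
    pow_le_pow_left₀ (Sp.dis_nonneg x) (Sp.dis_le x) n
  rw [mul_pow] at h2
  unfold lyap
  linarith

lemma norm_apply_pow_four_le (x : Fin N → Vec M) (k : Fin N) :
    ‖x k‖ ^ 4 ≤ 8 * Sp.lyap 4 x :=
  (pow_le_pow_left₀ (norm_nonneg _) (Sp.norm_apply_le x k) 4).trans (add_pow_four_le _ _)

lemma norm_apply_sq_le (x : Fin N → Vec M) (k : Fin N) : ‖x k‖ ^ 2 ≤ 2 * Sp.lyap 2 x := by
  refine (pow_le_pow_left₀ (norm_nonneg _) (Sp.norm_apply_le x k) 2).trans ?_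
  unfold lyap
  nlinarith [sq_nonneg (‖Sp.cen x‖ - Sp.dis x)]

variable {A₁ A₂ : Matrix (Fin N) (Fin N) ℝ}

lemma norm_combine_sub_cen_le (Sq : Splitting M (A₁ * A₂))
    (hA₁ : A₁ ∈ Matrix.colStochastic ℝ (Fin N)) (x : Fin N → Vec M) (l : Fin N) :
    ‖combine A₁ x l - Sq.cen x‖ ≤ Sq.dis x := by
  have h : combine A₁ x l - Sq.cen x = combine A₁ (x - fun _ => Sq.cen x) l := by
    rw [combine_sub, combine_const hA₁]; rfl
  rw [h]
  exact norm_combine_apply_le hA₁ (fun k => Sq.norm_sub_le_dis x k) l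

lemma norm_combine_le (Sq : Splitting M (A₁ * A₂))
    (hA₁ : A₁ ∈ Matrix.colStochastic ℝ (Fin N)) (x : Fin N → Vec M) (l : Fin N) :
    ‖combine A₁ x l‖ ≤ ‖Sq.cen x‖ + Sq.dis x :=
  norm_combine_apply_le hA₁ (fun k => Sq.norm_apply_le x k) l

/-- The weights with which the updates of the agents enter the centroid. -/
def inputWeight (Sq : Splitting M (A₁ * A₂)) : Fin N → ℝ := A₂ *ᵥ Sq.weight

lemma inputWeight_nonneg (Sq : Splitting M (A₁ * A₂))
    (hA₂ : A₂ ∈ Matrix.colStochastic ℝ (Fin N)) (l : Fin N) : 0 ≤ Sq.inputWeight l :=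
  Matrix.nonneg_mulVec_of_mem_colStochastic hA₂ Sq.weight_nonneg l

lemma inputWeight_sum (Sq : Splitting M (A₁ * A₂))
    (hA₂ : A₂ ∈ Matrix.colStochastic ℝ (Fin N)) : ∑ l, Sq.inputWeight l = 1 := by
  rw [inputWeight, Matrix.sum_mulVec_of_mem_colStochastic hA₂, Sq.weight_sum]

/-- One step of the network: combine, subtract the updates `μ g_l`, and combine again. -/
def step (A₁ A₂ : Matrix (Fin N) (Fin N) ℝ) (μ : ℝ) (x g : Fin N → Vec M) : Fin N → Vec M :=
  combine A₂ (combine A₁ x - μ • g)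

lemma cen_step (Sq : Splitting M (A₁ * A₂)) (μ : ℝ) (x g : Fin N → Vec M) :
    Sq.cen (step A₁ A₂ μ x g) = Sq.cen x - μ • centroid Sq.inputWeight g := by
  rw [cen, step, combine_sub, centroid_sub, ← combine_mul, centroid_combine, Sq.stationary,
    centroid_combine]
  simp only [cen, centroid, inputWeight, Pi.smul_apply, Finset.smul_sum, smul_comm μ]

lemma dis_step_le (Sq : Splitting M (A₁ * A₂)) (hA₂ : A₂ ∈ Matrix.colStochastic ℝ (Fin N))
    {μ H : ℝ} (hμ : 0 ≤ μ) {x g : Fin N → Vec M} (hg : ‖g‖ ≤ H) :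
    Sq.dis (step A₁ A₂ μ x g) ≤ Sq.rate * Sq.dis x + μ * Sq.bound * H := by
  have e : step A₁ A₂ μ x g = combine (A₁ * A₂) x + combine A₂ (-(μ • g)) := by
    rw [combine_mul, ← combine_add, ← sub_eq_add_neg, step]
  rw [e]
  refine (Sq.dis_add_le _ _).trans (add_le_add (Sq.dis_combine_le x) ?_)
  refine (Sq.dis_le _).trans ?_
  have h1 : ‖combine A₂ (-(μ • g))‖ ≤ μ * H := by
    refine (_root_.norm_combine_le hA₂ _).trans ?_
    rw [norm_neg, norm_smul, Real.norm_of_nonneg hμ]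
    exact mul_le_mul_of_nonneg_left hg hμ
  calc _ ≤ Sq.bound * (μ * H) := mul_le_mul_of_nonneg_left h1 Sq.bound_nonneg
    _ = _ := by ring

lemma lyap_four_step_le [NeZero N] (Sq : Splitting M (A₁ * A₂))
    (hA₂ : A₂ ∈ Matrix.colStochastic ℝ (Fin N))
    {μ H : ℝ} (hμ : 0 ≤ μ) {x g : Fin N → Vec M} (hg : ‖g‖ ≤ H) :
    Sq.lyap 4 (step A₁ A₂ μ x g) ≤ ‖Sq.cen x‖ ^ 4
      - 4 * μ * (‖Sq.cen x‖ ^ 2 * inner ℝ (Sq.cen x) (centroid Sq.inputWeight g))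
      + 8 * μ ^ 2 * (‖Sq.cen x‖ ^ 2 * H ^ 2)
      + (3 + (1 - Sq.rate) * (Sq.bound / (1 - Sq.rate)) ^ 4) * μ ^ 4 * H ^ 4
      + Sq.rate * Sq.dis x ^ 4 := by
  have hv : ‖centroid Sq.inputWeight g‖ ≤ H :=
    (norm_centroid_le (Sq.inputWeight_nonneg hA₂) (Sq.inputWeight_sum hA₂) g).trans hg
  have h1 := norm_sub_smul_pow_four_le (u := Sq.cen x) (μ := μ) hv
  have hH : 0 ≤ H := (norm_nonneg _).trans hg
  have h2 : Sq.dis (step A₁ A₂ μ x g) ^ 4 ≤ _ :=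
    (pow_le_pow_left₀ (Sq.dis_nonneg _) (Sq.dis_step_le hA₂ hμ hg) 4).trans
      (contraction_add_pow_le Sq.rate_nonneg Sq.rate_lt_one (Sq.dis_nonneg x)
        (mul_nonneg (mul_nonneg hμ Sq.bound_nonneg) hH) 4)
  have e : (μ * Sq.bound * H / (1 - Sq.rate)) ^ 4
      = (Sq.bound / (1 - Sq.rate)) ^ 4 * μ ^ 4 * H ^ 4 := by ring
  rw [e] at h2
  rw [lyap, cen_step]
  linarith

lemma lyap_two_step_le [NeZero N] (Sq : Splitting M (A₁ * A₂))
    (hA₂ : A₂ ∈ Matrix.colStochastic ℝ (Fin N))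
    {μ H : ℝ} (hμ : 0 ≤ μ) {x g : Fin N → Vec M} (hg : ‖g‖ ≤ H) :
    Sq.lyap 2 (step A₁ A₂ μ x g) ≤ ‖Sq.cen x‖ ^ 2
      - 2 * μ * inner ℝ (Sq.cen x) (centroid Sq.inputWeight g)
      + (1 + (1 - Sq.rate) * (Sq.bound / (1 - Sq.rate)) ^ 2) * μ ^ 2 * H ^ 2
      + Sq.rate * Sq.dis x ^ 2 := by
  have hv : ‖centroid Sq.inputWeight g‖ ≤ H :=
    (norm_centroid_le (Sq.inputWeight_nonneg hA₂) (Sq.inputWeight_sum hA₂) g).trans hg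
  have h1 := norm_sub_smul_sq_le (u := Sq.cen x) (μ := μ) hv
  have hH : 0 ≤ H := (norm_nonneg _).trans hg
  have h2 : Sq.dis (step A₁ A₂ μ x g) ^ 2 ≤ _ :=
    (pow_le_pow_left₀ (Sq.dis_nonneg _) (Sq.dis_step_le hA₂ hμ hg) 2).trans
      (contraction_add_pow_le Sq.rate_nonneg Sq.rate_lt_one (Sq.dis_nonneg x)
        (mul_nonneg (mul_nonneg hμ Sq.bound_nonneg) hH) 2)
  have e : (μ * Sq.bound * H / (1 - Sq.rate)) ^ 2
      = (Sq.bound / (1 - Sq.rate)) ^ 2 * μ ^ 2 * H ^ 2 := by ring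
  rw [e] at h2
  rw [lyap, cen_step]
  linarith

/-- The mean update, with a positive total weight of the agents, pulls the centroid back. -/
lemma inner_mean_update_ge (Sq : Splitting M (A₁ * A₂))
    (hA₁ : A₁ ∈ Matrix.colStochastic ℝ (Fin N)) (hA₂ : A₂ ∈ Matrix.colStochastic ℝ (Fin N))
    {G : Fin N → Vec M → Vec M} {ν D : ℝ} (hν : 0 ≤ ν) (hD : 0 ≤ D)
    (hG : ∀ l, RestoringField (G l) ν D) {ρ : Fin N → ℝ} {ρ₀ : ℝ} (hρ₀ : 0 ≤ ρ₀)
    (hρ : ∀ l, ρ₀ ≤ ρ l) (hρ1 : ∀ l, ρ l ≤ 1) (x e : Fin N → Vec M) {T : ℝ} (he : ∀ l, ‖e l‖ ≤ T) :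
    ν * ρ₀ * ‖Sq.cen x‖ ^ 2 - D * (‖Sq.cen x‖ * Sq.dis x) - ‖Sq.cen x‖ * T
      ≤ inner ℝ (Sq.cen x)
        (centroid Sq.inputWeight fun l => ρ l • (G l (combine A₁ x l) + e l)) := by
  set u := Sq.cen x with hu
  have hl : ∀ l, ν * ρ₀ * ‖u‖ ^ 2 - D * (‖u‖ * Sq.dis x) - ‖u‖ * T
      ≤ ρ l * inner ℝ u (G l (combine A₁ x l) + e l) := fun l => by
    have h1 : -(‖u‖ * (D * Sq.dis x)) ≤ inner ℝ u (G l (combine A₁ x l) - G l u) := by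
      have h := (abs_le.1 (abs_real_inner_le_norm u (G l (combine A₁ x l) - G l u))).1
      have h' : ‖G l (combine A₁ x l) - G l u‖ ≤ D * Sq.dis x :=
        ((hG l).lipschitz _ _).trans
          (mul_le_mul_of_nonneg_left (Sq.norm_combine_sub_cen_le hA₁ x l) hD)
      linarith [mul_le_mul_of_nonneg_left h' (norm_nonneg u)]
    have h2 : -(‖u‖ * T) ≤ inner ℝ u (e l) := by
      have h := (abs_le.1 (abs_real_inner_le_norm u (e l))).1
      linarith [mul_le_mul_of_nonneg_left (he l) (norm_nonneg u)]
    have h3 := (hG l).monotone u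
    have h0 : 0 ≤ ρ l := hρ₀.trans (hρ l)
    have hdis : 0 ≤ Sq.dis x := (norm_nonneg _).trans (Sq.norm_sub_le_dis x l)
    have hT : 0 ≤ T := (norm_nonneg _).trans (he l)
    have h4 : ν * ‖u‖ ^ 2 - ‖u‖ * (D * Sq.dis x) - ‖u‖ * T
        ≤ inner ℝ u (G l (combine A₁ x l) + e l) := by
      rw [inner_sub_right] at h1
      rw [inner_add_right]
      linarith
    have h5 := mul_le_mul_of_nonneg_left h4 h0
    have h6 := mul_le_mul_of_nonneg_right (hρ l) (by positivity : 0 ≤ ν * ‖u‖ ^ 2)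
    have h7 := mul_le_mul_of_nonneg_right (hρ1 l) (by positivity : 0 ≤ ‖u‖ * (D * Sq.dis x))
    have h8 := mul_le_mul_of_nonneg_right (hρ1 l) (by positivity : 0 ≤ ‖u‖ * T)
    linarith
  calc _ = ∑ l, Sq.inputWeight l * (ν * ρ₀ * ‖u‖ ^ 2 - D * (‖u‖ * Sq.dis x) - ‖u‖ * T) := by
        rw [← Finset.sum_mul, Sq.inputWeight_sum hA₂, one_mul]
    _ ≤ ∑ l, Sq.inputWeight l * (ρ l * inner ℝ u (G l (combine A₁ x l) + e l)) :=
        Finset.sum_le_sum fun l _ =>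
          mul_le_mul_of_nonneg_left (hl l) (Sq.inputWeight_nonneg hA₂ l)
    _ = _ := by
        rw [centroid, inner_sum]
        simp only [inner_smul_right]

end Splitting

section Integrability

variable {Ω : Type*} [MeasurableSpace Ω] {μP : Measure Ω}

lemma integrable_mul_four {f₁ f₂ f₃ f₄ : Ω → ℝ} (h₁ : MemLp f₁ 4 μP) (h₂ : MemLp f₂ 4 μP)
    (h₃ : MemLp f₃ 4 μP) (h₄ : MemLp f₄ 4 μP) :
    Integrable (fun ω => f₁ ω * f₂ ω * (f₃ ω * f₄ ω)) μP := by
  have hpow : ∀ {f : Ω → ℝ}, MemLp f 4 μP → Integrable (fun ω => f ω ^ 4) μP := fun {f} hf => by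
    have := hf.integrable_norm_pow (p := 4) (by norm_num)
    refine this.congr (Eventually.of_forall fun ω => ?_)
    simp only [Real.norm_eq_abs]
    exact Even.pow_abs (by decide) _
  refine (((hpow h₁).add (hpow h₂)).add ((hpow h₃).add (hpow h₄))).mono'
    ((h₁.1.mul h₂.1).mul (h₃.1.mul h₄.1)) (Eventually.of_forall fun ω => ?_)
  have key : ∀ a b c d : ℝ, |a * b * (c * d)| ≤ a ^ 4 + b ^ 4 + (c ^ 4 + d ^ 4) := by
    intro a b c d
    have e1 : |a * b * (c * d)| ≤ (a * b) ^ 2 / 2 + (c * d) ^ 2 / 2 := by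
      rw [abs_le]
      constructor <;> nlinarith [sq_nonneg (a * b + c * d), sq_nonneg (a * b - c * d)]
    nlinarith [sq_nonneg (a ^ 2 - b ^ 2), sq_nonneg (c ^ 2 - d ^ 2), sq_nonneg (a ^ 2),
      sq_nonneg (b ^ 2), sq_nonneg (c ^ 2), sq_nonneg (d ^ 2)]
  exact key _ _ _ _

lemma integrable_pow_four {f : Ω → ℝ} (hf : MemLp f 4 μP) :
    Integrable (fun ω => f ω ^ 4) μP :=
  (integrable_mul_four hf hf hf hf).congr (Eventually.of_forall fun ω => by ring)

lemma integral_sub_mul_add {f g h : Ω → ℝ} (hf : Integrable f μP) (hg : Integrable g μP)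
    (hh : Integrable h μP) (c : ℝ) :
    ∫ ω, (f ω - c * g ω + h ω) ∂μP = ∫ ω, f ω ∂μP - c * ∫ ω, g ω ∂μP + ∫ ω, h ω ∂μP := by
  have hcg : Integrable (fun ω => c * g ω) μP := hg.const_mul c
  have hs : Integrable (fun ω => f ω - c * g ω) μP := hf.sub hcg
  rw [integral_add hs hh, integral_sub hf hcg, integral_const_mul]

lemma integral_mul_add_mul {f g : Ω → ℝ} (hf : Integrable f μP) (hg : Integrable g μP)
    (c d : ℝ) :
    ∫ ω, (c * f ω + d * g ω) ∂μP = c * ∫ ω, f ω ∂μP + d * ∫ ω, g ω ∂μP := by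
  rw [integral_add (hf.const_mul c) (hg.const_mul d), integral_const_mul, integral_const_mul]

end Integrability

end MomentStep

section MomentStep

variable {N M : ℕ} {A₁ A₂ : Matrix (Fin N) (Fin N) ℝ}

open Splitting in
/-- Fourth-order drift. The hypothesis `hdec` says that, on average, the update of agent `l` acts
on the centroid like `ρ_l G_l`. -/
theorem exists_fourth_moment_step [NeZero N] (Sq : Splitting M (A₁ * A₂))
    (hA₁ : A₁ ∈ Matrix.colStochastic ℝ (Fin N)) (hA₂ : A₂ ∈ Matrix.colStochastic ℝ (Fin N))
    {G : Fin N → Vec M → Vec M} {ν D : ℝ} (hν : 0 < ν) (hD : 0 ≤ D)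
    (hG : ∀ l, RestoringField (G l) ν D) {ρ : Fin N → ℝ} {ρ₀ : ℝ} (hρ₀ : 0 < ρ₀)
    (hρ : ∀ l, ρ₀ ≤ ρ l) (hρ1 : ∀ l, ρ l ≤ 1) :
    ∃ a > 0, ∃ b, 0 ≤ b ∧ ∃ μ₁ > 0, ∀ μ, 0 < μ → μ < μ₁ →
      ∀ {Ω : Type*} [MeasurableSpace Ω] (P : Measure Ω) (X g : Ω → Fin N → Vec M) (T : Ω → ℝ),
        MemLp X 4 P → AEStronglyMeasurable g P → MemLp T 4 P → (∀ ω, 0 ≤ T ω) →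
        (∀ ω l, ‖g ω l‖ ≤ D * ‖combine A₁ (X ω) l‖ + T ω) →
        (∀ l, ∫ ω, ‖Sq.cen (X ω)‖ ^ 2 * inner ℝ (Sq.cen (X ω)) (g ω l) ∂P
          = ρ l * ∫ ω, ‖Sq.cen (X ω)‖ ^ 2
              * inner ℝ (Sq.cen (X ω)) (G l (combine A₁ (X ω) l)) ∂P) →
        ∫ ω, Sq.lyap 4 (step A₁ A₂ μ (X ω) (g ω)) ∂P
          ≤ (1 - a * μ) * ∫ ω, Sq.lyap 4 (X ω) ∂P + b * μ ^ 3 * ∫ ω, T ω ^ 4 ∂P := by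
  have hrate : 0 < 1 - Sq.rate := by linarith [Sq.rate_lt_one]
  set L : ℝ := 3 + (1 - Sq.rate) * (Sq.bound / (1 - Sq.rate)) ^ 4
  have hL : 0 ≤ L := by positivity
  obtain ⟨b, hb, μ₁, hμ₁, habs⟩ := exists_quartic_absorption (a := ν * ρ₀) (D := D)
    (lam := Sq.rate) (L := L) (by positivity) Sq.rate_lt_one hL
  refine ⟨ν * ρ₀, by positivity, b, hb, μ₁, hμ₁, ?_⟩
  intro μ hμ hμμ₁ Ω _ P X g T hX hgm hT hT0 hg hdec
  set u : Ω → Vec M := fun ω => Sq.cen (X ω) with hu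
  set q : Ω → ℝ := fun ω => Sq.dis (X ω) with hq
  set H : Ω → ℝ := fun ω => D * (‖u ω‖ + q ω) + T ω with hH
  have hq0 : ∀ ω, 0 ≤ q ω := fun ω => Sq.dis_nonneg _
  have hH0 : ∀ ω, 0 ≤ H ω := fun ω =>
    add_nonneg (mul_nonneg hD (add_nonneg (norm_nonneg _) (hq0 ω))) (hT0 ω)
  have hgH : ∀ ω l, ‖g ω l‖ ≤ H ω := fun ω l =>
    (hg ω l).trans (add_le_add_left (mul_le_mul_of_nonneg_left
      (Sq.norm_combine_le hA₁ (X ω) l) hD) _)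
  have hum : AEStronglyMeasurable u P := Sq.continuous_cen.comp_aestronglyMeasurable hX.1
  have hu4 : MemLp u 4 P := hX.of_le hum (Eventually.of_forall fun ω => Sq.norm_cen_le _)
  have hun4 : MemLp (fun ω => ‖u ω‖) 4 P := hu4.norm
  have hq4 : MemLp q 4 P := by
    refine hX.of_le_mul (c := Sq.bound) (Sq.continuous_dis.comp_aestronglyMeasurable hX.1)
      (Eventually.of_forall fun ω => ?_)
    rw [Real.norm_of_nonneg (hq0 ω)]
    exact Sq.dis_le _
  have hH4 : MemLp H 4 P := ((hun4.add hq4).const_mul D).add hT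
  -- the inner product with any field dominated by `H` is integrable
  have hint : ∀ y : Ω → Vec M, AEStronglyMeasurable y P → (∀ ω, ‖y ω‖ ≤ H ω) →
      Integrable (fun ω => ‖u ω‖ ^ 2 * inner ℝ (u ω) (y ω)) P := fun y hy hyH => by
    refine (integrable_mul_four hun4 hun4 hun4 hH4).mono'
      ((hum.norm.pow 2).mul (hum.inner hy)) (Eventually.of_forall fun ω => ?_)
    rw [norm_mul, norm_pow, norm_norm, sq]
    refine mul_le_mul_of_nonneg_left ?_ (by positivity)
    exact (norm_inner_le_norm _ _).trans (mul_le_mul_of_nonneg_left (hyH ω) (norm_nonneg _))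
  have hglm : ∀ l, AEStronglyMeasurable (fun ω => g ω l) P := fun l =>
    (continuous_apply l).comp_aestronglyMeasurable hgm
  set y : Ω → Fin N → Vec M := fun ω l => G l (combine A₁ (X ω) l) with hy
  have hylm : ∀ l, AEStronglyMeasurable (fun ω => y ω l) P := fun l =>
    ((hG l).continuous.comp ((continuous_apply l).comp
      (continuous_combine A₁))).comp_aestronglyMeasurable hX.1
  have hyH : ∀ ω l, ‖y ω l‖ ≤ H ω := fun ω l =>
    ((hG l).norm_le _).trans ((mul_le_mul_of_nonneg_left (Sq.norm_combine_le hA₁ (X ω) l) hD).trans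
      (le_add_of_nonneg_right (hT0 ω)))
  have hexp : ∀ (z : Fin N → Vec M) (v : Vec M), ‖v‖ ^ 2 * inner ℝ v (centroid Sq.inputWeight z)
      = ∑ l, Sq.inputWeight l * (‖v‖ ^ 2 * inner ℝ v (z l)) := fun z v => by
    rw [centroid, inner_sum, Finset.mul_sum]
    refine Finset.sum_congr rfl fun l _ => ?_
    rw [inner_smul_right]; ring
  have hmean : ∫ ω, ‖u ω‖ ^ 2 * inner ℝ (u ω) (centroid Sq.inputWeight (g ω)) ∂P
      = ∫ ω, ‖u ω‖ ^ 2
          * inner ℝ (u ω) (centroid Sq.inputWeight fun l => ρ l • (y ω l + 0)) ∂P := by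
    simp only [hexp, add_zero, inner_smul_right, mul_left_comm _ (ρ _)]
    rw [integral_finsetSum _ fun l _ => (hint _ (hglm l) fun ω => hgH ω l).const_mul _,
      integral_finsetSum _ fun l _ =>
        ((hint _ (hylm l) fun ω => hyH ω l).const_mul _).const_mul _]
    refine Finset.sum_congr rfl fun l _ => ?_
    rw [integral_const_mul, integral_const_mul, integral_const_mul, hdec l]
    ring
  have hcg : Integrable (fun ω => ‖u ω‖ ^ 2
      * inner ℝ (u ω) (centroid Sq.inputWeight (g ω))) P := by
    simp only [hexp]
    exact integrable_finsetSum _ fun l _ => (hint _ (hglm l) fun ω => hgH ω l).const_mul _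
  have hcy : Integrable (fun ω => ‖u ω‖ ^ 2
      * inner ℝ (u ω) (centroid Sq.inputWeight fun l => ρ l • (y ω l + 0))) P := by
    simp only [hexp, add_zero, inner_smul_right, mul_left_comm _ (ρ _)]
    exact integrable_finsetSum _ fun l _ =>
      ((hint _ (hylm l) fun ω => hyH ω l).const_mul _).const_mul _
  set R : Ω → ℝ := fun ω => 8 * μ ^ 2 * (‖u ω‖ ^ 2 * H ω ^ 2) + L * μ ^ 4 * H ω ^ 4
    + Sq.rate * q ω ^ 4 with hR
  have hu4i : Integrable (fun ω => ‖u ω‖ ^ 4) P := integrable_pow_four hun4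
  have hq4i : Integrable (fun ω => q ω ^ 4) P := integrable_pow_four hq4
  have hRi : Integrable R P := by
    refine (((integrable_mul_four hun4 hun4 hH4 hH4).congr (Eventually.of_forall fun ω => ?_)
      |>.const_mul _).add ((integrable_pow_four hH4).const_mul _)).add (hq4i.const_mul _)
    simp only [sq]
  calc ∫ ω, Sq.lyap 4 (step A₁ A₂ μ (X ω) (g ω)) ∂P
      ≤ ∫ ω, (‖u ω‖ ^ 4 - 4 * μ * (‖u ω‖ ^ 2 * inner ℝ (u ω) (centroid Sq.inputWeight (g ω)))
          + R ω) ∂P := by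
        refine integral_mono_of_nonneg (Eventually.of_forall fun ω => Sq.lyap_nonneg 4 _)
          ((hu4i.sub (hcg.const_mul _)).add hRi) (Eventually.of_forall fun ω => ?_)
        have h := Sq.lyap_four_step_le hA₂ hμ.le (x := X ω)
          ((pi_norm_le_iff_of_nonneg (hH0 ω)).2 (hgH ω))
        simp only [hR]
        linarith
    _ = ∫ ω, (‖u ω‖ ^ 4 - 4 * μ * (‖u ω‖ ^ 2
          * inner ℝ (u ω) (centroid Sq.inputWeight fun l => ρ l • (y ω l + 0))) + R ω) ∂P := by
        rw [integral_sub_mul_add hu4i hcg hRi, integral_sub_mul_add hu4i hcy hRi, hmean]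
    _ ≤ ∫ ω, ((1 - ν * ρ₀ * μ) * Sq.lyap 4 (X ω) + b * μ ^ 3 * T ω ^ 4) ∂P := by
        refine integral_mono ((hu4i.sub (hcy.const_mul _)).add hRi)
          (((hu4i.add hq4i).const_mul _).add ((integrable_pow_four hT).const_mul _)) fun ω => ?_
        have h := Sq.inner_mean_update_ge hA₁ hA₂ hν.le hD hG hρ₀.le hρ hρ1 (X ω)
          (fun _ => 0) (T := 0) (fun l => by simp)
        have h' := mul_le_mul_of_nonneg_left h (by positivity : 0 ≤ 4 * μ * ‖u ω‖ ^ 2)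
        have h2 := habs μ hμ hμμ₁ ‖u ω‖ (q ω) (T ω) (H ω) (norm_nonneg _) (hq0 ω) (hT0 ω) rfl
        simp only [hR, lyap]
        simp only [hu, hq, hy] at h' h2 ⊢
        linarith
    _ = _ := integral_mul_add_mul (hu4i.add hq4i) (integrable_pow_four hT) _ _

open Splitting in
/-- Second-order drift. The hypothesis `hdec` says that, on average, the update of agent `l` acts
on the centroid like `ρ_l (G_l + e_l)`, with a disturbance `e_l` of size at most `T`. -/
theorem exists_second_moment_step [NeZero N] (Sq : Splitting M (A₁ * A₂))
    (hA₁ : A₁ ∈ Matrix.colStochastic ℝ (Fin N)) (hA₂ : A₂ ∈ Matrix.colStochastic ℝ (Fin N))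
    {G : Fin N → Vec M → Vec M} {ν D : ℝ} (hν : 0 < ν) (hD : 0 ≤ D)
    (hG : ∀ l, RestoringField (G l) ν D) {ρ : Fin N → ℝ} {ρ₀ : ℝ} (hρ₀ : 0 < ρ₀)
    (hρ : ∀ l, ρ₀ ≤ ρ l) (hρ1 : ∀ l, ρ l ≤ 1) :
    ∃ a > 0, ∃ b, 0 ≤ b ∧ ∃ μ₁ > 0, ∀ μ, 0 < μ → μ < μ₁ →
      ∀ {Ω : Type*} [MeasurableSpace Ω] (P : Measure Ω) (X e g : Ω → Fin N → Vec M) (T : Ω → ℝ),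
        MemLp X 2 P → AEStronglyMeasurable e P → AEStronglyMeasurable g P → MemLp T 2 P →
        (∀ ω l, ‖e ω l‖ ≤ T ω) →
        (∀ ω l, ‖g ω l‖ ≤ D * ‖combine A₁ (X ω) l‖ + T ω) →
        (∀ l, ∫ ω, inner ℝ (Sq.cen (X ω)) (g ω l) ∂P
          = ρ l * ∫ ω, inner ℝ (Sq.cen (X ω)) (G l (combine A₁ (X ω) l) + e ω l) ∂P) →
        ∫ ω, Sq.lyap 2 (step A₁ A₂ μ (X ω) (g ω)) ∂P
          ≤ (1 - a * μ) * ∫ ω, Sq.lyap 2 (X ω) ∂P + b * μ * ∫ ω, T ω ^ 2 ∂P := by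
  have hrate : 0 < 1 - Sq.rate := by linarith [Sq.rate_lt_one]
  set L : ℝ := 1 + (1 - Sq.rate) * (Sq.bound / (1 - Sq.rate)) ^ 2
  have hL : 0 ≤ L := by positivity
  obtain ⟨b, hb, μ₁, hμ₁, habs⟩ := exists_quadratic_absorption (a := ν * ρ₀) (D := D)
    (lam := Sq.rate) (L := L) (by positivity) Sq.rate_lt_one hL
  refine ⟨ν * ρ₀ / 2, by positivity, b, hb, μ₁, hμ₁, ?_⟩
  intro μ hμ hμμ₁ Ω _ P X e g T hX hem hgm hT he hg hdec
  have hT0 : ∀ ω, 0 ≤ T ω := fun ω => (norm_nonneg _).trans (he ω 0)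
  set u : Ω → Vec M := fun ω => Sq.cen (X ω) with hu
  set q : Ω → ℝ := fun ω => Sq.dis (X ω) with hq
  set H : Ω → ℝ := fun ω => D * (‖u ω‖ + q ω) + T ω with hH
  have hq0 : ∀ ω, 0 ≤ q ω := fun ω => Sq.dis_nonneg _
  have hH0 : ∀ ω, 0 ≤ H ω := fun ω =>
    add_nonneg (mul_nonneg hD (add_nonneg (norm_nonneg _) (hq0 ω))) (hT0 ω)
  have hgH : ∀ ω l, ‖g ω l‖ ≤ H ω := fun ω l =>
    (hg ω l).trans (add_le_add_left (mul_le_mul_of_nonneg_left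
      (Sq.norm_combine_le hA₁ (X ω) l) hD) _)
  have hum : AEStronglyMeasurable u P := Sq.continuous_cen.comp_aestronglyMeasurable hX.1
  have hu2 : MemLp u 2 P := hX.of_le hum (Eventually.of_forall fun ω => Sq.norm_cen_le _)
  have hun2 : MemLp (fun ω => ‖u ω‖) 2 P := hu2.norm
  have hq2 : MemLp q 2 P := by
    refine hX.of_le_mul (c := Sq.bound) (Sq.continuous_dis.comp_aestronglyMeasurable hX.1)
      (Eventually.of_forall fun ω => ?_)
    rw [Real.norm_of_nonneg (hq0 ω)]
    exact Sq.dis_le _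
  have hH2 : MemLp H 2 P := ((hun2.add hq2).const_mul D).add hT
  have hint : ∀ y : Ω → Vec M, AEStronglyMeasurable y P → (∀ ω, ‖y ω‖ ≤ H ω) →
      Integrable (fun ω => inner ℝ (u ω) (y ω)) P := fun y hy hyH => by
    refine (hun2.integrable_mul hH2).mono' (hum.inner hy) (Eventually.of_forall fun ω => ?_)
    exact (norm_inner_le_norm _ _).trans (mul_le_mul_of_nonneg_left (hyH ω) (norm_nonneg _))
  have hglm : ∀ l, AEStronglyMeasurable (fun ω => g ω l) P := fun l =>
    (continuous_apply l).comp_aestronglyMeasurable hgm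
  set y : Ω → Fin N → Vec M := fun ω l => G l (combine A₁ (X ω) l) + e ω l with hy
  have hylm : ∀ l, AEStronglyMeasurable (fun ω => y ω l) P := fun l =>
    (((hG l).continuous.comp ((continuous_apply l).comp
      (continuous_combine A₁))).comp_aestronglyMeasurable hX.1).add
      ((continuous_apply l).comp_aestronglyMeasurable hem)
  have hyH : ∀ ω l, ‖y ω l‖ ≤ H ω := fun ω l =>
    (norm_add_le _ _).trans (add_le_add (((hG l).norm_le _).trans
      (mul_le_mul_of_nonneg_left (Sq.norm_combine_le hA₁ (X ω) l) hD)) (he ω l))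
  have hexp : ∀ (z : Fin N → Vec M) (v : Vec M), inner ℝ v (centroid Sq.inputWeight z)
      = ∑ l, Sq.inputWeight l * inner ℝ v (z l) := fun z v => by
    simp only [centroid, inner_sum, inner_smul_right]
  have hmean : ∫ ω, inner ℝ (u ω) (centroid Sq.inputWeight (g ω)) ∂P
      = ∫ ω, inner ℝ (u ω) (centroid Sq.inputWeight fun l => ρ l • y ω l) ∂P := by
    simp only [hexp, inner_smul_right]
    rw [integral_finsetSum _ fun l _ => (hint _ (hglm l) fun ω => hgH ω l).const_mul _,
      integral_finsetSum _ fun l _ =>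
        ((hint _ (hylm l) fun ω => hyH ω l).const_mul _).const_mul _]
    refine Finset.sum_congr rfl fun l _ => ?_
    rw [integral_const_mul, integral_const_mul, integral_const_mul, hdec l]
  have hcg : Integrable (fun ω => inner ℝ (u ω) (centroid Sq.inputWeight (g ω))) P := by
    simp only [hexp]
    exact integrable_finsetSum _ fun l _ => (hint _ (hglm l) fun ω => hgH ω l).const_mul _
  have hcy : Integrable (fun ω =>
      inner ℝ (u ω) (centroid Sq.inputWeight fun l => ρ l • y ω l)) P := by
    simp only [hexp, inner_smul_right]
    exact integrable_finsetSum _ fun l _ =>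
      ((hint _ (hylm l) fun ω => hyH ω l).const_mul _).const_mul _
  set R : Ω → ℝ := fun ω => L * μ ^ 2 * H ω ^ 2 + Sq.rate * q ω ^ 2 with hR
  have hu2i : Integrable (fun ω => ‖u ω‖ ^ 2) P := hun2.integrable_sq
  have hq2i : Integrable (fun ω => q ω ^ 2) P := hq2.integrable_sq
  have hRi : Integrable R P := (hH2.integrable_sq.const_mul _).add (hq2i.const_mul _)
  calc ∫ ω, Sq.lyap 2 (step A₁ A₂ μ (X ω) (g ω)) ∂P
      ≤ ∫ ω, (‖u ω‖ ^ 2 - 2 * μ * inner ℝ (u ω) (centroid Sq.inputWeight (g ω)) + R ω) ∂P := by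
        refine integral_mono_of_nonneg (Eventually.of_forall fun ω => Sq.lyap_nonneg 2 _)
          ((hu2i.sub (hcg.const_mul _)).add hRi) (Eventually.of_forall fun ω => ?_)
        have h := Sq.lyap_two_step_le hA₂ hμ.le (x := X ω)
          ((pi_norm_le_iff_of_nonneg (hH0 ω)).2 (hgH ω))
        simp only [hR]
        linarith
    _ = ∫ ω, (‖u ω‖ ^ 2 - 2 * μ
          * inner ℝ (u ω) (centroid Sq.inputWeight fun l => ρ l • y ω l) + R ω) ∂P := by
        rw [integral_sub_mul_add hu2i hcg hRi, integral_sub_mul_add hu2i hcy hRi, hmean]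
    _ ≤ ∫ ω, ((1 - ν * ρ₀ / 2 * μ) * Sq.lyap 2 (X ω) + b * μ * T ω ^ 2) ∂P := by
        refine integral_mono ((hu2i.sub (hcy.const_mul _)).add hRi)
          (((hu2i.add hq2i).const_mul _).add (hT.integrable_sq.const_mul _)) fun ω => ?_
        have h := Sq.inner_mean_update_ge hA₁ hA₂ hν.le hD hG hρ₀.le hρ hρ1 (X ω)
          (e ω) (he ω)
        have h' := mul_le_mul_of_nonneg_left h (by positivity : 0 ≤ 2 * μ)
        have h2 := habs μ hμ hμμ₁ ‖u ω‖ (q ω) (T ω) (H ω) (norm_nonneg _) (hq0 ω) (hT0 ω) rfl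
        simp only [hR, lyap]
        simp only [hu, hq, hy] at h' h2 ⊢
        linarith
    _ = _ := integral_mul_add_mul (hu2i.add hq2i) hT.integrable_sq _ _

end MomentStep

/-! ### Independence of the indicators and zero mean of the noise -/

section Probability

variable {N M : ℕ} {Ω : Type*}

lemma gam_apply (S : Inputs N M Ω) (k : Fin N) (i : ℕ) (ω : Ω) (v : Vec M) :
    Matrix.toEuclideanLin (S.Gam k i ω) v = WithLp.toLp 2 fun m => S.ind k i m ω * v m := by
  ext m
  simp [Inputs.Gam, Matrix.toLpLin_apply, Matrix.mulVec_diagonal]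

lemma norm_gam_le {S : Inputs N M Ω} {k : Fin N} {i : ℕ} {ω : Ω}
    (h : ∀ m, S.ind k i m ω = 0 ∨ S.ind k i m ω = 1) (v : Vec M) :
    ‖Matrix.toEuclideanLin (S.Gam k i ω) v‖ ≤ ‖v‖ := by
  rw [gam_apply, EuclideanSpace.norm_eq, EuclideanSpace.norm_eq]
  refine Real.sqrt_le_sqrt (Finset.sum_le_sum fun m _ => ?_)
  rcases h m with h | h <;> simp [h, sq_nonneg]

lemma inner_gam (S : Inputs N M Ω) (k : Fin N) (i : ℕ) (ω : Ω) (y v : Vec M) :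
    inner ℝ y (Matrix.toEuclideanLin (S.Gam k i ω) v) = ∑ m, S.ind k i m ω * (y m * v m) := by
  rw [gam_apply, PiLp.inner_apply]
  refine Finset.sum_congr rfl fun m _ => ?_
  simp only [RCLike.inner_apply, conj_trivial]
  ring

lemma measurable_gam {m' : MeasurableSpace Ω} {S : Inputs N M Ω} {k : Fin N} {i : ℕ}
    (h : ∀ m, Measurable[m'] (S.ind k i m)) {v : Ω → Vec M} (hv : Measurable[m'] v) :
    Measurable[m'] fun ω => Matrix.toEuclideanLin (S.Gam k i ω) (v ω) := by
  simp only [gam_apply]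
  refine (PiLp.continuous_toLp 2 _).measurable.comp (measurable_pi_lambda _ fun m => ?_)
  exact (h m).mul ((EuclideanSpace.proj (𝕜 := ℝ) m).continuous.measurable.comp hv)

variable {A₁ A₂ : Matrix (Fin N) (Fin N) ℝ} {μ : Fin N → ℝ} {S : Inputs N M Ω}

lemma past_mono {i j : ℕ} (hij : i ≤ j) : past A₁ A₂ μ S i ≤ past A₁ A₂ μ S j := by
  refine sup_le_sup ?_ ?_
  · exact iSup_mono fun n => iSup_mono' fun h => ⟨h.trans hij, le_rfl⟩
  · exact iSup_mono fun n => iSup_mono' fun h => ⟨h.trans_le hij, le_rfl⟩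

lemma measurable_past_est (i : ℕ) (k : Fin N) :
    Measurable[past A₁ A₂ μ S i] (est A₁ A₂ μ S i k) := by
  refine Measurable.mono (comap_measurable _) (le_sup_of_le_left ?_) le_rfl
  exact le_iSup_of_le i (le_iSup_of_le le_rfl (le_iSup_of_le k le_rfl))

lemma measurable_past_ind (i : ℕ) (k : Fin N) (m : Fin M) :
    Measurable[past A₁ A₂ μ S (i + 1)] (S.ind k i m) := by
  refine Measurable.mono (comap_measurable _) (le_sup_of_le_right ?_) le_rfl
  exact le_iSup_of_le i (le_iSup_of_le (Nat.lt_succ_self i)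
    (le_iSup_of_le k (le_iSup_of_le m le_rfl)))

lemma measurable_past_phi (i : ℕ) (k : Fin N) :
    Measurable[past A₁ A₂ μ S i] (phi A₁ A₂ μ S i k) := by
  unfold phi combine
  exact Finset.measurable_fun_sum _ fun l _ => (measurable_past_est i l).const_smul (A₁ l k)

variable [mΩ : MeasurableSpace Ω] {P : Measure Ω}

lemma measurable_est (hS : S.Regular P) (i : ℕ) (k : Fin N) :
    Measurable (est A₁ A₂ μ S i k) := by
  induction i generalizing k with
  | zero => exact hS.measurable_init k
  | succ i ih =>
    have hφ : ∀ l, Measurable fun ω => combine A₁ (fun j => est A₁ A₂ μ S i j ω) l := fun l => by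
      unfold combine
      exact Finset.measurable_fun_sum _ fun j _ => (ih j).const_smul (A₁ j l)
    have hψ : ∀ l, Measurable fun ω => combine A₁ (fun j => est A₁ A₂ μ S i j ω) l
        - μ l • Matrix.toEuclideanLin (S.Gam l i ω)
          (S.gradHat l i (combine A₁ (fun j => est A₁ A₂ μ S i j ω) l) ω) := fun l =>
      (hφ l).sub ((measurable_gam (hS.measurable_ind l i)
        ((hS.measurable_gradHat l i).comp ((hφ l).prodMk measurable_id))).const_smul (μ l))
    simp only [est]
    unfold combine at hψ ⊢
    exact Finset.measurable_fun_sum Finset.univ fun l _ => (hψ l).const_smul (A₂ l k)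

lemma past_le (hS : S.Regular P) (i : ℕ) : past A₁ A₂ μ S i ≤ mΩ := by
  refine sup_le ?_ ?_
  · exact iSup_le fun j => iSup_le fun _ => iSup_le fun k => (measurable_est hS j k).comap_le
  · exact iSup_le fun j => iSup_le fun _ => iSup_le fun k => iSup_le fun m =>
      (hS.measurable_ind k j m).comap_le

variable [IsProbabilityMeasure P] {r : Fin N → ℝ}

lemma integral_ind (hS : S.Regular P) (hI : IndicatorConditions P A₁ A₂ μ r S)
    (hr : ∀ k, 0 ≤ r k) (k : Fin N) (i : ℕ) (m : Fin M) : ∫ ω, S.ind k i m ω ∂P = 1 - r k := by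
  have hm : MeasurableSet {ω | S.ind k i m ω = 0} :=
    hS.measurable_ind k i m (measurableSet_singleton 0)
  have h : S.ind k i m = fun ω => 1 - {ω | S.ind k i m ω = 0}.indicator (1 : Ω → ℝ) ω := by
    funext ω
    rcases hI.zero_or_one k i m ω with h | h <;> simp [Set.indicator, h]
  rw [h, integral_sub (integrable_const _) ((integrable_const 1).indicator hm),
    integral_indicator_one hm, integral_const, measureReal_def, measureReal_def, hI.prob_zero k i m,
    ENNReal.toReal_ofReal (hr k)]
  simp

end Probability

section Selection

variable {N M : ℕ} {Ω : Type*} {A₁ A₂ : Matrix (Fin N) (Fin N) ℝ} {μ : Fin N → ℝ}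
  {S : Inputs N M Ω}

lemma integral_inner_gam_of_indep {m' : MeasurableSpace Ω} [mΩ : MeasurableSpace Ω]
    {P : Measure Ω} [IsProbabilityMeasure P] {r : Fin N → ℝ} (hS : S.Regular P)
    (hI : IndicatorConditions P A₁ A₂ μ r S)
    (hr : ∀ k, 0 ≤ r k) {i : ℕ} (k : Fin N) {Y Z : Ω → Vec M} (hm'le : m' ≤ mΩ)
    (hind' : Indep (indSigma S i) m' P) (hY : Measurable[m'] Y) (hZ : Measurable[m'] Z)
    (hYZ : Integrable (fun ω => ‖Y ω‖ * ‖Z ω‖) P) :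
    ∫ ω, inner ℝ (Y ω) (Matrix.toEuclideanLin (S.Gam k i ω) (Z ω)) ∂P
      = (1 - r k) * ∫ ω, inner ℝ (Y ω) (Z ω) ∂P := by
  have hprod : ∀ m, Measurable[m'] fun ω => Y ω m * Z ω m := fun m =>
    ((EuclideanSpace.proj (𝕜 := ℝ) m).continuous.measurable.comp hY).mul
      ((EuclideanSpace.proj (𝕜 := ℝ) m).continuous.measurable.comp hZ)
  have hprodm : ∀ m, Measurable fun ω => Y ω m * Z ω m := fun m => (hprod m).mono hm'le le_rfl
  have hint : ∀ m, Integrable (fun ω => Y ω m * Z ω m) P := fun m => by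
    refine hYZ.mono' (hprodm m).aestronglyMeasurable (Eventually.of_forall fun ω => ?_)
    rw [norm_mul]
    exact mul_le_mul (PiLp.norm_apply_le _ _) (PiLp.norm_apply_le _ _) (norm_nonneg _)
      (norm_nonneg _)
  have hind : ∀ m, Integrable (fun ω => S.ind k i m ω * (Y ω m * Z ω m)) P := fun m => by
    refine (hint m).norm.mono'
      ((hS.measurable_ind k i m).mul (hprodm m)).aestronglyMeasurable
      (Eventually.of_forall fun ω => ?_)
    rw [norm_mul]
    rcases hI.zero_or_one k i m ω with h | h <;> simp [h, mul_nonneg]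
  have hindep : ∀ m, S.ind k i m ⟂ᵢ[P] fun ω => Y ω m * Z ω m := fun m => by
    rw [IndepFun_iff_Indep]
    refine indep_of_indep_of_le_left (indep_of_indep_of_le_right hind'
      (hprod m).comap_le) ?_
    exact le_iSup_of_le k (le_iSup_of_le m le_rfl)
  simp only [inner_gam]
  rw [integral_finsetSum _ fun m _ => hind m]
  have hsum : ∀ ω, inner ℝ (Y ω) (Z ω) = ∑ m, Y ω m * Z ω m := fun ω => by
    rw [PiLp.inner_apply]
    exact Finset.sum_congr rfl fun m _ => by simp [mul_comm]
  simp only [hsum]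
  rw [integral_finsetSum _ fun m _ => hint m, Finset.mul_sum]
  refine Finset.sum_congr rfl fun m _ => ?_
  rw [(hindep m).integral_fun_mul_eq_mul_integral
    (hS.measurable_ind k i m).aestronglyMeasurable (hprodm m).aestronglyMeasurable,
    integral_ind hS hI hr]

variable [mΩ : MeasurableSpace Ω] {P : Measure Ω} [IsProbabilityMeasure P] {r : Fin N → ℝ}

/-- The selection matrix of agent `k` acts on average as the factor `1 - r_k` on everything that is
determined by the past and by the approximate gradient of agent `k`. -/
lemma integral_inner_gam (hS : S.Regular P) (hI : IndicatorConditions P A₁ A₂ μ r S)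
    (hr : ∀ k, 0 ≤ r k) {i : ℕ} {x : Ω → Vec M} (hx : IsIterate P A₁ A₂ μ S i x) (k : Fin N)
    {Y Z : Ω → Vec M}
    (hY : Measurable[past A₁ A₂ μ S i
      ⊔ MeasurableSpace.comap (fun ω => S.gradHat k i (x ω) ω) inferInstance] Y)
    (hZ : Measurable[past A₁ A₂ μ S i
      ⊔ MeasurableSpace.comap (fun ω => S.gradHat k i (x ω) ω) inferInstance] Z)
    (hYZ : Integrable (fun ω => ‖Y ω‖ * ‖Z ω‖) P) :
    ∫ ω, inner ℝ (Y ω) (Matrix.toEuclideanLin (S.Gam k i ω) (Z ω)) ∂P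
      = (1 - r k) * ∫ ω, inner ℝ (Y ω) (Z ω) ∂P := by
  have hxm : Measurable x := hx.1.mono (past_le hS i) le_rfl
  exact integral_inner_gam_of_indep hS hI hr k (sup_le (past_le hS i)
    ((hS.measurable_gradHat k i).comp (hxm.prodMk measurable_id)).comap_le)
    (hI.indep_past i x hx k) hY hZ hYZ

/-- The gradient noise is orthogonal to the past. -/
lemma integral_inner_gradNoise {J : Fin N → Vec M → ℝ} {β σ : Fin N → ℝ} (hS : S.Regular P)
    (hn : NoiseConditions P A₁ A₂ μ J β σ S) {i : ℕ} {x : Ω → Vec M}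
    (hx : IsIterate P A₁ A₂ μ S i x) (k : Fin N) {Y : Ω → Vec M}
    (hY : Measurable[past A₁ A₂ μ S i] Y)
    (hint : Integrable (fun ω => ‖Y ω‖ * ‖gradNoise J S k i (x ω) ω‖) P) :
    ∫ ω, inner ℝ (Y ω) (gradNoise J S k i (x ω) ω) ∂P = 0 := by
  have hle := past_le (A₁ := A₁) (A₂ := A₂) (μ := μ) hS i
  have hs := hn.memLp i x hx k
  have hi : Integrable (fun ω => inner ℝ (Y ω) (gradNoise J S k i (x ω) ω)) P :=
    hint.mono' ((hY.mono hle le_rfl).aestronglyMeasurable.inner hs.1)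
      (Eventually.of_forall fun ω => norm_inner_le_norm _ _)
  have h := condExp_bilin_of_stronglyMeasurable_left (μ := P) (m := past A₁ A₂ μ S i)
    (innerSL ℝ (E := Vec M)) hY.stronglyMeasurable hi (hs.integrable (by norm_num))
  rw [← integral_condExp hle]
  refine integral_eq_zero_of_ae ?_
  refine h.trans ?_
  filter_upwards [hn.mean_zero i x hx k] with ω hω
  rw [hω]
  simp

end Selection

/-! ### The error dynamics, the long-term model and their difference as network steps -/

section Dynamics

variable {N M : ℕ} {Ω : Type*}

/-- The errors `wo - w_{k,i-1}` of all agents. -/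
def netState (A₁ A₂ : Matrix (Fin N) (Fin N) ℝ) (μ : Fin N → ℝ) (wo : Vec M) (S : Inputs N M Ω)
    (i : ℕ) (ω : Ω) : Fin N → Vec M :=
  fun k => wo - est A₁ A₂ μ S i k ω

/-- The blocks of a block vector. -/
def blocks (x : BVec N M) : Fin N → Vec M := fun k => block k x

/-- The gradient noises of all agents at the intermediate estimates. -/
def noiseState (A₁ A₂ : Matrix (Fin N) (Fin N) ℝ) (μ : Fin N → ℝ) (J : Fin N → Vec M → ℝ)
    (S : Inputs N M Ω) (i : ℕ) (ω : Ω) : Fin N → Vec M :=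
  fun l => gradNoise J S l i (phi A₁ A₂ μ S i l ω) ω

/-- The gradient of `J_l` as a field in terms of the error. -/
def gradField (J : Fin N → Vec M → ℝ) (wo : Vec M) (l : Fin N) (x : Vec M) : Vec M :=
  -gradient (J l) (wo - x)

/-- The linearization of `gradField` at the minimizer. -/
def hessField (J : Fin N → Vec M → ℝ) (wo : Vec M) (l : Fin N) (x : Vec M) : Vec M :=
  Matrix.toEuclideanLin (hessian (J l) wo) x

/-- The updates `τ_l Γ_{l,i} h_l`. -/
def netUpdate (τ : Fin N → ℝ) (S : Inputs N M Ω) (i : ℕ) (ω : Ω) (h : Fin N → Vec M) :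
    Fin N → Vec M :=
  fun l => τ l • Matrix.toEuclideanLin (S.Gam l i ω) (h l)

lemma netUpdate_sub (τ : Fin N → ℝ) (S : Inputs N M Ω) (i : ℕ) (ω : Ω) (h h' : Fin N → Vec M) :
    netUpdate τ S i ω (h - h') = netUpdate τ S i ω h - netUpdate τ S i ω h' := by
  funext l
  simp [netUpdate, smul_sub]

lemma norm_netUpdate_le {τ : Fin N → ℝ} (hτ : ∀ k, 0 ≤ τ k) (hτ1 : ∀ k, τ k ≤ 1)
    {S : Inputs N M Ω} {i : ℕ} {ω : Ω} (hI : ∀ k m, S.ind k i m ω = 0 ∨ S.ind k i m ω = 1)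
    (h : Fin N → Vec M) (l : Fin N) : ‖netUpdate τ S i ω h l‖ ≤ ‖h l‖ := by
  rw [netUpdate, norm_smul, Real.norm_of_nonneg (hτ l)]
  calc _ ≤ 1 * ‖h l‖ := mul_le_mul (hτ1 l) (norm_gam_le (hI l) _) (norm_nonneg _) zero_le_one
    _ = _ := one_mul _

lemma measurable_netUpdate {m' : MeasurableSpace Ω} (τ : Fin N → ℝ) {S : Inputs N M Ω} {i : ℕ}
    (hS : ∀ k m, Measurable[m'] (S.ind k i m)) {h : Ω → Fin N → Vec M} (hh : Measurable[m'] h) :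
    Measurable[m'] fun ω => netUpdate τ S i ω (h ω) :=
  measurable_pi_lambda _ fun l =>
    (measurable_gam (hS l) ((measurable_pi_apply l).comp hh)).const_smul (τ l)

lemma step_sub (A₁ A₂ : Matrix (Fin N) (Fin N) ℝ) (μ : ℝ) (x x' g g' : Fin N → Vec M) :
    Splitting.step A₁ A₂ μ (x - x') (g - g')
      = Splitting.step A₁ A₂ μ x g - Splitting.step A₁ A₂ μ x' g' := by
  simp only [Splitting.step, ← combine_sub]
  congr 1
  rw [combine_sub, smul_sub]
  abel

lemma measurable_step_netUpdate {m' : MeasurableSpace Ω} (A₁ A₂ : Matrix (Fin N) (Fin N) ℝ)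
    (μmax : ℝ) (τ : Fin N → ℝ) {S : Inputs N M Ω} {i : ℕ}
    (hS : ∀ k m, Measurable[m'] (S.ind k i m)) {x h : Ω → Fin N → Vec M}
    (hx : Measurable[m'] x) (hh : Measurable[m'] h) :
    Measurable[m'] fun ω =>
      Splitting.step A₁ A₂ μmax (x ω) (netUpdate τ S i ω (h ω)) :=
  (continuous_combine A₂).measurable.comp (((continuous_combine A₁).measurable.comp hx).sub
    ((measurable_netUpdate τ hS hh).const_smul μmax))

variable {A₁ A₂ : Matrix (Fin N) (Fin N) ℝ} {μ τ : Fin N → ℝ} {μmax : ℝ}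
  {J : Fin N → Vec M → ℝ} {wo : Vec M} {S : Inputs N M Ω}

lemma combine_netState (hA₁ : A₁ ∈ Matrix.colStochastic ℝ (Fin N)) (i : ℕ) (ω : Ω) (l : Fin N) :
    combine A₁ (netState A₁ A₂ μ wo S i ω) l = wo - phi A₁ A₂ μ S i l ω := by
  have h : netState A₁ A₂ μ wo S i ω = (fun _ => wo) - fun k => est A₁ A₂ μ S i k ω := rfl
  rw [h, combine_sub, combine_const hA₁]
  rfl

lemma netState_succ (hA₁ : A₁ ∈ Matrix.colStochastic ℝ (Fin N))
    (hA₂ : A₂ ∈ Matrix.colStochastic ℝ (Fin N)) (hμ : ∀ k, μ k = τ k * μmax) (i : ℕ) (ω : Ω) :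
    netState A₁ A₂ μ wo S (i + 1) ω = Splitting.step A₁ A₂ μmax (netState A₁ A₂ μ wo S i ω)
      (netUpdate τ S i ω fun l => gradField J wo l (combine A₁ (netState A₁ A₂ μ wo S i ω) l)
        - noiseState A₁ A₂ μ J S i ω l) := by
  have h : netState A₁ A₂ μ wo S (i + 1) ω = combine A₂ ((fun _ => wo) - fun l =>
      phi A₁ A₂ μ S i l ω - μ l • Matrix.toEuclideanLin (S.Gam l i ω)
        (S.gradHat l i (phi A₁ A₂ μ S i l ω) ω)) := by
    rw [combine_sub, combine_const hA₂]
    rfl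
  rw [h, Splitting.step]
  congr 1
  funext l
  simp only [Pi.sub_apply, Pi.smul_apply, combine_netState hA₁, netUpdate, gradField, noiseState,
    gradNoise, sub_sub_cancel, hμ, map_sub, map_neg, mul_smul, smul_sub, smul_neg,
    smul_comm μmax]
  abel

lemma blocks_calA_transpose (A : Matrix (Fin N) (Fin N) ℝ) (x : BVec N M) :
    blocks (Matrix.toEuclideanLin (calA M A)ᵀ x) = combine A (blocks x) := by
  funext k
  ext m
  simp only [blocks, block, combine, calA, Matrix.toLpLin_apply, Matrix.mulVec, dotProduct,
    Matrix.transpose_apply, Matrix.kroneckerMap_apply, Matrix.one_apply, Fintype.sum_prod_type,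
    WithLp.ofLp_sum, WithLp.ofLp_smul, Finset.sum_apply, Pi.smul_apply, smul_eq_mul]
  simp

lemma block_calM (a : Fin N → ℝ) (x : BVec N M) (k : Fin N) :
    block k (Matrix.toEuclideanLin (calM M a) x) = a k • block k x := by
  ext m
  simp only [block, calM, Matrix.toLpLin_apply, Matrix.mulVec, dotProduct,
    Matrix.kroneckerMap_apply, Matrix.one_apply, Matrix.diagonal_apply, Fintype.sum_prod_type,
    WithLp.ofLp_smul, Pi.smul_apply, smul_eq_mul]
  simp [ite_mul, Finset.sum_ite_eq]

lemma block_blockDiag (X : Fin N → Matrix (Fin M) (Fin M) ℝ) (x : BVec N M) (k : Fin N) :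
    block k (Matrix.toEuclideanLin (blockDiag X) x) = Matrix.toEuclideanLin (X k) (block k x) := by
  ext m
  simp only [block, blockDiag, Matrix.toLpLin_apply, Matrix.mulVec, dotProduct,
    Matrix.of_apply, Fintype.sum_prod_type, ite_mul, zero_mul]
  simp

lemma blocks_add (x y : BVec N M) : blocks (x + y) = blocks x + blocks y := rfl

lemma blocks_sub (x y : BVec N M) : blocks (x - y) = blocks x - blocks y := rfl

/-- One step of the long-term model in terms of the blocks. -/
lemma blocks_model_step (hμ : ∀ k, μ k = τ k * μmax) (i : ℕ) (ω : Ω) (x : BVec N M) :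
    blocks (Matrix.toEuclideanLin (calB' A₁ A₂ μ J wo S i ω) x
      + Matrix.toEuclideanLin ((calA M A₂)ᵀ * calM M μ * S.calGam i ω)
        (netNoise A₁ A₂ μ J S i ω))
      = Splitting.step A₁ A₂ μmax (blocks x)
        (netUpdate τ S i ω fun l => hessField J wo l (combine A₁ (blocks x) l)
          - noiseState A₁ A₂ μ J S i ω l) := by
  have hB : blocks (Matrix.toEuclideanLin (calB' A₁ A₂ μ J wo S i ω) x)
      = combine A₂ (fun l => combine A₁ (blocks x) l - μ l • Matrix.toEuclideanLin (S.Gam l i ω)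
          (hessField J wo l (combine A₁ (blocks x) l))) := by
    rw [calB', Matrix.toLpLin_mul_same, Matrix.toLpLin_mul_same, LinearMap.comp_apply,
      LinearMap.comp_apply, blocks_calA_transpose]
    congr 1
    funext l
    rw [map_sub, LinearMap.sub_apply, blocks_sub, Pi.sub_apply, Matrix.toLpLin_one,
      LinearMap.id_apply, blocks_calA_transpose]
    congr 1
    rw [Matrix.toLpLin_mul_same, Matrix.toLpLin_mul_same, LinearMap.comp_apply,
      LinearMap.comp_apply, blocks, block_calM, Inputs.calGam, block_blockDiag, calH,
      block_blockDiag, ← blocks_calA_transpose]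
    rfl
  have hN : blocks (Matrix.toEuclideanLin ((calA M A₂)ᵀ * calM M μ * S.calGam i ω)
        (netNoise A₁ A₂ μ J S i ω))
      = combine A₂ (fun l => μ l • Matrix.toEuclideanLin (S.Gam l i ω)
          (noiseState A₁ A₂ μ J S i ω l)) := by
    rw [Matrix.toLpLin_mul_same, Matrix.toLpLin_mul_same, LinearMap.comp_apply,
      LinearMap.comp_apply, blocks_calA_transpose]
    congr 1
    funext l
    rw [blocks, block_calM, Inputs.calGam, block_blockDiag]
    rfl
  rw [blocks_add, hB, hN, ← combine_add, Splitting.step]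
  congr 1
  funext l
  simp only [Pi.sub_apply, Pi.add_apply, Pi.smul_apply, netUpdate, hμ, map_sub, mul_smul, smul_sub,
    smul_comm μmax]
  abel

lemma pi_norm_pow_le_sum [NeZero N] (x : Fin N → Vec M) (n : ℕ) : ‖x‖ ^ n ≤ ∑ l, ‖x l‖ ^ n := by
  obtain ⟨l, hl⟩ := Finite.exists_max fun l => ‖x l‖
  calc ‖x‖ ^ n ≤ ‖x l‖ ^ n :=
        pow_le_pow_left₀ (norm_nonneg _) ((pi_norm_le_iff_of_nonneg (norm_nonneg _)).2 hl) n
    _ ≤ _ := Finset.single_le_sum (f := fun l => ‖x l‖ ^ n) (fun l _ => by positivity)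
        (Finset.mem_univ l)

lemma measurable_netState (i : ℕ) :
    Measurable[past A₁ A₂ μ S i] (netState A₁ A₂ μ wo S i) := by
  let _ : MeasurableSpace Ω := past A₁ A₂ μ S i
  exact measurable_pi_lambda _ fun k => (measurable_past_est i k).const_sub wo

lemma measurable_field {m' : MeasurableSpace Ω} {G : Fin N → Vec M → Vec M} {D : ℝ}
    (hG : ∀ l, RestoringField (G l) ν D) (A : Matrix (Fin N) (Fin N) ℝ)
    {x : Ω → Fin N → Vec M} (hx : Measurable[m'] x) :
    Measurable[m'] fun ω l => G l (combine A (x ω) l) :=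
  measurable_pi_lambda _ fun l => ((hG l).continuous.comp
    ((continuous_apply l).comp (continuous_combine A))).measurable.comp hx

end Dynamics

/-! ### Moments of the network errors, the model and the noise -/

section Moments

variable {N M : ℕ} {Ω : Type*} [mΩ : MeasurableSpace Ω] {P : Measure Ω}
  {A₁ A₂ : Matrix (Fin N) (Fin N) ℝ} {μ τ : Fin N → ℝ} {μmax : ℝ} {J : Fin N → Vec M → ℝ}
  {wo : Vec M} {ν δ : ℝ} {r β σ : Fin N → ℝ} {S : Inputs N M Ω}

lemma isIterate_phi {i : ℕ} (hE : ∀ k, MemLp (est A₁ A₂ μ S i k) 4 P) (l : Fin N) :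
    IsIterate P A₁ A₂ μ S i (phi A₁ A₂ μ S i l) := by
  refine ⟨measurable_past_phi i l, ?_⟩
  unfold phi combine
  exact memLp_finsetSum _ fun k _ => (hE k).const_smul (A₁ k l)

lemma memLp_noiseState (hE : ∀ i k, MemLp (est A₁ A₂ μ S i k) 4 P)
    (hn : NoiseConditions P A₁ A₂ μ J β σ S) (i : ℕ) :
    MemLp (noiseState A₁ A₂ μ J S i) 4 P :=
  memLp_pi_iff.2 fun l => hn.memLp i _ (isIterate_phi (hE i) l) l

lemma memLp_gam (hS : S.Regular P) (hI : IndicatorConditions P A₁ A₂ μ r S) (k : Fin N) (i : ℕ)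
    {x : Ω → Vec M} (hx : MemLp x 4 P) :
    MemLp (fun ω => Matrix.toEuclideanLin (S.Gam k i ω) (x ω)) 4 P := by
  refine hx.of_le ?_ (Eventually.of_forall fun ω =>
    norm_gam_le (fun m => hI.zero_or_one k i m ω) _)
  obtain ⟨y, hy, hxy⟩ := hx.1.aemeasurable
  refine AEMeasurable.aestronglyMeasurable
    ⟨_, measurable_gam (hS.measurable_ind k i) hy, ?_⟩
  filter_upwards [hxy] with ω hω
  rw [hω]

lemma memLp_netUpdate (hS : S.Regular P) (hI : IndicatorConditions P A₁ A₂ μ r S) (τ : Fin N → ℝ)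
    (i : ℕ) {h : Ω → Fin N → Vec M} (hh : MemLp h 4 P) :
    MemLp (fun ω => netUpdate τ S i ω (h ω)) 4 P :=
  memLp_pi_iff.2 fun l => (memLp_gam hS hI l i (hh.eval l)).const_smul (τ l)

lemma memLp_combine (A : Matrix (Fin N) (Fin N) ℝ) {h : Ω → Fin N → Vec M} (hh : MemLp h 4 P) :
    MemLp (fun ω => combine A (h ω)) 4 P :=
  memLp_pi_iff.2 fun k => memLp_finsetSum _ fun l _ => (hh.eval l).const_smul (A l k)

lemma memLp_step (A₁ A₂ : Matrix (Fin N) (Fin N) ℝ) (μmax : ℝ) {x g : Ω → Fin N → Vec M}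
    (hx : MemLp x 4 P) (hg : MemLp g 4 P) :
    MemLp (fun ω => Splitting.step A₁ A₂ μmax (x ω) (g ω)) 4 P :=
  memLp_combine A₂ ((memLp_combine A₁ hx).sub (hg.const_smul μmax))

lemma memLp_field {G : Fin N → Vec M → Vec M} {D : ℝ} (hG : ∀ l, RestoringField (G l) ν D)
    (A : Matrix (Fin N) (Fin N) ℝ) {x : Ω → Fin N → Vec M} (hx : MemLp x 4 P) :
    MemLp (fun ω l => G l (combine A (x ω) l)) 4 P :=
  memLp_pi_iff.2 fun l => ((memLp_combine A hx).eval l).of_le_mul (c := D)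
    ((hG l).continuous.comp_aestronglyMeasurable ((memLp_combine A hx).eval l).1)
    (Eventually.of_forall fun _ => (hG l).norm_le _)

variable [IsProbabilityMeasure P]

lemma memLp_gradient (hJ : ∀ k, HessianBounds (J k) ν δ) (hν : 0 ≤ ν)
    (hwo : ∀ k, IsMinOn (J k) Set.univ wo) (l : Fin N) {x : Ω → Vec M} (hx : MemLp x 4 P) :
    MemLp (fun ω => gradient (J l) (x ω)) 4 P := by
  refine (hx.sub (memLp_const wo)).of_le_mul (c := |δ|)
    ((hJ l).continuous_gradient.comp_aestronglyMeasurable hx.1) (Eventually.of_forall fun ω => ?_)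
  have h := (hJ l).norm_gradient_sub_le hν (x ω) wo
  rwa [gradient_eq_zero_of_isMinOn (hwo l), sub_zero] at h

lemma memLp_est (hS : S.Regular P) (hI : IndicatorConditions P A₁ A₂ μ r S)
    (hn : NoiseConditions P A₁ A₂ μ J β σ S) (hJ : ∀ k, HessianBounds (J k) ν δ) (hν : 0 ≤ ν)
    (hwo : ∀ k, IsMinOn (J k) Set.univ wo) (i : ℕ) (k : Fin N) :
    MemLp (est A₁ A₂ μ S i k) 4 P := by
  induction i generalizing k with
  | zero => exact hS.memLp_init k
  | succ i ih =>
    have hφ := isIterate_phi ih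
    have hg : ∀ l, MemLp (fun ω => S.gradHat l i (phi A₁ A₂ μ S i l ω) ω) 4 P := fun l => by
      refine ((hn.memLp i _ (hφ l) l).add (memLp_gradient hJ hν hwo l (hφ l).2)).ae_eq
        (Eventually.of_forall fun ω => ?_)
      simp [gradNoise]
    have hψ := fun l => (hφ l).2.sub ((memLp_gam hS hI l i (hg l)).const_smul (μ l))
    have h : est A₁ A₂ μ S (i + 1) k = fun ω => ∑ l, A₂ l k • (phi A₁ A₂ μ S i l ω
        - μ l • Matrix.toEuclideanLin (S.Gam l i ω)
          (S.gradHat l i (phi A₁ A₂ μ S i l ω) ω)) := rfl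
    rw [h]
    exact memLp_finsetSum _ fun l _ => (hψ l).const_smul (A₂ l k)

lemma memLp_netState (hE : ∀ i k, MemLp (est A₁ A₂ μ S i k) 4 P) (i : ℕ) :
    MemLp (netState A₁ A₂ μ wo S i) 4 P :=
  memLp_pi_iff.2 fun k => (memLp_const wo).sub (hE i k)

/-- The fourth moment of the noise is controlled by the Lyapunov function of the network error. -/
lemma integral_noiseState_le [NeZero N] (Sq : Splitting M (A₁ * A₂))
    (hA₁ : A₁ ∈ Matrix.colStochastic ℝ (Fin N)) (hS : S.Regular P)
    (hE : ∀ i k, MemLp (est A₁ A₂ μ S i k) 4 P) (hn : NoiseConditions P A₁ A₂ μ J β σ S) (i : ℕ) :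
    ∫ ω, ‖noiseState A₁ A₂ μ J S i ω‖ ^ 4 ∂P
      ≤ (∑ l, 64 * β l ^ 4) * ∫ ω, Sq.lyap 4 (netState A₁ A₂ μ wo S i ω) ∂P
        + ∑ l, (8 * β l ^ 4 * ‖wo‖ ^ 4 + σ l ^ 4) := by
  have hs := memLp_noiseState hE hn i
  have hX := memLp_netState (wo := wo) hE i
  have hsl : ∀ l, Integrable (fun ω => ‖noiseState A₁ A₂ μ J S i ω l‖ ^ 4) P := fun l =>
    integrable_pow_four (hs.eval l).norm
  have hlyap : Integrable (fun ω => Sq.lyap 4 (netState A₁ A₂ μ wo S i ω)) P := by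
    refine ((integrable_pow_four hX.norm).const_mul (1 + Sq.bound ^ 4)).mono'
      ((Sq.continuous_lyap 4).comp_aestronglyMeasurable hX.1) (Eventually.of_forall fun ω => ?_)
    rw [Real.norm_of_nonneg (Sq.lyap_nonneg 4 _)]
    exact Sq.lyap_le 4 _
  have hl : ∀ l, ∫ ω, ‖noiseState A₁ A₂ μ J S i ω l‖ ^ 4 ∂P
      ≤ 64 * β l ^ 4 * ∫ ω, Sq.lyap 4 (netState A₁ A₂ μ wo S i ω) ∂P
        + (8 * β l ^ 4 * ‖wo‖ ^ 4 + σ l ^ 4) := fun l => by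
    have hφ := isIterate_phi (hE i) l
    have hφ4 : Integrable (fun ω => ‖phi A₁ A₂ μ S i l ω‖ ^ 4) P := integrable_pow_four hφ.2.norm
    calc ∫ ω, ‖noiseState A₁ A₂ μ J S i ω l‖ ^ 4 ∂P
        = ∫ ω, (P[fun ω => ‖noiseState A₁ A₂ μ J S i ω l‖ ^ 4 | past A₁ A₂ μ S i]) ω ∂P :=
          (integral_condExp (past_le hS i)).symm
      _ ≤ ∫ ω, (β l ^ 4 * ‖phi A₁ A₂ μ S i l ω‖ ^ 4 + σ l ^ 4) ∂P :=
          integral_mono_ae integrable_condExp ((hφ4.const_mul _).add (integrable_const _))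
            (hn.fourth_moment i _ hφ l)
      _ ≤ ∫ ω, (64 * β l ^ 4 * Sq.lyap 4 (netState A₁ A₂ μ wo S i ω)
            + (8 * β l ^ 4 * ‖wo‖ ^ 4 + σ l ^ 4) * 1) ∂P := by
          refine integral_mono ((hφ4.const_mul _).add (integrable_const _))
            ((hlyap.const_mul _).add ((integrable_const _).const_mul _)) fun ω => ?_
          have h1 : ‖phi A₁ A₂ μ S i l ω‖
              ≤ ‖wo‖ + ‖combine A₁ (netState A₁ A₂ μ wo S i ω) l‖ := by
            rw [combine_netState hA₁]
            have := norm_sub_le wo (wo - phi A₁ A₂ μ S i l ω)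
            rwa [sub_sub_cancel] at this
          have h2 := (pow_le_pow_left₀ (norm_nonneg _) h1 4).trans (add_pow_four_le _ _)
          have h3 : ‖combine A₁ (netState A₁ A₂ μ wo S i ω) l‖ ^ 4
              ≤ 8 * Sq.lyap 4 (netState A₁ A₂ μ wo S i ω) :=
            (pow_le_pow_left₀ (norm_nonneg _) (Sq.norm_combine_le hA₁ _ l) 4).trans
              (add_pow_four_le _ _)
          have h4 : ‖phi A₁ A₂ μ S i l ω‖ ^ 4
              ≤ 8 * (‖wo‖ ^ 4 + 8 * Sq.lyap 4 (netState A₁ A₂ μ wo S i ω)) := by linarith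
          have h5 := mul_le_mul_of_nonneg_left h4 (by positivity : 0 ≤ β l ^ 4)
          linarith
      _ = _ := by
          rw [integral_mul_add_mul hlyap (integrable_const _)]
          simp
  calc ∫ ω, ‖noiseState A₁ A₂ μ J S i ω‖ ^ 4 ∂P
      ≤ ∫ ω, ∑ l, ‖noiseState A₁ A₂ μ J S i ω l‖ ^ 4 ∂P :=
        integral_mono (integrable_pow_four hs.norm) (integrable_finsetSum _ fun l _ => hsl l)
          fun ω => pi_norm_pow_le_sum _ 4
    _ = ∑ l, ∫ ω, ‖noiseState A₁ A₂ μ J S i ω l‖ ^ 4 ∂P :=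
        integral_finsetSum _ fun l _ => hsl l
    _ ≤ _ := by
        rw [Finset.sum_mul, ← Finset.sum_add_distrib]
        exact Finset.sum_le_sum fun l _ => hl l

/-- The fourth-order decoupling: both the selection and the noise average out. -/
lemma integral_decoupled_four (hS : S.Regular P) (hI : IndicatorConditions P A₁ A₂ μ r S)
    (hr : ∀ k, 0 ≤ r k) (hE : ∀ i k, MemLp (est A₁ A₂ μ S i k) 4 P)
    (hn : NoiseConditions P A₁ A₂ μ J β σ S) (hJ : ∀ k, HessianBounds (J k) ν δ) (i : ℕ)
    {u : Ω → Vec M} (hu : IsIterate P A₁ A₂ μ S i u) {h : Ω → Fin N → Vec M}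
    (hh : IsIterate P A₁ A₂ μ S i h) (τ : Fin N → ℝ) (l : Fin N) :
    ∫ ω, ‖u ω‖ ^ 2 * inner ℝ (u ω)
        (netUpdate τ S i ω (fun l => h ω l - noiseState A₁ A₂ μ J S i ω l) l) ∂P
      = τ l * (1 - r l) * ∫ ω, ‖u ω‖ ^ 2 * inner ℝ (u ω) (h ω l) ∂P := by
  have hφ := isIterate_phi (hE i) l
  have hs : MemLp (fun ω => noiseState A₁ A₂ μ J S i ω l) 4 P := (memLp_noiseState hE hn i).eval l
  have hhl : MemLp (fun ω => h ω l) 4 P := hh.2.eval l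
  have hhm : Measurable[past A₁ A₂ μ S i] fun ω => h ω l := (measurable_pi_apply l).comp hh.1
  set Y : Ω → Vec M := fun ω => ‖u ω‖ ^ 2 • u ω with hY
  have hYm : Measurable[past A₁ A₂ μ S i] Y := by
    have hc : Continuous fun v : Vec M => ‖v‖ ^ 2 • v := by fun_prop
    exact hc.measurable.comp hu.1
  have hint : ∀ {z : Ω → Vec M}, MemLp z 4 P → Integrable (fun ω => ‖Y ω‖ * ‖z ω‖) P :=
    fun {z} hz => by
      refine (integrable_mul_four hu.2.norm hu.2.norm hu.2.norm hz.norm).congr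
        (Eventually.of_forall fun ω => ?_)
      simp only [hY, norm_smul, norm_pow, norm_norm]
      ring
  have hle : past A₁ A₂ μ S i ≤ past A₁ A₂ μ S i
      ⊔ MeasurableSpace.comap (fun ω => S.gradHat l i (phi A₁ A₂ μ S i l ω) ω) inferInstance :=
    le_sup_left
  have hsm : Measurable[past A₁ A₂ μ S i
      ⊔ MeasurableSpace.comap (fun ω => S.gradHat l i (phi A₁ A₂ μ S i l ω) ω) inferInstance]
      fun ω => noiseState A₁ A₂ μ J S i ω l :=
    (Measurable.mono (comap_measurable _) le_sup_right le_rfl).sub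
      ((hJ l).continuous_gradient.measurable.comp (hφ.1.mono hle le_rfl))
  have h1 := integral_inner_gam hS hI hr hφ l (hYm.mono hle le_rfl)
    ((hhm.mono hle le_rfl).sub hsm) (hint (hhl.sub hs))
  have hin : ∀ {z : Ω → Vec M}, MemLp z 4 P → Integrable (fun ω => inner ℝ (Y ω) (z ω)) P :=
    fun {z} hz => (hint hz).mono'
      ((hYm.mono (past_le hS i) le_rfl).aestronglyMeasurable.inner hz.1)
      (Eventually.of_forall fun ω => norm_inner_le_norm _ _)
  have h2 : ∫ ω, inner ℝ (Y ω) (noiseState A₁ A₂ μ J S i ω l) ∂P = 0 :=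
    integral_inner_gradNoise hS hn hφ l hYm (hint hs)
  have h3 : ∫ ω, inner ℝ (Y ω) (h ω l - noiseState A₁ A₂ μ J S i ω l) ∂P
      = ∫ ω, inner ℝ (Y ω) (h ω l) ∂P := by
    simp only [inner_sub_right]
    rw [integral_sub (hin hhl) (hin hs), h2, sub_zero]
  have e : ∀ ω z, ‖u ω‖ ^ 2 * inner ℝ (u ω) z = inner ℝ (Y ω) z := fun ω z => by
    rw [hY, real_inner_smul_left]
  simp only [e]
  simp only [netUpdate, inner_smul_right]
  rw [integral_const_mul, mul_assoc, ← h3]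
  exact congrArg (τ l * ·) h1

/-- The second-order decoupling, without noise. -/
lemma integral_decoupled_two (hS : S.Regular P) (hI : IndicatorConditions P A₁ A₂ μ r S)
    (hr : ∀ k, 0 ≤ r k) (hE : ∀ i k, MemLp (est A₁ A₂ μ S i k) 4 P) (i : ℕ)
    {u : Ω → Vec M} (hu : IsIterate P A₁ A₂ μ S i u) {h : Ω → Fin N → Vec M}
    (hh : IsIterate P A₁ A₂ μ S i h) (τ : Fin N → ℝ) (l : Fin N) :
    ∫ ω, inner ℝ (u ω) (netUpdate τ S i ω (h ω) l) ∂P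
      = τ l * (1 - r l) * ∫ ω, inner ℝ (u ω) (h ω l) ∂P := by
  have hφ := isIterate_phi (hE i) l
  have hle : past A₁ A₂ μ S i ≤ past A₁ A₂ μ S i
      ⊔ MeasurableSpace.comap (fun ω => S.gradHat l i (phi A₁ A₂ μ S i l ω) ω) inferInstance :=
    le_sup_left
  have hhl : MemLp (fun ω => h ω l) 4 P := hh.2.eval l
  have hint : Integrable (fun ω => ‖u ω‖ * ‖h ω l‖) P :=
    (hu.2.norm.mono_exponent (p := 2) (by norm_num)).integrable_mul
      (hhl.norm.mono_exponent (p := 2) (by norm_num))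
  have h1 := integral_inner_gam hS hI hr hφ l (hu.1.mono hle le_rfl)
    (((measurable_pi_apply l).comp hh.1).mono hle le_rfl) hint
  simp only [netUpdate, inner_smul_right]
  rw [integral_const_mul, mul_assoc]
  exact congrArg (τ l * ·) h1

end Moments

/-! ### Long-term bounds -/

section Recursion

/-- A sequence contracted by `1 - θ` up to a constant `c` is eventually at most `c / θ`, up to any
positive margin. -/
lemma eventually_le_of_recursion {a : ℕ → ℝ} {θ c η : ℝ} (hθ : 0 < θ) (hθ1 : θ ≤ 1) (hη : 0 < η)
    (h : ∀ᶠ i in atTop, a (i + 1) ≤ (1 - θ) * a i + c) : ∀ᶠ i in atTop, a i ≤ c / θ + η := by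
  obtain ⟨i₁, hi₁⟩ := eventually_atTop.1 h
  have hn : ∀ n, a (i₁ + n) - c / θ ≤ (1 - θ) ^ n * (a i₁ - c / θ) := fun n => by
    induction n with
    | zero => simp
    | succ n ih =>
      have h1 := hi₁ (i₁ + n) (Nat.le_add_right _ _)
      have h2 := mul_le_mul_of_nonneg_left ih (by linarith : 0 ≤ 1 - θ)
      have h3 : θ * (c / θ) = c := mul_div_cancel₀ _ hθ.ne'
      rw [pow_succ]
      have h4 : i₁ + (n + 1) = i₁ + n + 1 := rfl
      rw [h4]
      nlinarith
  have ht : Tendsto (fun n : ℕ => (1 - θ) ^ n * (a i₁ - c / θ)) atTop (nhds 0) := by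
    have := (tendsto_pow_atTop_nhds_zero_of_lt_one (by linarith : 0 ≤ 1 - θ)
      (by linarith)).mul_const (a i₁ - c / θ)
    rwa [zero_mul] at this
  obtain ⟨n₀, hn₀⟩ := eventually_atTop.1 (ht.eventually_lt_const hη)
  refine eventually_atTop.2 ⟨i₁ + n₀, fun i hi => ?_⟩
  have h1 := hn (i - i₁)
  have h2 := hn₀ (i - i₁) (by omega)
  rw [Nat.add_sub_cancel' (by omega)] at h1
  linarith

end Recursion

section LongTerm

variable {N M : ℕ} {A₁ A₂ : Matrix (Fin N) (Fin N) ℝ} {τ : Fin N → ℝ}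
  {J : Fin N → Vec M → ℝ} {wo : Vec M} {ν δ : ℝ} {r β σ : Fin N → ℝ}

lemma exists_update_rate [NeZero N] (hr : ∀ k, 0 ≤ r k ∧ r k < 1) (hτ : ∀ k, 0 < τ k) :
    ∃ ρ₀ > 0, ∀ l, ρ₀ ≤ τ l * (1 - r l) := by
  obtain ⟨l, hl⟩ := Finite.exists_min fun l => τ l * (1 - r l)
  exact ⟨_, mul_pos (hτ l) (by linarith [(hr l).2]), hl⟩

lemma mul_one_sub_le_one (hr : ∀ k, 0 ≤ r k ∧ r k < 1) (hτ1 : ∀ k, τ k ≤ 1)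
    (l : Fin N) : τ l * (1 - r l) ≤ 1 :=
  mul_le_one₀ (hτ1 l) (by linarith [(hr l).2]) (by linarith [(hr l).1])

/-- Fourth-order drift of any network process that is driven by a restoring field and by the
gradient noise of the diffusion strategy. -/
theorem exists_fourth_moment_drift [NeZero N] (Sq : Splitting M (A₁ * A₂))
    (hA₁ : A₁ ∈ Matrix.colStochastic ℝ (Fin N)) (hA₂ : A₂ ∈ Matrix.colStochastic ℝ (Fin N))
    (hJ : ∀ k, HessianBounds (J k) ν δ) (hν : 0 < ν) (hr : ∀ k, 0 ≤ r k ∧ r k < 1)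
    (hτ : ∀ k, 0 < τ k) (hτ1 : ∀ k, τ k ≤ 1) {G : Fin N → Vec M → Vec M} {D : ℝ} (hD : 0 ≤ D)
    (hG : ∀ l, RestoringField (G l) ν D) :
    ∃ a > 0, ∃ b, 0 ≤ b ∧ ∃ μ₁ > 0, ∀ μmax, 0 < μmax → μmax < μ₁ →
      ∀ {μ : Fin N → ℝ} {Ω : Type*} [MeasurableSpace Ω] {P : Measure Ω} [IsProbabilityMeasure P]
        {S : Inputs N M Ω}, S.Regular P → IndicatorConditions P A₁ A₂ μ r S →
        NoiseConditions P A₁ A₂ μ J β σ S → (∀ i k, MemLp (est A₁ A₂ μ S i k) 4 P) →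
        ∀ (i : ℕ) (X : Ω → Fin N → Vec M), IsIterate P A₁ A₂ μ S i X →
          ∫ ω, Sq.lyap 4 (Splitting.step A₁ A₂ μmax (X ω) (netUpdate τ S i ω fun l =>
              G l (combine A₁ (X ω) l) - noiseState A₁ A₂ μ J S i ω l)) ∂P
            ≤ (1 - a * μmax) * ∫ ω, Sq.lyap 4 (X ω) ∂P
              + b * μmax ^ 3 * ∫ ω, ‖noiseState A₁ A₂ μ J S i ω‖ ^ 4 ∂P := by
  obtain ⟨ρ₀, hρ₀, hρ⟩ := exists_update_rate hr hτ
  obtain ⟨a, ha, b, hb, μ₁, hμ₁, hstep⟩ := exists_fourth_moment_step Sq hA₁ hA₂ hν hD hG hρ₀ hρ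
    (mul_one_sub_le_one hr hτ1)
  refine ⟨a, ha, b, hb, μ₁, hμ₁, ?_⟩
  intro μmax hμ hμlt μ Ω _ P _ S hS hI hn hE i X hX
  have hs : MemLp (noiseState A₁ A₂ μ J S i) 4 P := memLp_noiseState hE hn i
  have hf := memLp_field hG A₁ hX.2
  have hu : IsIterate P A₁ A₂ μ S i fun ω => Sq.cen (X ω) :=
    ⟨Sq.continuous_cen.measurable.comp hX.1,
      hX.2.of_le (Sq.continuous_cen.comp_aestronglyMeasurable hX.2.1)
        (Eventually.of_forall fun ω => Sq.norm_cen_le _)⟩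
  refine hstep μmax hμ hμlt P X _ (fun ω => ‖noiseState A₁ A₂ μ J S i ω‖) hX.2
    (memLp_netUpdate hS hI τ i (hf.sub hs)).1 hs.norm (fun ω => norm_nonneg _)
    (fun ω l => ?_) (fun l => ?_)
  · refine (norm_netUpdate_le (fun k => (hτ k).le) hτ1 (fun k m => hI.zero_or_one k i m ω) _ l).trans
      ((norm_sub_le _ _).trans (add_le_add ((hG l).norm_le _) ?_))
    exact norm_le_pi_norm (noiseState A₁ A₂ μ J S i ω) l
  · exact integral_decoupled_four hS hI (fun k => (hr k).1) hE hn hJ i hu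
      ⟨measurable_field hG A₁ hX.1, hf⟩ τ l

/-- Second-order drift of any network process that is driven by a restoring field and by a
disturbance determined by the past. -/
theorem exists_second_moment_drift [NeZero N] (Sq : Splitting M (A₁ * A₂))
    (hA₁ : A₁ ∈ Matrix.colStochastic ℝ (Fin N)) (hA₂ : A₂ ∈ Matrix.colStochastic ℝ (Fin N))
    (hν : 0 < ν) (hr : ∀ k, 0 ≤ r k ∧ r k < 1)
    (hτ : ∀ k, 0 < τ k) (hτ1 : ∀ k, τ k ≤ 1) {G : Fin N → Vec M → Vec M} {D : ℝ} (hD : 0 ≤ D)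
    (hG : ∀ l, RestoringField (G l) ν D) :
    ∃ a > 0, ∃ b, 0 ≤ b ∧ ∃ μ₁ > 0, ∀ μmax, 0 < μmax → μmax < μ₁ →
      ∀ {μ : Fin N → ℝ} {Ω : Type*} [MeasurableSpace Ω] {P : Measure Ω} [IsProbabilityMeasure P]
        {S : Inputs N M Ω}, S.Regular P → IndicatorConditions P A₁ A₂ μ r S →
        (∀ i k, MemLp (est A₁ A₂ μ S i k) 4 P) →
        ∀ (i : ℕ) (X e : Ω → Fin N → Vec M), IsIterate P A₁ A₂ μ S i X →
          IsIterate P A₁ A₂ μ S i e →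
          ∫ ω, Sq.lyap 2 (Splitting.step A₁ A₂ μmax (X ω) (netUpdate τ S i ω fun l =>
              G l (combine A₁ (X ω) l) + e ω l)) ∂P
            ≤ (1 - a * μmax) * ∫ ω, Sq.lyap 2 (X ω) ∂P + b * μmax * ∫ ω, ‖e ω‖ ^ 2 ∂P := by
  obtain ⟨ρ₀, hρ₀, hρ⟩ := exists_update_rate hr hτ
  obtain ⟨a, ha, b, hb, μ₁, hμ₁, hstep⟩ := exists_second_moment_step Sq hA₁ hA₂ hν hD hG hρ₀ hρ
    (mul_one_sub_le_one hr hτ1)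
  refine ⟨a, ha, b, hb, μ₁, hμ₁, ?_⟩
  intro μmax hμ hμlt μ Ω _ P _ S hS hI hE i X e hX he
  have hf := memLp_field hG A₁ hX.2
  have hu : IsIterate P A₁ A₂ μ S i fun ω => Sq.cen (X ω) :=
    ⟨Sq.continuous_cen.measurable.comp hX.1,
      hX.2.of_le (Sq.continuous_cen.comp_aestronglyMeasurable hX.2.1)
        (Eventually.of_forall fun ω => Sq.norm_cen_le _)⟩
  refine hstep μmax hμ hμlt P X e _ (fun ω => ‖e ω‖) (hX.2.mono_exponent (by norm_num)) he.2.1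
    (memLp_netUpdate hS hI τ i (hf.add he.2)).1 (he.2.norm.mono_exponent (by norm_num))
    (fun ω l => norm_le_pi_norm (e ω) l) (fun ω l => ?_) (fun l => ?_)
  · refine (norm_netUpdate_le (fun k => (hτ k).le) hτ1 (fun k m => hI.zero_or_one k i m ω) _ l).trans
      ((norm_add_le _ _).trans (add_le_add ((hG l).norm_le _) ?_))
    exact norm_le_pi_norm (e ω) l
  · exact integral_decoupled_two hS hI (fun k => (hr k).1) hE i hu
      ⟨(measurable_field hG A₁ hX.1).add he.1, hf.add he.2⟩ τ l

end LongTerm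

section Difference

variable {N M : ℕ} {A₁ A₂ : Matrix (Fin N) (Fin N) ℝ} {μ τ : Fin N → ℝ} {μmax : ℝ}
  {J : Fin N → Vec M → ℝ} {wo : Vec M} {ν δ : ℝ} {S : Inputs N M Ω} {i₀ : ℕ}
  {w' : ℕ → Ω → BVec N M}

lemma continuous_blocks : Continuous (blocks : BVec N M → Fin N → Vec M) :=
  continuous_pi fun k => (PiLp.continuous_toLp 2 _).comp
    (continuous_pi fun m => (EuclideanSpace.proj (𝕜 := ℝ) (k, m)).continuous)

lemma norm_sq_eq_sum_blocks (x : BVec N M) : ‖x‖ ^ 2 = ∑ k, ‖blocks x k‖ ^ 2 := by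
  simp only [EuclideanSpace.norm_sq_eq, Fintype.sum_prod_type, blocks, block]

lemma norm_blocks_le (x : BVec N M) : ‖blocks x‖ ≤ ‖x‖ := by
  refine (pi_norm_le_iff_of_nonneg (norm_nonneg x)).2 fun k => ?_
  refine le_of_sq_le_sq ?_ (norm_nonneg x)
  rw [norm_sq_eq_sum_blocks]
  exact Finset.single_le_sum (f := fun k => ‖blocks x k‖ ^ 2) (fun _ _ => by positivity)
    (Finset.mem_univ k)

/-- The error that the linearization of the gradients commits at the current estimates. -/
def linError (A₁ A₂ : Matrix (Fin N) (Fin N) ℝ) (μ : Fin N → ℝ) (J : Fin N → Vec M → ℝ)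
    (wo : Vec M) (S : Inputs N M Ω) (i : ℕ) (ω : Ω) : Fin N → Vec M :=
  fun l => gradField J wo l (combine A₁ (netState A₁ A₂ μ wo S i ω) l)
    - hessField J wo l (combine A₁ (netState A₁ A₂ μ wo S i ω) l)

/-- The difference between the network errors and the long-term model. -/
def modelGap (A₁ A₂ : Matrix (Fin N) (Fin N) ℝ) (μ : Fin N → ℝ) (wo : Vec M) (S : Inputs N M Ω)
    (w' : ℕ → Ω → BVec N M) (i : ℕ) (ω : Ω) : Fin N → Vec M :=
  netState A₁ A₂ μ wo S i ω - blocks (w' i ω)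

lemma norm_linError_sq_le [NeZero N] (Sq : Splitting M (A₁ * A₂))
    (hA₁ : A₁ ∈ Matrix.colStochastic ℝ (Fin N)) {c : ℝ} (hc : 0 ≤ c)
    (hlin : ∀ l x, ‖gradField J wo l x - hessField J wo l x‖ ≤ c * ‖x‖ ^ 2) (i : ℕ) (ω : Ω) :
    ‖linError A₁ A₂ μ J wo S i ω‖ ^ 2 ≤ 8 * c ^ 2 * Sq.lyap 4 (netState A₁ A₂ μ wo S i ω) := by
  set x := netState A₁ A₂ μ wo S i ω with hx
  have h1 : ‖linError A₁ A₂ μ J wo S i ω‖ ≤ c * (‖Sq.cen x‖ + Sq.dis x) ^ 2 := by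
    refine (pi_norm_le_iff_of_nonneg (by positivity)).2 fun l => (hlin l _).trans ?_
    exact mul_le_mul_of_nonneg_left
      (pow_le_pow_left₀ (norm_nonneg _) (Sq.norm_combine_le hA₁ x l) 2) hc
  calc _ ≤ (c * (‖Sq.cen x‖ + Sq.dis x) ^ 2) ^ 2 := pow_le_pow_left₀ (norm_nonneg _) h1 2
    _ = c ^ 2 * (‖Sq.cen x‖ + Sq.dis x) ^ 4 := by ring
    _ ≤ c ^ 2 * (8 * Sq.lyap 4 x) :=
        mul_le_mul_of_nonneg_left (add_pow_four_le _ _) (sq_nonneg c)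
    _ = _ := by ring

variable [mΩ : MeasurableSpace Ω] {P : Measure Ω}

lemma blocks_model_succ (hμ : ∀ k, μ k = τ k * μmax)
    (hw : IsLongTermModel P A₁ A₂ μ J wo S i₀ w') {i : ℕ} (hi : i₀ ≤ i) (ω : Ω) :
    blocks (w' (i + 1) ω) = Splitting.step A₁ A₂ μmax (blocks (w' i ω))
        (netUpdate τ S i ω fun l => hessField J wo l (combine A₁ (blocks (w' i ω)) l)
          - noiseState A₁ A₂ μ J S i ω l) := by
  rw [hw.step i hi ω, blocks_model_step hμ]

/-- The gradient noise cancels in the recursion for the difference. -/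
lemma modelGap_succ (hA₁ : A₁ ∈ Matrix.colStochastic ℝ (Fin N))
    (hA₂ : A₂ ∈ Matrix.colStochastic ℝ (Fin N)) (hμ : ∀ k, μ k = τ k * μmax)
    (hw : IsLongTermModel P A₁ A₂ μ J wo S i₀ w') {i : ℕ} (hi : i₀ ≤ i) (ω : Ω) :
    modelGap A₁ A₂ μ wo S w' (i + 1) ω
      = Splitting.step A₁ A₂ μmax (modelGap A₁ A₂ μ wo S w' i ω) (netUpdate τ S i ω fun l =>
          hessField J wo l (combine A₁ (modelGap A₁ A₂ μ wo S w' i ω) l)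
            + linError A₁ A₂ μ J wo S i ω l) := by
  rw [modelGap, netState_succ (J := J) hA₁ hA₂ hμ, blocks_model_succ hμ hw hi, ← step_sub,
    ← netUpdate_sub]
  congr 2
  funext l
  simp only [Pi.sub_apply, modelGap, combine_sub, linError, hessField, map_sub]
  abel

variable [IsProbabilityMeasure P]

lemma isIterate_netState (hE : ∀ i k, MemLp (est A₁ A₂ μ S i k) 4 P) (i : ℕ) :
    IsIterate P A₁ A₂ μ S i (netState A₁ A₂ μ wo S i) :=
  ⟨measurable_netState i, memLp_netState hE i⟩

lemma isIterate_linError (hE : ∀ i k, MemLp (est A₁ A₂ μ S i k) 4 P)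
    (hG : ∀ l, RestoringField (gradField J wo l) ν |δ|)
    (hH : ∀ l, RestoringField (hessField J wo l) ν |δ|) (i : ℕ) :
    IsIterate P A₁ A₂ μ S i (linError A₁ A₂ μ J wo S i) :=
  ⟨(measurable_field hG A₁ (measurable_netState i)).sub
      (measurable_field hH A₁ (measurable_netState i)),
    (memLp_field hG A₁ (memLp_netState hE i)).sub (memLp_field hH A₁ (memLp_netState hE i))⟩

lemma isIterate_modelGap {r : Fin N → ℝ} (hA₁ : A₁ ∈ Matrix.colStochastic ℝ (Fin N))
    (hA₂ : A₂ ∈ Matrix.colStochastic ℝ (Fin N)) (hμ : ∀ k, μ k = τ k * μmax) (hS : S.Regular P)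
    (hI : IndicatorConditions P A₁ A₂ μ r S)
    (hE : ∀ i k, MemLp (est A₁ A₂ μ S i k) 4 P)
    (hG : ∀ l, RestoringField (gradField J wo l) ν |δ|)
    (hH : ∀ l, RestoringField (hessField J wo l) ν |δ|)
    (hw : IsLongTermModel P A₁ A₂ μ J wo S i₀ w') {i : ℕ} (hi : i₀ ≤ i) :
    IsIterate P A₁ A₂ μ S i (modelGap A₁ A₂ μ wo S w' i) := by
  induction i, hi using Nat.le_induction with
  | base =>
    have hb : MemLp (fun ω => blocks (w' i₀ ω)) 4 P :=
      hw.start.2.of_le (continuous_blocks.comp_aestronglyMeasurable hw.start.2.1)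
        (Eventually.of_forall fun ω => norm_blocks_le _)
    exact ⟨(measurable_netState i₀).sub (continuous_blocks.measurable.comp hw.start.1),
      (memLp_netState hE i₀).sub hb⟩
  | succ i hi ih =>
    have he := isIterate_linError hE hG hH i
    have hle := past_mono (A₁ := A₁) (A₂ := A₂) (μ := μ) (S := S) (Nat.le_succ i)
    have hfun : modelGap A₁ A₂ μ wo S w' (i + 1) = _ :=
      funext fun ω => modelGap_succ hA₁ hA₂ hμ hw hi ω
    rw [hfun]
    have hf : IsIterate P A₁ A₂ μ S i fun ω l =>
        hessField J wo l (combine A₁ (modelGap A₁ A₂ μ wo S w' i ω) l)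
          + linError A₁ A₂ μ J wo S i ω l :=
      ⟨(measurable_field hH A₁ ih.1).add he.1, (memLp_field hH A₁ ih.2).add he.2⟩
    refine ⟨?_, memLp_step A₁ A₂ μmax ih.2 (memLp_netUpdate hS hI τ i hf.2)⟩
    exact measurable_step_netUpdate A₁ A₂ μmax τ (fun k m => measurable_past_ind i k m)
      (ih.1.mono hle le_rfl) (hf.1.mono hle le_rfl)

/-- The model is determined by the past because the network error and the difference are. -/
lemma isIterate_blocks {r : Fin N → ℝ} (hA₁ : A₁ ∈ Matrix.colStochastic ℝ (Fin N))
    (hA₂ : A₂ ∈ Matrix.colStochastic ℝ (Fin N)) (hμ : ∀ k, μ k = τ k * μmax) (hS : S.Regular P)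
    (hI : IndicatorConditions P A₁ A₂ μ r S)
    (hE : ∀ i k, MemLp (est A₁ A₂ μ S i k) 4 P)
    (hG : ∀ l, RestoringField (gradField J wo l) ν |δ|)
    (hH : ∀ l, RestoringField (hessField J wo l) ν |δ|)
    (hw : IsLongTermModel P A₁ A₂ μ J wo S i₀ w') {i : ℕ} (hi : i₀ ≤ i) :
    IsIterate P A₁ A₂ μ S i fun ω => blocks (w' i ω) := by
  have h := isIterate_modelGap hA₁ hA₂ hμ hS hI hE hG hH hw hi
  have e : (fun ω => blocks (w' i ω))
      = netState A₁ A₂ μ wo S i - modelGap A₁ A₂ μ wo S w' i := by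
    funext ω
    rw [Pi.sub_apply, modelGap, sub_sub_cancel]
  rw [e]
  exact ⟨(measurable_netState i).sub h.1, (memLp_netState hE i).sub h.2⟩

end Difference

section Bounds

variable {N M : ℕ} {A₁ A₂ : Matrix (Fin N) (Fin N) ℝ} {τ : Fin N → ℝ}
  {J : Fin N → Vec M → ℝ} {wo : Vec M} {ν δ : ℝ} {r β σ : Fin N → ℝ}

lemma integrable_lyap [NeZero N] {Ω : Type*} [MeasurableSpace Ω] {P : Measure Ω}
    {Q : Matrix (Fin N) (Fin N) ℝ} (Sq : Splitting M Q) {X : Ω → Fin N → Vec M} {n : ℕ}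
    (hX : AEStronglyMeasurable X P) (hXn : Integrable (fun ω => ‖X ω‖ ^ n) P) :
    Integrable (fun ω => Sq.lyap n (X ω)) P := by
  refine (hXn.const_mul (1 + Sq.bound ^ n)).mono'
    ((Sq.continuous_lyap n).comp_aestronglyMeasurable hX) (Eventually.of_forall fun ω => ?_)
  rw [Real.norm_of_nonneg (Sq.lyap_nonneg n _)]
  exact Sq.lyap_le n _

/-- For small step-sizes, the fourth-order Lyapunov functions of the network error and of the model
are eventually `O(μ²)`, and so is the second-order Lyapunov function of their difference. -/
theorem exists_eventual_bounds [NeZero N] (Sq : Splitting M (A₁ * A₂))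
    (hA₁ : A₁ ∈ Matrix.colStochastic ℝ (Fin N)) (hA₂ : A₂ ∈ Matrix.colStochastic ℝ (Fin N))
    (hwo : ∀ k, IsMinOn (J k) Set.univ wo) (hν : 0 < ν) (hJ : ∀ k, HessianBounds (J k) ν δ)
    {κ ε : ℝ} (hκ : 0 ≤ κ) (hε : 0 < ε) (hLip : ∀ k, HessianLocallyLipschitz (J k) wo κ ε)
    (hr : ∀ k, 0 ≤ r k ∧ r k < 1) (hτ : ∀ k, 0 < τ k) (hτ1 : ∀ k, τ k ≤ 1) :
    ∃ C, 0 ≤ C ∧ ∃ μ₁ > 0, ∀ μmax, 0 < μmax → μmax < μ₁ →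
      ∀ {μ : Fin N → ℝ} {Ω : Type*} [MeasurableSpace Ω] {P : Measure Ω} [IsProbabilityMeasure P]
        {S : Inputs N M Ω}, (∀ k, μ k = τ k * μmax) → S.Regular P →
        IndicatorConditions P A₁ A₂ μ r S → NoiseConditions P A₁ A₂ μ J β σ S →
        ∀ {i₀ : ℕ} {w' : ℕ → Ω → BVec N M}, IsLongTermModel P A₁ A₂ μ J wo S i₀ w' →
          (∀ i, MemLp (netState A₁ A₂ μ wo S i) 4 P) ∧
          (∀ i, i₀ ≤ i → MemLp (fun ω => blocks (w' i ω)) 4 P) ∧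
          (∀ᶠ i in atTop, ∫ ω, Sq.lyap 4 (netState A₁ A₂ μ wo S i ω) ∂P ≤ C * μmax ^ 2) ∧
          (∀ᶠ i in atTop, ∫ ω, Sq.lyap 4 (blocks (w' i ω)) ∂P ≤ C * μmax ^ 2) ∧
          (∀ᶠ i in atTop, ∫ ω, Sq.lyap 2 (modelGap A₁ A₂ μ wo S w' i ω) ∂P ≤ C * μmax ^ 2) := by
  have hG : ∀ l, RestoringField (gradField J wo l) ν |δ| := fun l =>
    (hJ l).restoringField_gradient hν.le (hwo l)
  have hH : ∀ l, RestoringField (hessField J wo l) ν |δ| := fun l =>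
    (hJ l).restoringField_hessian hν.le wo
  obtain ⟨a, ha, b, hb, μa, hμa, hreal⟩ := exists_fourth_moment_drift (β := β) (σ := σ) Sq hA₁ hA₂
    hJ hν hr hτ hτ1 (abs_nonneg δ) hG
  obtain ⟨a', ha', b', hb', μb, hμb, hmodel⟩ := exists_fourth_moment_drift (β := β) (σ := σ) Sq
    hA₁ hA₂ hJ hν hr hτ hτ1 (abs_nonneg δ) hH
  obtain ⟨a'', ha'', b'', hb'', μc, hμc, hgap⟩ := exists_second_moment_drift Sq hA₁ hA₂
    hν hr hτ hτ1 (abs_nonneg δ) hH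
  set c₁ : ℝ := ∑ l, 64 * β l ^ 4 with hc₁
  set c₂ : ℝ := ∑ l, (8 * β l ^ 4 * ‖wo‖ ^ 4 + σ l ^ 4) with hc₂
  have hc₁0 : 0 ≤ c₁ := Finset.sum_nonneg fun l _ => by positivity
  have hc₂0 : 0 ≤ c₂ := Finset.sum_nonneg fun l _ => by positivity
  set c : ℝ := κ + 2 * |δ| / ε with hc
  have hc0 : 0 ≤ c := by positivity
  set C₁ : ℝ := 2 * b * c₂ / a + 1 with hC₁
  set C₂ : ℝ := b' * (c₁ * C₁ + c₂) / a' + 1 with hC₂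
  set C₃ : ℝ := b'' * (8 * c ^ 2 * C₁) / a'' + 1 with hC₃
  have hC₁0 : 0 ≤ C₁ := by positivity
  have hC₂0 : 0 ≤ C₂ := by positivity
  have hC₃0 : 0 ≤ C₃ := by positivity
  refine ⟨C₁ + C₂ + C₃, by positivity, min (min μa (min μb μc)) (min 1 (min (a / (2 * (b * c₁ + 1)))
    (min (1 / a) (min (1 / a') (1 / a''))))), ?_, ?_⟩
  · exact lt_min (lt_min hμa (lt_min hμb hμc)) (lt_min one_pos (lt_min (by positivity)
      (lt_min (by positivity) (lt_min (by positivity) (by positivity)))))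
  intro μmax hμ hμlt μ Ω _ P _ S hμτ hS hI hn i₀ w' hw
  simp only [lt_min_iff] at hμlt
  obtain ⟨⟨hlta, hltb, hltc⟩, hlt1, hlt2, hlt3, hlt4, hlt5⟩ := hμlt
  rw [lt_div_iff₀ (by positivity)] at hlt2 hlt3 hlt4 hlt5
  have hμ2 : 0 < μmax ^ 2 := by positivity
  have hE : ∀ i k, MemLp (est A₁ A₂ μ S i k) 4 P := memLp_est hS hI hn hJ hν.le hwo
  have hX := memLp_netState (wo := wo) hE
  have hnoise := fun i => integral_noiseState_le (wo := wo) Sq hA₁ hS hE hn i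
  have hX' : ∀ i, i₀ ≤ i → IsIterate P A₁ A₂ μ S i fun ω => blocks (w' i ω) := fun i hi =>
    isIterate_blocks hA₁ hA₂ hμτ hS hI hE hG hH hw hi
  have hZ : ∀ i, i₀ ≤ i → IsIterate P A₁ A₂ μ S i (modelGap A₁ A₂ μ wo S w' i) := fun i hi =>
    isIterate_modelGap hA₁ hA₂ hμτ hS hI hE hG hH hw hi
  -- the noise grows with the error, but its contribution `μ³` is absorbed by the contraction `μ`
  have h₁ : ∀ᶠ i in atTop, ∫ ω, Sq.lyap 4 (netState A₁ A₂ μ wo S i ω) ∂P ≤ C₁ * μmax ^ 2 := by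
    have hrec : ∀ᶠ i in atTop, ∫ ω, Sq.lyap 4 (netState A₁ A₂ μ wo S (i + 1) ω) ∂P
        ≤ (1 - a / 2 * μmax) * ∫ ω, Sq.lyap 4 (netState A₁ A₂ μ wo S i ω) ∂P
          + b * c₂ * μmax ^ 3 := Eventually.of_forall fun i => by
      have h := hreal μmax hμ hlta hS hI hn hE i _ (isIterate_netState (wo := wo) hE i)
      simp only [← netState_succ hA₁ hA₂ hμτ] at h
      have h0 : 0 ≤ ∫ ω, Sq.lyap 4 (netState A₁ A₂ μ wo S i ω) ∂P :=
        integral_nonneg fun ω => Sq.lyap_nonneg 4 _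
      have h2 := mul_le_mul_of_nonneg_left (hnoise i) (by positivity : 0 ≤ b * μmax ^ 3)
      have h3 : b * c₁ * μmax ^ 3 ≤ a / 2 * μmax := by
        have h4 : b * c₁ * μmax ^ 2 ≤ a / 2 := by
          nlinarith [mul_nonneg (mul_nonneg hb hc₁0) hμ.le]
        nlinarith
      have h5 := mul_le_mul_of_nonneg_right h3 h0
      linarith
    have hev := eventually_le_of_recursion (a := fun i => ∫ ω, Sq.lyap 4 (netState A₁ A₂ μ wo S i ω) ∂P)
      (θ := a / 2 * μmax) (by positivity) (by linarith) hμ2 hrec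
    filter_upwards [hev] with i hi
    refine hi.trans (le_of_eq ?_)
    rw [hC₁]; field_simp
  have h₂ : ∀ᶠ i in atTop, ∫ ω, Sq.lyap 4 (blocks (w' i ω)) ∂P ≤ C₂ * μmax ^ 2 := by
    have hrec : ∀ᶠ i in atTop, ∫ ω, Sq.lyap 4 (blocks (w' (i + 1) ω)) ∂P
        ≤ (1 - a' * μmax) * ∫ ω, Sq.lyap 4 (blocks (w' i ω)) ∂P
          + b' * (c₁ * C₁ + c₂) * μmax ^ 3 := by
      filter_upwards [h₁, eventually_ge_atTop i₀] with i hi₁ hi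
      have h := hmodel μmax hμ hltb hS hI hn hE i _ (hX' i hi)
      simp only [← blocks_model_succ hμτ hw hi] at h
      have h2 : ∫ ω, ‖noiseState A₁ A₂ μ J S i ω‖ ^ 4 ∂P ≤ c₁ * C₁ + c₂ := by
        refine (hnoise i).trans (add_le_add_left (mul_le_mul_of_nonneg_left ?_ hc₁0) _)
        refine hi₁.trans (mul_le_of_le_one_right hC₁0 (pow_le_one₀ hμ.le hlt1.le))
      have h3 := mul_le_mul_of_nonneg_left h2 (by positivity : 0 ≤ b' * μmax ^ 3)
      linarith
    have hev := eventually_le_of_recursion (a := fun i => ∫ ω, Sq.lyap 4 (blocks (w' i ω)) ∂P)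
      (θ := a' * μmax) (by positivity) (by linarith) hμ2 hrec
    filter_upwards [hev] with i hi
    refine hi.trans (le_of_eq ?_)
    rw [hC₂]; field_simp
  have h₃ : ∀ᶠ i in atTop, ∫ ω, Sq.lyap 2 (modelGap A₁ A₂ μ wo S w' i ω) ∂P
      ≤ C₃ * μmax ^ 2 := by
    have hrec : ∀ᶠ i in atTop, ∫ ω, Sq.lyap 2 (modelGap A₁ A₂ μ wo S w' (i + 1) ω) ∂P
        ≤ (1 - a'' * μmax) * ∫ ω, Sq.lyap 2 (modelGap A₁ A₂ μ wo S w' i ω) ∂P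
          + b'' * (8 * c ^ 2 * C₁) * μmax ^ 3 := by
      filter_upwards [h₁, eventually_ge_atTop i₀] with i hi₁ hi
      have h := hgap μmax hμ hltc hS hI hE i _ _ (hZ i hi) (isIterate_linError hE hG hH i)
      simp only [← modelGap_succ hA₁ hA₂ hμτ hw hi] at h
      have h2 : ∫ ω, ‖linError A₁ A₂ μ J wo S i ω‖ ^ 2 ∂P ≤ 8 * c ^ 2 * (C₁ * μmax ^ 2) := by
        refine le_trans ?_ (mul_le_mul_of_nonneg_left hi₁ (by positivity))
        rw [← integral_const_mul]
        refine integral_mono_of_nonneg (Eventually.of_forall fun ω => sq_nonneg _)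
          ((integrable_lyap Sq (hX i).1 (integrable_pow_four (hX i).norm)).const_mul _)
          (Eventually.of_forall fun ω => ?_)
        exact norm_linError_sq_le Sq hA₁ hc0 (fun l x =>
          (hJ l).linearization_error_le hν.le (hwo l) hκ hε (hLip l) x) i ω
      have h3 := mul_le_mul_of_nonneg_left h2 (by positivity : 0 ≤ b'' * μmax)
      linarith
    have hev := eventually_le_of_recursion (a := fun i => ∫ ω, Sq.lyap 2 (modelGap A₁ A₂ μ wo S w' i ω) ∂P)
      (θ := a'' * μmax) (by positivity) (by linarith) hμ2 hrec
    filter_upwards [hev] with i hi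
    refine hi.trans (le_of_eq ?_)
    rw [hC₃]; field_simp
  refine ⟨hX, fun i hi => (hX' i hi).2, ?_, ?_, ?_⟩
  · filter_upwards [h₁] with i hi
    exact hi.trans (mul_le_mul_of_nonneg_right (by linarith) hμ2.le)
  · filter_upwards [h₂] with i hi
    exact hi.trans (mul_le_mul_of_nonneg_right (by linarith) hμ2.le)
  · filter_upwards [h₃] with i hi
    exact hi.trans (mul_le_mul_of_nonneg_right (by linarith) hμ2.le)

end Bounds

/-! ### Asymptotic moments -/

section Limsup

variable {Ω : Type*} [MeasurableSpace Ω] {P : Measure Ω} {E F : Type*} [NormedAddCommGroup E]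
  [NormedAddCommGroup F]

lemma lintegral_enorm_pow {X : Ω → E} {p : ℕ} (hX : Integrable (fun ω => ‖X ω‖ ^ p) P) :
    ∫⁻ ω, ‖X ω‖ₑ ^ p ∂P = ENNReal.ofReal (∫ ω, ‖X ω‖ ^ p ∂P) := by
  rw [ofReal_integral_eq_lintegral_ofReal hX (Eventually.of_forall fun ω => by positivity)]
  refine lintegral_congr fun ω => ?_
  rw [ENNReal.ofReal_pow (norm_nonneg _), ofReal_norm]

lemma limsupMoment_le {X : ℕ → Ω → E} {p : ℕ} {c : ℝ}
    (h : ∀ᶠ i in atTop, Integrable (fun ω => ‖X i ω‖ ^ p) P ∧ ∫ ω, ‖X i ω‖ ^ p ∂P ≤ c) :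
    limsupMoment P p X ≤ ENNReal.ofReal c := by
  refine limsup_le_of_le (by isBoundedDefault) ?_
  filter_upwards [h] with i hi
  rw [lintegral_enorm_pow hi.1]
  exact ENNReal.ofReal_le_ofReal hi.2

lemma limsupMoment_le_add {X : ℕ → Ω → E} {Y : ℕ → Ω → F} {p : ℕ} {c : ℝ}
    (h : ∀ᶠ i in atTop, Integrable (fun ω => ‖X i ω‖ ^ p) P ∧ Integrable (fun ω => ‖Y i ω‖ ^ p) P ∧
      ∫ ω, ‖X i ω‖ ^ p ∂P ≤ ∫ ω, ‖Y i ω‖ ^ p ∂P + c) :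
    limsupMoment P p X ≤ limsupMoment P p Y + ENNReal.ofReal c := by
  unfold limsupMoment
  rw [← limsup_add_const atTop _ _ (by isBoundedDefault) (by isBoundedDefault)]
  refine limsup_le_limsup ?_ (by isBoundedDefault) (by isBoundedDefault)
  filter_upwards [h] with i hi
  rw [lintegral_enorm_pow hi.1, lintegral_enorm_pow hi.2.1]
  exact (ENNReal.ofReal_le_ofReal hi.2.2).trans ENNReal.ofReal_add_le

end Limsup

section Network

variable {N M : ℕ} {Ω : Type*} [MeasurableSpace Ω] {P : Measure Ω} [IsProbabilityMeasure P]

lemma integrable_norm_sq_of_blocks {x : Ω → BVec N M}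
    (hx : MemLp (fun ω => blocks (x ω)) 4 P) : Integrable (fun ω => ‖x ω‖ ^ 2) P := by
  simp only [norm_sq_eq_sum_blocks]
  exact integrable_finsetSum _ fun k _ =>
    ((hx.eval k).norm.mono_exponent (p := 2) (by norm_num)).integrable_sq

/-- `t² ≤ (t⁴ / s + s) / 2` turns a fourth moment of order `s²` into a second moment of order
`s`. -/
lemma integral_norm_sq_le_of_four {E : Type*} [NormedAddCommGroup E] {x : Ω → E}
    (hx : MemLp x 4 P) {c s : ℝ} (hs : 0 < s) (h : ∫ ω, ‖x ω‖ ^ 4 ∂P ≤ c * s ^ 2) :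
    ∫ ω, ‖x ω‖ ^ 2 ∂P ≤ (c + 1) * s := by
  have h4 : Integrable (fun ω => ‖x ω‖ ^ 4) P := integrable_pow_four hx.norm
  have hcs : 0 ≤ c * s := by
    have h0 : 0 ≤ ∫ ω, ‖x ω‖ ^ 4 ∂P := integral_nonneg fun ω => by positivity
    have : 0 ≤ c * s * s := by nlinarith
    exact nonneg_of_mul_nonneg_left this hs
  calc ∫ ω, ‖x ω‖ ^ 2 ∂P ≤ ∫ ω, (1 / (2 * s) * ‖x ω‖ ^ 4 + s / 2 * 1) ∂P := by
        refine integral_mono_of_nonneg (Eventually.of_forall fun ω => by positivity)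
          ((h4.const_mul _).add ((integrable_const _).const_mul _))
          (Eventually.of_forall fun ω => ?_)
        have h0 : 0 ≤ 1 / (2 * s) * (‖x ω‖ ^ 2 - s) ^ 2 := by positivity
        have e : 1 / (2 * s) * (‖x ω‖ ^ 2 - s) ^ 2
            = 1 / (2 * s) * ‖x ω‖ ^ 4 + s / 2 * 1 - ‖x ω‖ ^ 2 := by
          field_simp; ring
        linarith
    _ = 1 / (2 * s) * ∫ ω, ‖x ω‖ ^ 4 ∂P + s / 2 := by
        rw [integral_mul_add_mul h4 (integrable_const _)]
        simp
    _ ≤ 1 / (2 * s) * (c * s ^ 2) + s / 2 := by gcongr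
    _ = c * s / 2 + s / 2 := by field_simp
    _ ≤ _ := by linarith

/-- The second moments of two block vectors agree up to `O(s³)` if they are `O(s²)` and that of the
difference is `O(s⁴)`. -/
lemma integral_norm_sq_le_add {x y : Ω → BVec N M}
    (hx : MemLp (fun ω => blocks (x ω)) 4 P) (hy : MemLp (fun ω => blocks (y ω)) 4 P)
    {s a c : ℝ} (hs : 0 < s) (hs1 : s ≤ 1) (hc : 0 ≤ c) (hya : ∫ ω, ‖y ω‖ ^ 2 ∂P ≤ a * s ^ 2)
    (hxy : ∫ ω, ‖x ω - y ω‖ ^ 2 ∂P ≤ c * s ^ 4) :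
    ∫ ω, ‖x ω‖ ^ 2 ∂P ≤ ∫ ω, ‖y ω‖ ^ 2 ∂P + (a + 2 * c) * s ^ 3 := by
  have hyi := integrable_norm_sq_of_blocks hy
  have hxyi : Integrable (fun ω => ‖x ω - y ω‖ ^ 2) P :=
    integrable_norm_sq_of_blocks (x := fun ω => x ω - y ω) (hx.sub hy)
  have h1 : ∫ ω, ‖x ω‖ ^ 2 ∂P
      ≤ (1 + s) * ∫ ω, ‖y ω‖ ^ 2 ∂P + (1 + 1 / s) * ∫ ω, ‖x ω - y ω‖ ^ 2 ∂P := by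
    rw [← integral_mul_add_mul hyi hxyi]
    refine integral_mono_of_nonneg (Eventually.of_forall fun ω => by positivity)
      ((hyi.const_mul _).add (hxyi.const_mul _)) (Eventually.of_forall fun ω => ?_)
    have h2 : ‖x ω‖ ≤ ‖y ω‖ + ‖x ω - y ω‖ := by
      have := norm_add_le (y ω) (x ω - y ω)
      rwa [add_sub_cancel] at this
    have h3 : ‖x ω‖ ^ 2 ≤ (‖y ω‖ + ‖x ω - y ω‖) ^ 2 := pow_le_pow_left₀ (norm_nonneg _) h2 2
    have h0 : 0 ≤ 1 / s * (s * ‖y ω‖ - ‖x ω - y ω‖) ^ 2 := by positivity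
    have e : 1 / s * (s * ‖y ω‖ - ‖x ω - y ω‖) ^ 2
        = s * ‖y ω‖ ^ 2 - 2 * (‖y ω‖ * ‖x ω - y ω‖) + 1 / s * ‖x ω - y ω‖ ^ 2 := by
      field_simp; ring
    simp only
    linarith
  have h2 := mul_le_mul_of_nonneg_left hya hs.le
  have h3 := mul_le_mul_of_nonneg_left hxy (by positivity : 0 ≤ 1 + 1 / s)
  have e : (1 + 1 / s) * (c * s ^ 4) = c * s ^ 4 + c * s ^ 3 := by field_simp
  have h4 : c * s ^ 4 ≤ c * s ^ 3 :=
    mul_le_mul_of_nonneg_left (pow_le_pow_of_le_one hs.le hs1 (by norm_num)) hc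
  linarith

end Network

end

theorem lemma2 {N M : ℕ} [NeZero N]
    -- left-stochastic combination matrices with a primitive product
    (A₁ A₂ : Matrix (Fin N) (Fin N) ℝ)
    (hA₁ : A₁ ∈ Matrix.colStochastic ℝ (Fin N)) (hA₂ : A₂ ∈ Matrix.colStochastic ℝ (Fin N))
    (hP : (A₁ * A₂).IsPrimitive)
    -- individual costs with a common minimizer
    (J : Fin N → Vec M → ℝ) (wo : Vec M) (hwo : ∀ k, IsMinOn (J k) Set.univ wo)
    (ν δ : ℝ) (hν : 0 < ν) (hJ : ∀ k, HessianBounds (J k) ν δ)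
    (κ ε : ℝ) (hκ : 0 ≤ κ) (hε : 0 < ε)
    (hLip : ∀ k, HessianLocallyLipschitz (J k) wo κ ε)
    -- missing probabilities, and the constants in the bound on the gradient noise
    (r : Fin N → ℝ) (hr : ∀ k, 0 ≤ r k ∧ r k < 1)
    (β σ : Fin N → ℝ)
    -- step-size ratios `τ_k = μ_k / μ_max`
    (τ : Fin N → ℝ) (hτ : ∀ k, 0 < τ k) (hτmax : IsGreatest (Set.range τ) 1) :
    ∃ μo > 0, ∃ C : ℝ, 0 ≤ C ∧ ∀ μmax : ℝ, 0 < μmax → μmax < μo →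
      ∀ (μ : Fin N → ℝ), (∀ k, μ k = τ k * μmax) →
      ∀ (Ω : Type*) [MeasurableSpace Ω] (P : Measure Ω) [IsProbabilityMeasure P]
        (S : Inputs N M Ω), S.Regular P →
        IndicatorConditions P A₁ A₂ μ r S →
        NoiseConditions P A₁ A₂ μ J β σ S →
      ∀ (i₀ : ℕ) (w' : ℕ → Ω → BVec N M), IsLongTermModel P A₁ A₂ μ J wo S i₀ w' →
        -- second and fourth moments of the long-term model
        (∀ k, limsupMoment P 2 (fun i ω => block k (w' i ω)) ≤ ENNReal.ofReal (C * μmax)) ∧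
        (∀ k, limsupMoment P 4 (fun i ω => block k (w' i ω)) ≤ ENNReal.ofReal (C * μmax ^ 2)) ∧
        -- the steady-state mean-square errors agree up to `O(μ_max^{3/2})`
        limsupMoment P 2 w' ≤
          limsupMoment P 2 (netError A₁ A₂ μ wo S) + ENNReal.ofReal (C * μmax ^ (3 / 2 : ℝ)) ∧
        limsupMoment P 2 (netError A₁ A₂ μ wo S) ≤
          limsupMoment P 2 w' + ENNReal.ofReal (C * μmax ^ (3 / 2 : ℝ)) ∧
        -- the model approximates the error dynamics
        limsupMoment P 2 (fun i ω => netError A₁ A₂ μ wo S i ω - w' i ω) ≤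
          ENNReal.ofReal (C * μmax ^ 2) := by
  have hτ1 : ∀ k, τ k ≤ 1 := fun k => hτmax.2 ⟨k, rfl⟩
  obtain ⟨Sq⟩ := exists_splitting M (mul_mem hA₁ hA₂) hP
  obtain ⟨K, hK, μ₁, hμ₁, hmain⟩ := exists_eventual_bounds (β := β) (σ := σ) Sq hA₁ hA₂ hwo hν hJ
    hκ hε hLip hr hτ hτ1
  have hNK : (0 : ℝ) ≤ N * K := by positivity
  have hN : (0 : ℝ) ≤ N := by positivity
  refine ⟨min 1 μ₁, lt_min one_pos hμ₁, (N + 1) * (8 * K + 1) + 4 * (N * K), by positivity, ?_⟩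
  intro μmax hμ hμlt μ hμτ Ω _ P _ S hS hI hn i₀ w' hw
  obtain ⟨hμ1, hμlt⟩ := lt_min_iff.1 hμlt
  obtain ⟨hX, hX', h₁, h₂, h₃⟩ := hmain μmax hμ hμlt hμτ hS hI hn hw
  set X := netError A₁ A₂ μ wo S with hXdef
  set s := √μmax with hs
  have hs0 : 0 < s := Real.sqrt_pos.2 hμ
  have hs1 : s ≤ 1 := Real.sqrt_le_one.2 hμ1.le
  have hs2 : s ^ 2 = μmax := Real.sq_sqrt hμ.le
  -- with `s = √μmax`, the claimed orders `3/2` and `2` are `s³` and `s⁴`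
  have hs3 : μmax ^ (3 / 2 : ℝ) = s ^ 3 := by
    rw [show (3 / 2 : ℝ) = 1 + 1 / 2 by norm_num, Real.rpow_add hμ, Real.rpow_one,
      ← Real.sqrt_eq_rpow, ← hs]
    nth_rw 1 [← hs2]
    ring
  have hXi : ∀ i, MemLp (fun ω => blocks (X i ω)) 4 P := hX
  have hfour : ∀ {x : Ω → Fin N → Vec M}, MemLp x 4 P →
      ∫ ω, Sq.lyap 4 (x ω) ∂P ≤ K * μmax ^ 2 → ∀ k, ∫ ω, ‖x ω k‖ ^ 4 ∂P ≤ 8 * K * μmax ^ 2 :=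
    fun {x} hx hl k => by
      have h : ∫ ω, ‖x ω k‖ ^ 4 ∂P ≤ 8 * ∫ ω, Sq.lyap 4 (x ω) ∂P := by
        rw [← integral_const_mul]
        exact integral_mono (integrable_pow_four (hx.eval k).norm)
          ((integrable_lyap Sq hx.1 (integrable_pow_four hx.norm)).const_mul _)
          fun ω => Sq.norm_apply_pow_four_le _ k
      linarith
  have htwo : ∀ {x : Ω → Fin N → Vec M}, MemLp x 4 P →
      ∫ ω, Sq.lyap 4 (x ω) ∂P ≤ K * μmax ^ 2 →
      ∀ k, ∫ ω, ‖x ω k‖ ^ 2 ∂P ≤ (8 * K + 1) * μmax :=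
    fun {x} hx hl k => integral_norm_sq_le_of_four (hx.eval k) hμ (hfour hx hl k)
  have hnet : ∀ {x : Ω → BVec N M}, MemLp (fun ω => blocks (x ω)) 4 P → ∀ {c : ℝ},
      (∀ k, ∫ ω, ‖blocks (x ω) k‖ ^ 2 ∂P ≤ c) → ∫ ω, ‖x ω‖ ^ 2 ∂P ≤ N * c :=
    fun {x} hx c hc => by
      simp only [norm_sq_eq_sum_blocks]
      rw [integral_finsetSum _ fun k _ =>
        ((hx.eval k).norm.mono_exponent (p := 2) (by norm_num)).integrable_sq]
      refine (Finset.sum_le_sum fun k _ => hc k).trans (le_of_eq ?_)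
      simp
  have hgap : ∀ᶠ i in atTop, ∫ ω, ‖X i ω - w' i ω‖ ^ 2 ∂P ≤ 2 * (N * K) * μmax ^ 2 := by
    filter_upwards [h₃, eventually_ge_atTop i₀] with i hi hi₀
    have hZ : MemLp (fun ω => blocks (X i ω - w' i ω)) 4 P := (hX i).sub (hX' i hi₀)
    have h := hnet (x := fun ω => X i ω - w' i ω) hZ (c := 2 * (K * μmax ^ 2)) fun k => by
      refine le_trans ?_ (mul_le_mul_of_nonneg_left hi zero_le_two)
      rw [← integral_const_mul]
      refine integral_mono ((hZ.eval k).norm.mono_exponent (p := 2) (by norm_num)).integrable_sq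
        ((integrable_lyap Sq hZ.1 ?_).const_mul _) fun ω => Sq.norm_apply_sq_le _ k
      exact (hZ.norm.mono_exponent (p := 2) (by norm_num)).integrable_sq
    linarith
  have hgap' : ∀ᶠ i in atTop, ∫ ω, ‖X i ω - w' i ω‖ ^ 2 ∂P ≤ 2 * (N * K) * s ^ 4 := by
    filter_upwards [hgap] with i hi
    rwa [← hs2, ← pow_mul] at hi
  have hs30 : 0 ≤ s ^ 3 := by positivity
  refine ⟨fun k => limsupMoment_le ?_, fun k => limsupMoment_le ?_, limsupMoment_le_add ?_,
    limsupMoment_le_add ?_, limsupMoment_le ?_⟩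
  · filter_upwards [h₂, eventually_ge_atTop i₀] with i hi hi₀
    refine ⟨(((hX' i hi₀).eval k).norm.mono_exponent (p := 2) (by norm_num)).integrable_sq,
      (htwo (hX' i hi₀) hi k).trans (mul_le_mul_of_nonneg_right ?_ hμ.le)⟩
    nlinarith [mul_nonneg hN hK]
  · filter_upwards [h₂, eventually_ge_atTop i₀] with i hi hi₀
    refine ⟨integrable_pow_four ((hX' i hi₀).eval k).norm,
      (hfour (hX' i hi₀) hi k).trans (mul_le_mul_of_nonneg_right ?_ (sq_nonneg _))⟩
    nlinarith [mul_nonneg hN hK]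
  · filter_upwards [h₁, hgap', eventually_ge_atTop i₀] with i hi hg hi₀
    refine ⟨integrable_norm_sq_of_blocks (hX' i hi₀), integrable_norm_sq_of_blocks (hXi i), ?_⟩
    have hy := hnet (hXi i) (htwo (hX i) hi)
    simp only [norm_sub_rev (X i _)] at hg
    rw [← hs2, ← mul_assoc] at hy
    refine (integral_norm_sq_le_add (hX' i hi₀) (hXi i) hs0 hs1 (by positivity) hy hg).trans ?_
    rw [hs3]
    refine add_le_add_right (mul_le_mul_of_nonneg_right ?_ hs30) _
    nlinarith
  · filter_upwards [h₂, hgap', eventually_ge_atTop i₀] with i hi hg hi₀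
    refine ⟨integrable_norm_sq_of_blocks (hXi i), integrable_norm_sq_of_blocks (hX' i hi₀), ?_⟩
    have hy := hnet (hX' i hi₀) (htwo (hX' i hi₀) hi)
    rw [← hs2, ← mul_assoc] at hy
    refine (integral_norm_sq_le_add (hXi i) (hX' i hi₀) hs0 hs1 (by positivity) hy hg).trans ?_
    rw [hs3]
    refine add_le_add_right (mul_le_mul_of_nonneg_right ?_ hs30) _
    nlinarith
  · filter_upwards [hgap, eventually_ge_atTop i₀] with i hi hi₀
    refine ⟨integrable_norm_sq_of_blocks (x := fun ω => X i ω - w' i ω)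
      ((hX i).sub (hX' i hi₀)), hi.trans (mul_le_mul_of_nonneg_right ?_ (sq_nonneg _))⟩
    nlinarith
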